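/- Let $G$ be a compact connected metric graph: a finite set of edges $e$, each identified with an interval $[0,|e|]$ with $|e|>0$, whose ends are glued according to a partition of the set of all ends into vertices. For a bounded measurable $q:G\to\mathbb R$ let $\lambda_1(q)<\lambda_2(q)\le\dots$ denote the eigenvalues, counted with multiplicity, of the Schrödinger operator $Hu=-u''+qu$ on $G$ with standard (Kirchhoff) conditions, i.e. acting on functions $u$ that are continuous on $G$, of class $W^{2,2}$ on each edge, and such that at every vertex the derivatives of $u$ along the incident edge ends, directed into the vertex, sum to $0$. Let $\Gamma[q]=\lambda_2(q)-\lambda_1(q)$. A path in $G$ is given by a continuous map $\gamma:[0,1]\to G$ that is injective except that $\gamma(0)=\gamma(1)$ is allowed; $q$ is convex on it if it is convex along $\gamma$ as a function of arc length (a closed path being regarded as an interval cut at $\gamma(0)=\gamma(1)$). Fix a finite family $\mathcal P$ of paths in $G$, a subtree $T\subset G$ (a connected subgraph, possibly of a subdivision of $G$, that contains no cycle), and $M>0$. Let - $C_{G,\mathcal P,M}$ be the set of measurable $q:G\to\mathbb R$ with $0\le q\le M$ on $G$ that are convex on every path in $\mathcal P$; - $SW_{G,T,M}$ be the set of measurable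 $q:G\to\mathbb R$ with $0\le q\le M$ on $G$ that are single-well on $T$, i.e. for which there is a point $a\in T$ such that $q$ is nonincreasing along every path in $T$ from a leaf (a point of degree $1$ in $T$) to $a$. Let $\Lambda$ be either $C_{G,\mathcal P,M}$ or $SW_{G,T,M}$. Then for every $q\in\Lambda$ the eigenvalues $\lambda_1(q)$ and $\lambda_2(q)$ exist, and there are $q_*,q^*\in\Lambda$ with $$\Gamma[q_*]=\min\{\Gamma[q]:q\in\Lambda\},\qquad \Gamma[q^*]=\max\{\Gamma[q]:q\in\Lambda\}.$$ -/

import Mathlib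

open Set Filter Topology MeasureTheory

noncomputable section

/-- A metric graph with edge set `E`: every edge `e` is identified with `[0, len e]`, its two ends
are `(e, false)` (the point `0`) and `(e, true)` (the point `len e`), and the ends of all edges are
partitioned into equivalence classes, the vertices. Loops and multiple edges are allowed. -/
structure MetricGraph (E : Type*) where
  len : E → ℝ
  len_pos : ∀ e, 0 < len e
  vertexSetoid : Setoid (E × Bool)

namespace MetricGraph

variable {E : Type*} (G : MetricGraph E)

/-- The vertices: equivalence classes of ends of edges. -/
abbrev Vertex : Type _ := Quotient G.vertexSetoid

/-- The disjoint union of the edges. -/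
abbrev PrePoint : Type _ := Σ e : E, Icc (0 : ℝ) (G.len e)

/-- The point of the disjoint union of the edges at an end of an edge. -/
def endPoint (a : E × Bool) : G.PrePoint :=
  ⟨a.1, if a.2 then ⟨G.len a.1, right_mem_Icc.2 (G.len_pos a.1).le⟩
    else ⟨0, left_mem_Icc.2 (G.len_pos a.1).le⟩⟩

theorem endPoint_injective : Function.Injective G.endPoint := by
  rintro ⟨e, b⟩ ⟨e', b'⟩ h
  have he : e = e' := congrArg Sigma.fst h
  subst he
  have h2 := eq_of_heq (Sigma.mk.inj h).2
  have hp := G.len_pos e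
  cases b <;> cases b' <;> simp [Subtype.ext_iff] at h2 ⊢ <;> linarith

/-- Two ends of edges are glued together when they belong to the same vertex. -/
def glue : Setoid G.PrePoint where
  r x y := x = y ∨ ∃ a b, G.vertexSetoid a b ∧ x = G.endPoint a ∧ y = G.endPoint b
  iseqv :=
    { refl := fun _ => Or.inl rfl
      symm := by
        rintro x y (rfl | ⟨a, b, h, rfl, rfl⟩)
        · exact Or.inl rfl
        · exact Or.inr ⟨b, a, G.vertexSetoid.symm h, rfl, rfl⟩
      trans := by
        rintro x y z (rfl | ⟨a, b, h, rfl, rfl⟩) (rfl | ⟨c, d, h', hc, rfl⟩)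
        · exact Or.inl rfl
        · exact Or.inr ⟨c, d, h', hc, rfl⟩
        · exact Or.inr ⟨a, b, h, rfl, rfl⟩
        · obtain rfl := G.endPoint_injective hc
          exact Or.inr ⟨a, d, G.vertexSetoid.trans h h', rfl, rfl⟩ }

/-- The points of the metric graph, with the quotient topology. -/
def Point : Type _ := Quotient G.glue

instance : TopologicalSpace G.Point := inferInstanceAs (TopologicalSpace (Quotient G.glue))

/-- The point of the graph at the coordinate `t ∈ [0, len e]` of the edge `e`
(coordinates outside this interval are projected to it). -/
def pt (e : E) (t : ℝ) : G.Point :=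
  Quotient.mk G.glue ⟨e, projIcc 0 (G.len e) (G.len_pos e).le t⟩

/-- Lebesgue measure on the edge `e`. -/
def edgeMeasure (e : E) : Measure ℝ := volume.restrict (Icc 0 (G.len e))

/-- The length (one-dimensional measure) of a subset of the graph. -/
def setLength [Fintype E] (S : Set G.Point) : ℝ :=
  ∑ e, (volume {t | t ∈ Icc 0 (G.len e) ∧ G.pt e t ∈ S}).toReal

/-! ### The Schrödinger operator with Kirchhoff conditions -/

/-- `u` is continuous on the graph and of class `W^{2,2}` on each edge, with (edgewise) first and
second derivatives `u'` and `u''`: `u` is continuously differentiable on each closed edge and its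
derivative is absolutely continuous with derivative `u'' ∈ L²`. -/
structure IsH2 (u : G.Point → ℝ) (u' u'' : E → ℝ → ℝ) : Prop where
  continuous : Continuous u
  hasDeriv : ∀ e, ∀ t ∈ Icc 0 (G.len e),
    HasDerivWithinAt (fun s => u (G.pt e s)) (u' e t) (Icc 0 (G.len e)) t
  memLp : ∀ e, MemLp (u'' e) 2 (G.edgeMeasure e)
  deriv_eq : ∀ e, ∀ t ∈ Icc 0 (G.len e), u' e t = u' e 0 + ∫ s in (0 : ℝ)..t, u'' e s

/-- The derivative at an end of an edge, in the direction pointing into the vertex. -/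
def normalDeriv (u' : E → ℝ → ℝ) (a : E × Bool) : ℝ :=
  if a.2 then u' a.1 (G.len a.1) else - u' a.1 0

open Classical in
/-- The Kirchhoff condition at every vertex. -/
def Kirchhoff [Fintype E] (u' : E → ℝ → ℝ) : Prop :=
  ∀ v : G.Vertex, ∑ a : E × Bool with (Quotient.mk G.vertexSetoid a) = v, G.normalDeriv u' a = 0

/-- `u` is an eigenfunction, with eigenvalue `μ`, of the Schrödinger operator `-u'' + q u` with
Kirchhoff conditions at all vertices. -/
def IsEigenfunction [Fintype E] (q : G.Point → ℝ) (μ : ℝ) (u : G.Point → ℝ) : Prop :=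
  u ≠ 0 ∧ ∃ u' u'' : E → ℝ → ℝ, G.IsH2 u u' u'' ∧ G.Kirchhoff u' ∧
    ∀ e, ∀ᵐ t ∂(G.edgeMeasure e),
      - u'' e t + q (G.pt e t) * u (G.pt e t) = μ * u (G.pt e t)

/-- The numbers `x` such that there are at least `n` eigenvalues `≤ x`, counted with
multiplicity. -/
def atLeastEigenvalues [Fintype E] (q : G.Point → ℝ) (n : ℕ) : Set ℝ :=
  {x | ∃ u : Fin n → G.Point → ℝ, LinearIndependent ℝ u ∧
    ∀ i, ∃ μ ≤ x, G.IsEigenfunction q μ (u i)}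

/-- The `n`-th eigenvalue `λₙ(q)` (`n ≥ 1`), in increasing order and counted with multiplicity. -/
def eigenvalue [Fintype E] (q : G.Point → ℝ) (n : ℕ) : ℝ := sInf (G.atLeastEigenvalues q n)

/-- The fundamental gap `Γ[q] = λ₂(q) - λ₁(q)`. -/
def gap [Fintype E] (q : G.Point → ℝ) : ℝ := G.eigenvalue q 2 - G.eigenvalue q 1

/-! ### Paths and trees -/

/-- A path: a continuous map from `[0,1]` to the graph, injective except that the two end points
may coincide. -/
structure GPath where
  map : C(unitInterval, G.Point)
  inj : ∀ s t, s < t → map s = map t → s = 0 ∧ t = 1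

/-- A subgraph (of some subdivision): a finite union of nondegenerate closed edge segments. -/
def IsSubgraph (T : Set G.Point) : Prop :=
  ∃ S : Finset (E × ℝ × ℝ), (∀ p ∈ S, 0 ≤ p.2.1 ∧ p.2.1 < p.2.2 ∧ p.2.2 ≤ G.len p.1) ∧
    T = ⋃ p ∈ S, G.pt p.1 '' Icc p.2.1 p.2.2

/-- A tree in the graph: a connected subgraph without cycles. -/
structure IsTree (T : Set G.Point) : Prop where
  subgraph : G.IsSubgraph T
  connected : IsConnected T
  acyclic : ∀ γ : G.GPath, range γ.map ⊆ T → γ.map 0 ≠ γ.map 1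

/-- The degree of the point `x` in the subgraph `T`: the number of edge directions `(e, t, σ)`,
with `σ = ±1`, that start at `x`, the point of coordinate `t` on `e`, and stay in `T` initially. -/
def degree (T : Set G.Point) (x : G.Point) : ℕ :=
  Set.ncard {g : E × ℝ × ℝ | g.2.1 ∈ Icc 0 (G.len g.1) ∧ (g.2.2 = 1 ∨ g.2.2 = -1) ∧
    G.pt g.1 g.2.1 = x ∧
    ∀ᶠ s in 𝓝[>] (0 : ℝ), g.2.1 + g.2.2 * s ∈ Icc 0 (G.len g.1) ∧
      G.pt g.1 (g.2.1 + g.2.2 * s) ∈ T}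

/-- The boundary of a tree: its leaves. -/
def leaves (T : Set G.Point) : Set G.Point := {x | x ∈ T ∧ G.degree T x = 1}

/-! ### The two classes of potentials -/

/-- The measurable potentials with `0 ≤ q ≤ M` on the graph. -/
def boundedClass (M : ℝ) : Set (G.Point → ℝ) :=
  {q | (∀ e, AEStronglyMeasurable (fun t => q (G.pt e t)) (G.edgeMeasure e)) ∧
    ∀ x, 0 ≤ q x ∧ q x ≤ M}

/-- `q` is convex along the path `γ`, regarded as an interval: convex as a function of the arc
length. A closed path is cut at `γ 0 = γ 1`. -/
def ConvexAlong [Fintype E] (q : G.Point → ℝ) (γ : G.GPath) : Prop :=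
  ∀ r s t : unitInterval, r ≤ s → s ≤ t →
    G.setLength (γ.map '' Icc r t) * q (γ.map s) ≤
      G.setLength (γ.map '' Icc s t) * q (γ.map r) + G.setLength (γ.map '' Icc r s) * q (γ.map t)

/-- The convex class `C_{G,P,M}`. -/
def convexClass [Fintype E] (P : Set G.GPath) (M : ℝ) : Set (G.Point → ℝ) :=
  {q | q ∈ G.boundedClass M ∧ ∀ γ ∈ P, G.ConvexAlong q γ}

/-- `q` is single-well on the tree `T`: for some `a ∈ T` it is nonincreasing along every path in
`T` from a leaf of `T` to `a`. -/
def SingleWellOn (T : Set G.Point) (q : G.Point → ℝ) : Prop :=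
  ∃ a ∈ T, ∀ γ : G.GPath, range γ.map ⊆ T → γ.map 0 ∈ G.leaves T → γ.map 1 = a →
    Antitone fun s => q (γ.map s)

/-- The single-well class `SW_{G,T,M}`. -/
def singleWellClass (T : Set G.Point) (M : ℝ) : Set (G.Point → ℝ) :=
  {q | q ∈ G.boundedClass M ∧ G.SingleWellOn T q}

end MetricGraph

end

/-! The gap is continuous for weak L² convergence of potentials bounded by `M`, and each of the two
classes is sequentially compact for that convergence. The image of the class under the gap is
therefore a nonempty compact set of reals, and its least and greatest elements are attained
(`exists_isMinOn_isMaxOn_gap`).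

Continuity rests on a variational description of the eigenvalues. On the Sobolev space H¹ of the
graph the form of the operator, shifted by the L² product, satisfies Rellich compactness and
completeness (`isCompactPair`), so minimising it twice gives two orthonormal weak solutions. Weak
solutions and eigenfunctions are the same thing, by Green's formula in one direction and a
regularity argument in the other (`exists_isWeakSolution`, `IsWeakSolution.isEigenfunction`). For n
= 1, 2 this yields `rayleigh_characterization`: λₙ is at most x exactly when the Rayleigh quotient
is at most x on a space containing n independent functions. If the potentials converge weakly, the
forms ∫ q v² converge uniformly over H¹-bounded v, by Rellich compactness
(`eventually_abs_weight_sub_le`). A trial space for one potential then serves for the other with a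
small error, whence `tendsto_eigenvalue`.

Compactness of the classes must produce a limit that obeys the constraint at every point, whereas a
weak limit is defined only almost everywhere. On the set R covered by the relevant paths the
potentials are locally convex or locally monotone, so a subsequence converges there off a countable
set. An ultrafilter limit assigns a value at all points of R and agrees with the weak limit almost
everywhere (`exists_limit_potential`). Convexity along a path consists of inequalities between
finitely many values and passes to this limit directly.

For single wells the bottom moves with n. Along a subsequence the bottoms converge inside one
segment of the tree. A path from a leaf to the limit bottom, cut short before its end, can be
rerouted along a short piece of that segment to the n-th bottom (`eventually_antitoneOn_ext`), which
gives monotonicity up to any time before the end. Setting the limit potential to 0 at its bottom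
settles the final point. -/

/-! ### Minimisers of a quotient of two quadratic forms -/

namespace LinearMap.BilinForm

variable {V : Type*} [AddCommGroup V] [Module ℝ V]

theorem sq_apply_le {c : LinearMap.BilinForm ℝ V} (hs : ∀ u v, c u v = c v u)
    (hc : ∀ v, 0 ≤ c v v) (u v : V) : c u v ^ 2 ≤ c u u * c v v := by
  have := LinearMap.BilinForm.apply_mul_apply_le_of_forall_zero_le c hc u v
  rw [hs v u] at this
  linarith [sq (c u v)]

theorem tendsto_apply {c : LinearMap.BilinForm ℝ V} (hs : ∀ u v, c u v = c v u)
    (hc : ∀ v, 0 ≤ c v v) {x : ℕ → V} {u : V}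
    (hx : Tendsto (fun n => c (x n - u) (x n - u)) atTop (𝓝 0)) (w : V) :
    Tendsto (fun n => c w (x n)) atTop (𝓝 (c w u)) := by
  have h1 : Tendsto (fun n => c w (x n - u)) atTop (𝓝 0) := by
    have h2 : Tendsto (fun n => √(c w w * c (x n - u) (x n - u))) atTop (𝓝 0) := by
      simpa using ((hx.const_mul (c w w)).sqrt)
    refine squeeze_zero_norm (fun n => ?_) h2
    exact Real.abs_le_sqrt (sq_apply_le hs hc _ _)
  simpa using h1.add_const (c w u)

theorem tendsto_apply_self {c : LinearMap.BilinForm ℝ V} (hs : ∀ u v, c u v = c v u)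
    (hc : ∀ v, 0 ≤ c v v) {x : ℕ → V} {u : V}
    (hx : Tendsto (fun n => c (x n - u) (x n - u)) atTop (𝓝 0)) :
    Tendsto (fun n => c (x n) (x n)) atTop (𝓝 (c u u)) := by
  have h1 := tendsto_apply hs hc hx u
  have h2 := (hx.add (h1.const_mul 2)).add_const (-(c u u))
  refine (h2.congr fun n => ?_).trans_eq (by ring_nf)
  simp only [map_sub, LinearMap.sub_apply, hs (x n) u]
  ring

theorem parallelogram {c : LinearMap.BilinForm ℝ V} (u v : V) :
    c (u - v) (u - v) = 2 * c u u + 2 * c v v - c (u + v) (u + v) := by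
  simp only [map_sub, LinearMap.sub_apply, map_add, LinearMap.add_apply]
  ring

theorem apply_eq_zero_of_nonneg {x y : ℝ} (h : ∀ t : ℝ, 0 ≤ 2 * t * x + t ^ 2 * y) : x = 0 := by
  -- A small step against the sign of x; dividing by |y| + 1 lets the linear term dominate the
  -- quadratic one and is safe when y = 0.
  have h1 := h (-x / (|y| + 1))
  have hy : 0 < |y| + 1 := by positivity
  have h2 : 2 * (-x / (|y| + 1)) * x + (-x / (|y| + 1)) ^ 2 * y
      = x ^ 2 * (y - 2 * (|y| + 1)) / (|y| + 1) ^ 2 := by field_simp; ring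
  rw [h2] at h1
  by_contra hx
  have : x ^ 2 * (y - 2 * (|y| + 1)) / (|y| + 1) ^ 2 < 0 := by
    apply div_neg_of_neg_of_pos _ (by positivity)
    apply mul_neg_of_pos_of_neg (by positivity)
    linarith [le_abs_self y, abs_nonneg y]
  linarith

/-- Data for the variational eigenvalue problem `a u = μ b u`: sequences bounded for `a` have
subsequences that are Cauchy for `b`, and Cauchy sequences for `a` converge. -/
structure IsCompactPair (a b : LinearMap.BilinForm ℝ V) : Prop where
  symm_left : ∀ u v, a u v = a v u
  symm_right : ∀ u v, b u v = b v u
  nonneg : ∀ v, 0 ≤ b v v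
  le : ∀ v, b v v ≤ a v v
  compact : ∀ (x : ℕ → V) (C : ℝ), (∀ n, a (x n) (x n) ≤ C) → ∃ φ : ℕ → ℕ, StrictMono φ ∧
    Tendsto (fun p : ℕ × ℕ => b (x (φ p.1) - x (φ p.2)) (x (φ p.1) - x (φ p.2))) atTop (𝓝 0)
  complete : ∀ x : ℕ → V,
    Tendsto (fun p : ℕ × ℕ => a (x p.1 - x p.2) (x p.1 - x p.2)) atTop (𝓝 0) →
    ∃ u, Tendsto (fun n => a (x n - u) (x n - u)) atTop (𝓝 0)
  -- This is where dimension at least two enters: the constraint set stays nontrivial after the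
  -- first eigenvector has been split off.
  exists_orthogonal : ∀ w, ∃ v, b w v = 0 ∧ 0 < b v v

namespace IsCompactPair

variable {a b : LinearMap.BilinForm ℝ V}

theorem exists_normalized {w v : V} (hv : b w v = 0) (hpos : 0 < b v v) :
    ∃ y, b w y = 0 ∧ b y y = 1 ∧ a v v = a y y * b v v := by
  have hs : 0 < √(b v v) := Real.sqrt_pos.2 hpos
  have hss : √(b v v) * √(b v v) = b v v := Real.mul_self_sqrt hpos.le
  refine ⟨(√(b v v))⁻¹ • v, by simp [hv], ?_, ?_⟩
  · simp only [map_smul, LinearMap.smul_apply, smul_eq_mul]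
    field_simp
    linarith [sq (√(b v v))]
  · simp only [map_smul, LinearMap.smul_apply, smul_eq_mul]
    field_simp
    rw [sq, hss]

theorem exists_minimizing_sequence (h : IsCompactPair a b) (w : V) :
    ∃ (l : ℝ) (x : ℕ → V), 0 ≤ l ∧ (∀ v, b w v = 0 → l * b v v ≤ a v v) ∧
      (∀ n, b w (x n) = 0) ∧ (∀ n, b (x n) (x n) = 1) ∧
      Tendsto (fun n => a (x n) (x n)) atTop (𝓝 l) := by
  have ha0 : ∀ v, 0 ≤ a v v := fun v => (h.nonneg v).trans (h.le v)
  let S : Set ℝ := {r | ∃ v, b w v = 0 ∧ b v v = 1 ∧ a v v = r}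
  have hSne : S.Nonempty := by
    obtain ⟨v, hv, hpos⟩ := h.exists_orthogonal w
    obtain ⟨y, hy1, hy2, -⟩ := exists_normalized (a := a) hv hpos
    exact ⟨_, y, hy1, hy2, rfl⟩
  have hSbdd : BddBelow S := ⟨0, by rintro r ⟨v, -, -, rfl⟩; exact ha0 v⟩
  obtain ⟨r, -, hr, hrS⟩ := exists_seq_tendsto_sInf hSne hSbdd
  choose x hx1 hx2 hx3 using hrS
  refine ⟨sInf S, x, le_csInf hSne (by rintro r ⟨v, -, -, rfl⟩; exact ha0 v), ?_, hx1, hx2,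
    hr.congr fun n => (hx3 n).symm⟩
  intro v hv
  rcases (h.nonneg v).eq_or_lt with h0 | hpos
  · rw [← h0]; simpa using ha0 v
  · obtain ⟨y, hy1, hy2, hy3⟩ := exists_normalized (a := a) hv hpos
    rw [hy3]
    exact mul_le_mul_of_nonneg_right (csInf_le hSbdd ⟨y, hy1, hy2, rfl⟩) hpos.le

/-- The direct method without weak limits. A subsequence of a minimising sequence is Cauchy for b;
the parallelogram law, together with the lower bound applied to sums of its terms, makes it Cauchy
for a as well, so it converges strongly. -/
theorem exists_minimizer (h : IsCompactPair a b) (w : V) :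
    ∃ u, b w u = 0 ∧ b u u = 1 ∧ ∀ v, b w v = 0 → a u u * b v v ≤ a v v := by
  have ha0 : ∀ v, 0 ≤ a v v := fun v => (h.nonneg v).trans (h.le v)
  obtain ⟨l, x, hl0, hlow, hx1, hx2, hr⟩ := h.exists_minimizing_sequence w
  obtain ⟨C, hC⟩ := hr.bddAbove_range
  obtain ⟨φ, hφ, hcau⟩ := h.compact x C fun n => hC ⟨n, rfl⟩
  have hr' : Tendsto (fun n => a (x (φ n)) (x (φ n))) atTop (𝓝 l) :=
    hr.comp hφ.tendsto_atTop
  have hacau : Tendsto (fun p : ℕ × ℕ =>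
      a (x (φ p.1) - x (φ p.2)) (x (φ p.1) - x (φ p.2))) atTop (𝓝 0) := by
    have h1 : Tendsto (fun p : ℕ × ℕ => a (x (φ p.1)) (x (φ p.1))) atTop (𝓝 l) := by
      rw [← prod_atTop_atTop_eq]; exact hr'.comp tendsto_fst
    have h2 : Tendsto (fun p : ℕ × ℕ => a (x (φ p.2)) (x (φ p.2))) atTop (𝓝 l) := by
      rw [← prod_atTop_atTop_eq]; exact hr'.comp tendsto_snd
    have h3 := ((h1.const_mul 2).add (h2.const_mul 2)).sub
      ((hcau.const_sub 4).const_mul l)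
    rw [show 2 * l + 2 * l - l * (4 - 0) = 0 by ring] at h3
    refine squeeze_zero (fun p => ha0 _) (fun p => ?_) h3
    have h4 := parallelogram (c := a) (x (φ p.1)) (x (φ p.2))
    have h5 := parallelogram (c := b) (x (φ p.1)) (x (φ p.2))
    -- The sum still satisfies the constraint and has b-square 4 minus a term tending to 0, so its
    -- a-square is asymptotically at least 4l; this leaves nothing for the difference.
    have h6 := hlow (x (φ p.1) + x (φ p.2)) (by simp [hx1])
    rw [hx2, hx2] at h5
    have h7 : b (x (φ p.1) + x (φ p.2)) (x (φ p.1) + x (φ p.2))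
      = 4 - b (x (φ p.1) - x (φ p.2)) (x (φ p.1) - x (φ p.2)) := by linarith
    rw [h7] at h6
    linarith
  obtain ⟨u, hu⟩ := h.complete (fun n => x (φ n)) hacau
  have hbu : Tendsto (fun n => b (x (φ n) - u) (x (φ n) - u)) atTop (𝓝 0) :=
    squeeze_zero (fun n => h.nonneg _) (fun n => h.le _) hu
  have hau : a u u = l := by
    have h1 := tendsto_apply_self h.symm_left ha0 hu
    exact tendsto_nhds_unique h1 hr'
  refine ⟨u, ?_, ?_, fun v hv => ?_⟩
  · have h1 := tendsto_apply h.symm_right h.nonneg hbu w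
    simp only [hx1] at h1
    exact tendsto_nhds_unique h1 tendsto_const_nhds
  · have h1 := tendsto_apply_self h.symm_right h.nonneg hbu
    simp only [hx2] at h1
    exact tendsto_nhds_unique h1 tendsto_const_nhds
  · rw [hau]
    exact hlow v hv

/-- The Euler–Lagrange equation, from varying u in an admissible direction v. -/
theorem apply_eq_of_minimizer (h : IsCompactPair a b) {w u : V} (hwu : b w u = 0)
    (hu : b u u = 1) (hmin : ∀ v, b w v = 0 → a u u * b v v ≤ a v v) {v : V} (hv : b w v = 0) :
    a u v = a u u * b u v := by
  rw [← sub_eq_zero]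
  apply apply_eq_zero_of_nonneg (y := a v v - a u u * b v v)
  intro t
  have := hmin (u + t • v) (by simp [hwu, hv])
  simp only [map_add, map_smul, LinearMap.add_apply, LinearMap.smul_apply, smul_eq_mul, hu,
    h.symm_left v u, h.symm_right v u] at this
  nlinarith

/-- The first two eigenvalues of the pair of forms `(a, b)`. -/
theorem exists_two_eigenvectors (h : IsCompactPair a b) :
    ∃ (w₁ w₂ : V) (l₁ l₂ : ℝ), l₁ ≤ l₂ ∧ b w₁ w₁ = 1 ∧ b w₂ w₂ = 1 ∧ b w₁ w₂ = 0 ∧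
      (∀ v, a w₁ v = l₁ * b w₁ v) ∧ (∀ v, a w₂ v = l₂ * b w₂ v) ∧
      (∀ v, l₁ * b v v ≤ a v v) ∧ (∀ v, b w₁ v = 0 → l₂ * b v v ≤ a v v) := by
  obtain ⟨w₁, -, h1, hmin1⟩ := h.exists_minimizer 0
  obtain ⟨w₂, h12, h2, hmin2⟩ := h.exists_minimizer w₁
  have hmin1' : ∀ v, a w₁ w₁ * b v v ≤ a v v := fun v => hmin1 v (by simp)
  have e1 : ∀ v, a w₁ v = a w₁ w₁ * b w₁ v := fun v =>
    h.apply_eq_of_minimizer (w := 0) (by simp) h1 hmin1 (by simp)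
  refine ⟨w₁, w₂, a w₁ w₁, a w₂ w₂, by simpa [h2] using hmin1' w₂, h1, h2, h12, e1,
    fun v => ?_, hmin1', hmin2⟩
  -- The second minimiser is only known to satisfy its equation on the complement of w₁. An
  -- arbitrary v is projected there, and the removed part contributes nothing because w₁ already
  -- solves its own equation.
  have h3 := h.apply_eq_of_minimizer h12 h2 hmin2 (v := v - b w₁ v • w₁) (by simp [h1])
  have h4 : a w₂ w₁ = 0 := by rw [h.symm_left, e1, h12, mul_zero]
  have h5 : b w₂ w₁ = 0 := by rw [h.symm_right, h12]
  simpa [h4, h5] using h3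

end IsCompactPair

end LinearMap.BilinForm

/-! ### Pointwise convergent subsequences -/

theorem exists_subseq_tendsto_of_countable {X : Type*} {D : Set X} (hD : D.Countable)
    (f : ℕ → X → ℝ) {C : ℝ} (hf : ∀ n, ∀ x ∈ D, |f n x| ≤ C) :
    ∃ φ : ℕ → ℕ, StrictMono φ ∧ ∀ x ∈ D, ∃ y, Tendsto (fun n => f (φ n) x) atTop (𝓝 y) := by
  have := hD.to_subtype
  have hK : IsCompact (Set.pi univ fun _ : D => Icc (-C) C) := isCompact_univ_pi fun _ => isCompact_Icc
  obtain ⟨y, -, φ, hφ, hy⟩ := hK.tendsto_subseq (x := fun n (x : D) => f n x)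
    fun n x _ => abs_le.1 (hf n x x.2)
  exact ⟨φ, hφ, fun x hx => ⟨y ⟨x, hx⟩, (tendsto_pi_nhds.1 hy) ⟨x, hx⟩⟩⟩

/-- The common last step of the three selection arguments (equicontinuous, monotone, convex): being
close to a convergent sequence up to every ε makes the values Cauchy. -/
theorem exists_tendsto_of_approx {X : Type*} {f : ℕ → X → ℝ} {t : X}
    (h : ∀ ε > 0, ∃ r, (∀ᶠ n in atTop, |f n t - f n r| ≤ ε) ∧
      ∃ y, Tendsto (fun n => f n r) atTop (𝓝 y)) :
    ∃ y, Tendsto (fun n => f n t) atTop (𝓝 y) := by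
  apply cauchySeq_tendsto_of_complete
  rw [Metric.cauchySeq_iff']
  intro ε hε
  obtain ⟨r, hr, y, hy⟩ := h (ε / 8) (by positivity)
  have hy' := (Metric.tendsto_nhds.1 hy) (ε / 8) (by positivity)
  obtain ⟨N, hN⟩ := eventually_atTop.1 (hr.and hy')
  refine ⟨N, fun n hn => ?_⟩
  obtain ⟨h1, h2⟩ := hN n hn
  obtain ⟨h3, h4⟩ := hN N le_rfl
  rw [Real.dist_eq] at *
  rw [abs_le] at h1 h3
  rw [abs_lt] at h2 h4 ⊢
  constructor <;> linarith [h1.1, h1.2, h2.1, h2.2, h3.1, h3.2, h4.1, h4.2]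

/-! ### The Sobolev space H¹ of a metric graph and its compactness. -/

namespace MetricGraph

variable {E : Type*} (G : MetricGraph E)

theorem continuous_pt (e : E) : Continuous (G.pt e) := by
  have h1 : Continuous fun t : ℝ => projIcc 0 (G.len e) (G.len_pos e).le t := continuous_projIcc
  have h2 : Continuous fun x : Icc (0 : ℝ) (G.len e) => (⟨e, x⟩ : G.PrePoint) :=
    continuous_sigmaMk (σ := fun e : E => Icc (0 : ℝ) (G.len e))
  exact continuous_quotient_mk'.comp (h2.comp h1)

theorem pt_projIcc (e : E) (t : ℝ) :
    G.pt e (projIcc 0 (G.len e) (G.len_pos e).le t) = G.pt e t := by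
  simp only [pt, projIcc_val]
  rfl

theorem exists_pt_eq (x : G.Point) : ∃ e, ∃ t ∈ Icc 0 (G.len e), G.pt e t = x := by
  induction x using Quotient.inductionOn with
  | h x =>
    obtain ⟨e, t, ht⟩ := x
    exact ⟨e, t, ht, by rw [pt, projIcc_of_mem _ ht]⟩

instance (e : E) : IsFiniteMeasure (G.edgeMeasure e) := by
  unfold edgeMeasure; infer_instance

theorem integral_edgeMeasure (e : E) (f : ℝ → ℝ) :
    ∫ t, f t ∂(G.edgeMeasure e) = ∫ t in (0 : ℝ)..G.len e, f t := by
  rw [intervalIntegral.integral_of_le (G.len_pos e).le, edgeMeasure, integral_Icc_eq_integral_Ioc]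

theorem edgeMeasure_real_univ (e : E) : (G.edgeMeasure e).real univ = G.len e := by
  simp [edgeMeasure, (G.len_pos e).le]

theorem restrict_edgeMeasure {e : E} {s t : ℝ} (hs : 0 ≤ s) (ht : t ≤ G.len e) :
    (G.edgeMeasure e).restrict (Ioc s t) = volume.restrict (Ioc s t) := by
  rw [edgeMeasure, Measure.restrict_restrict measurableSet_Ioc,
    inter_eq_self_of_subset_left (s := Ioc s t) (t := Icc 0 (G.len e))
      fun x hx => ⟨hs.trans hx.1.le, hx.2.trans ht⟩]

/-- Integration over `(s, t]`, as a continuous linear functional on `L²` of the edge. -/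
noncomputable def integralCLM (e : E) (s t : ℝ) : Lp ℝ 2 (G.edgeMeasure e) →L[ℝ] ℝ :=
  innerSL ℝ (indicatorConstLp 2 (measurableSet_Ioc : MeasurableSet (Ioc s t))
    (measure_ne_top (G.edgeMeasure e) _) (1 : ℝ))

theorem integralCLM_apply {e : E} {s t : ℝ} (hs : 0 ≤ s) (hst : s ≤ t) (ht : t ≤ G.len e)
    (f : Lp ℝ 2 (G.edgeMeasure e)) : G.integralCLM e s t f = ∫ r in s..t, f r := by
  rw [integralCLM, innerSL_apply_apply, L2.inner_indicatorConstLp_one,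
    G.restrict_edgeMeasure hs ht, intervalIntegral.integral_of_le hst]

/-- Cauchy–Schwarz against the indicator of the interval; the source of the Hölder-1/2 bound on H¹
functions. -/
theorem abs_integralCLM_le (e : E) {s t : ℝ} (hst : s ≤ t) (f : Lp ℝ 2 (G.edgeMeasure e)) :
    |G.integralCLM e s t f| ≤ √(t - s) * ‖f‖ := by
  rw [integralCLM, innerSL_apply_apply]
  refine (abs_real_inner_le_norm _ _).trans ?_
  gcongr
  rw [norm_indicatorConstLp (by simp) (by simp), Real.sqrt_eq_rpow]
  simp only [norm_one, one_mul, ENNReal.toReal_ofNat]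
  apply Real.rpow_le_rpow measureReal_nonneg _ (by norm_num)
  have h1 : (G.edgeMeasure e).real (Ioc s t) ≤ volume.real (Ioc s t) :=
    ENNReal.toReal_mono (by simp) (Measure.restrict_apply_le _ _)
  simpa [hst] using h1

/-- The Sobolev space `H¹` of the graph: the pairs of a continuous function and its edgewise weak
derivative. -/
noncomputable def sobolevSubmodule :
    Submodule ℝ ((G.Point → ℝ) × (∀ e, Lp ℝ 2 (G.edgeMeasure e))) where
  carrier := {p | Continuous p.1 ∧ ∀ e, ∀ t ∈ Icc 0 (G.len e),
    p.1 (G.pt e t) = p.1 (G.pt e 0) + G.integralCLM e 0 t (p.2 e)}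
  add_mem' := by
    rintro p q ⟨hp, hp'⟩ ⟨hq, hq'⟩
    refine ⟨hp.add hq, fun e t ht => ?_⟩
    simp only [Prod.fst_add, Prod.snd_add, Pi.add_apply, map_add, hp' e t ht, hq' e t ht]
    ring
  zero_mem' := ⟨continuous_const, by simp⟩
  smul_mem' := by
    rintro c p ⟨hp, hp'⟩
    refine ⟨hp.const_smul c, fun e t ht => ?_⟩
    simp only [Prod.smul_fst, Prod.smul_snd, Pi.smul_apply, map_smul, hp' e t ht, smul_eq_mul]
    ring

/-- The Sobolev space `H¹` of the graph, as a type. -/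
def Sobolev : Type _ := G.sobolevSubmodule

noncomputable instance : AddCommGroup G.Sobolev := inferInstanceAs (AddCommGroup G.sobolevSubmodule)

noncomputable instance : Module ℝ G.Sobolev := inferInstanceAs (Module ℝ G.sobolevSubmodule)

variable {G}

namespace Sobolev

/-- The function underlying an element of `H¹`. -/
def toFun (v : G.Sobolev) : G.Point → ℝ := v.1.1

/-- The weak derivative of an element of `H¹`. -/
def grad (v : G.Sobolev) (e : E) : Lp ℝ 2 (G.edgeMeasure e) := v.1.2 e

theorem continuous_toFun (v : G.Sobolev) : Continuous v.toFun := v.2.1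

theorem toFun_pt (v : G.Sobolev) {e : E} {t : ℝ} (ht : t ∈ Icc 0 (G.len e)) :
    v.toFun (G.pt e t) = v.toFun (G.pt e 0) + G.integralCLM e 0 t (v.grad e) := v.2.2 e t ht

theorem toFun_pt' (v : G.Sobolev) {e : E} {t : ℝ} (ht : t ∈ Icc 0 (G.len e)) :
    v.toFun (G.pt e t) = v.toFun (G.pt e 0) + ∫ s in (0 : ℝ)..t, v.grad e s := by
  rw [v.toFun_pt ht, G.integralCLM_apply le_rfl ht.1 ht.2]

@[simp] theorem toFun_add (v w : G.Sobolev) : (v + w).toFun = v.toFun + w.toFun := rfl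
@[simp] theorem toFun_sub (v w : G.Sobolev) : (v - w).toFun = v.toFun - w.toFun := rfl
@[simp] theorem toFun_smul (c : ℝ) (v : G.Sobolev) : (c • v).toFun = c • v.toFun := rfl
@[simp] theorem toFun_zero : (0 : G.Sobolev).toFun = 0 := rfl
@[simp] theorem grad_add (v w : G.Sobolev) (e : E) : (v + w).grad e = v.grad e + w.grad e := rfl
@[simp] theorem grad_sub (v w : G.Sobolev) (e : E) : (v - w).grad e = v.grad e - w.grad e := rfl
@[simp] theorem grad_smul (c : ℝ) (v : G.Sobolev) (e : E) : (c • v).grad e = c • v.grad e := rfl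

theorem toFun_sub_toFun (v : G.Sobolev) {e : E} {s t : ℝ} (hs : s ∈ Icc 0 (G.len e))
    (ht : t ∈ Icc 0 (G.len e)) (hst : s ≤ t) :
    v.toFun (G.pt e t) - v.toFun (G.pt e s) = G.integralCLM e s t (v.grad e) := by
  have hint : ∀ a b, 0 ≤ a → a ≤ b → b ≤ G.len e →
      IntervalIntegrable (v.grad e) volume a b := by
    intro a b ha hab hb
    rw [intervalIntegrable_iff_integrableOn_Ioc_of_le hab]
    have h1 : Integrable (v.grad e) (G.edgeMeasure e) :=
      (Lp.memLp (v.grad e)).integrable (by norm_num)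
    exact IntegrableOn.mono_set (s := Ioc a b) (t := Icc 0 (G.len e)) h1
      fun x hx => ⟨ha.trans hx.1.le, hx.2.trans hb⟩
  rw [v.toFun_pt' hs, v.toFun_pt' ht, G.integralCLM_apply hs.1 hst ht.2,
    ← intervalIntegral.integral_add_adjacent_intervals (hint 0 s le_rfl hs.1 hs.2)
      (hint s t hs.1 hst ht.2)]
  ring

/-- No restriction to the edge is needed, because `pt` projects coordinates to it and the projection
does not increase distances. Later approximating rationals may thus lie outside the edge. -/
theorem abs_toFun_sub_le (v : G.Sobolev) (e : E) (s t : ℝ) :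
    |v.toFun (G.pt e t) - v.toFun (G.pt e s)| ≤ √|t - s| * ‖v.grad e‖ := by
  have key : ∀ s ∈ Icc 0 (G.len e), ∀ t ∈ Icc 0 (G.len e), s ≤ t →
      |v.toFun (G.pt e t) - v.toFun (G.pt e s)| ≤ √|t - s| * ‖v.grad e‖ := by
    intro s hs t ht hst
    rw [v.toFun_sub_toFun hs ht hst, abs_of_nonneg (sub_nonneg.2 hst)]
    exact G.abs_integralCLM_le e hst _
  rw [← G.pt_projIcc e t, ← G.pt_projIcc e s]
  have hp := abs_projIcc_sub_projIcc (c := t) (d := s) (G.len_pos e).le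
  set s' := projIcc 0 (G.len e) (G.len_pos e).le s
  set t' := projIcc 0 (G.len e) (G.len_pos e).le t
  have h1 : |v.toFun (G.pt e t') - v.toFun (G.pt e s')| ≤ √|(t' : ℝ) - s'| * ‖v.grad e‖ := by
    rcases le_total (s' : ℝ) t' with h | h
    · exact key _ s'.2 _ t'.2 h
    · rw [abs_sub_comm, abs_sub_comm (t' : ℝ)]
      exact key _ t'.2 _ s'.2 h
  exact h1.trans (mul_le_mul_of_nonneg_right (Real.sqrt_le_sqrt hp) (norm_nonneg _))

theorem continuous_comp_pt (v : G.Sobolev) (e : E) : Continuous fun t => v.toFun (G.pt e t) :=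
  v.continuous_toFun.comp (G.continuous_pt e)

theorem integrable_of_continuous {f : ℝ → ℝ} (hf : Continuous f) (e : E) :
    Integrable f (G.edgeMeasure e) :=
  hf.continuousOn.integrableOn_Icc

theorem integrable_mul (v w : G.Sobolev) (e : E) :
    Integrable (fun t => v.toFun (G.pt e t) * w.toFun (G.pt e t)) (G.edgeMeasure e) :=
  integrable_of_continuous ((v.continuous_comp_pt e).mul (w.continuous_comp_pt e)) e

end Sobolev

/-- A bounded measurable function on the graph. -/
structure IsBoundedPotential (ρ : G.Point → ℝ) : Prop where
  aestronglyMeasurable : ∀ e, AEStronglyMeasurable (fun t => ρ (G.pt e t)) (G.edgeMeasure e)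
  bounded : ∃ C, ∀ x, |ρ x| ≤ C

theorem isBoundedPotential_one : IsBoundedPotential (fun _ : G.Point => (1 : ℝ)) :=
  ⟨fun _ => aestronglyMeasurable_const, 1, by simp⟩

theorem IsBoundedPotential.integrable_mul {ρ : G.Point → ℝ} (hρ : IsBoundedPotential ρ) {e : E}
    {f : ℝ → ℝ} (hf : Integrable f (G.edgeMeasure e)) :
    Integrable (fun t => ρ (G.pt e t) * f t) (G.edgeMeasure e) := by
  obtain ⟨C, hC⟩ := hρ.bounded
  exact hf.bdd_mul (hρ.aestronglyMeasurable e) (.of_forall fun t => hC _)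

namespace Sobolev

theorem integrable_weight {ρ : G.Point → ℝ} (hρ : IsBoundedPotential ρ) (v w : G.Sobolev) (e : E) :
    Integrable (fun t => ρ (G.pt e t) * (v.toFun (G.pt e t) * w.toFun (G.pt e t)))
      (G.edgeMeasure e) :=
  hρ.integrable_mul (v.integrable_mul w e)

variable [Fintype E]

/-- The Dirichlet form. -/
noncomputable def dirichlet : LinearMap.BilinForm ℝ G.Sobolev :=
  LinearMap.mk₂ ℝ (fun v w => ∑ e, inner ℝ (v.grad e) (w.grad e))
    (by intros; simp [inner_add_left, Finset.sum_add_distrib])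
    (by intros; simp [inner_smul_left, Finset.mul_sum])
    (by intros; simp [inner_add_right, Finset.sum_add_distrib])
    (by intros; simp [inner_smul_right, Finset.mul_sum])

theorem dirichlet_apply (v w : G.Sobolev) :
    dirichlet v w = ∑ e, inner ℝ (v.grad e) (w.grad e) := rfl

/-- The form `∫ ρ v w`. -/
noncomputable def weight (ρ : G.Point → ℝ) (hρ : IsBoundedPotential ρ) :
    LinearMap.BilinForm ℝ G.Sobolev :=
  LinearMap.mk₂ ℝ (fun v w => ∑ e, ∫ t, ρ (G.pt e t) * (v.toFun (G.pt e t) * w.toFun (G.pt e t))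
      ∂(G.edgeMeasure e))
    (by
      intro v v' w
      rw [← Finset.sum_add_distrib]
      refine Finset.sum_congr rfl fun e _ => ?_
      rw [← integral_add (integrable_weight hρ v w e) (integrable_weight hρ v' w e)]
      exact integral_congr_ae (.of_forall fun t => by simp; ring))
    (by
      intro c v w
      rw [smul_eq_mul, Finset.mul_sum]
      refine Finset.sum_congr rfl fun e _ => ?_
      rw [← integral_const_mul]
      exact integral_congr_ae (.of_forall fun t => by simp; ring))
    (by
      intro v w w'
      rw [← Finset.sum_add_distrib]
      refine Finset.sum_congr rfl fun e _ => ?_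
      rw [← integral_add (integrable_weight hρ v w e) (integrable_weight hρ v w' e)]
      exact integral_congr_ae (.of_forall fun t => by simp; ring))
    (by
      intro c v w
      rw [smul_eq_mul, Finset.mul_sum]
      refine Finset.sum_congr rfl fun e _ => ?_
      rw [← integral_const_mul]
      exact integral_congr_ae (.of_forall fun t => by simp; ring))

theorem weight_apply {ρ : G.Point → ℝ} (hρ : IsBoundedPotential ρ) (v w : G.Sobolev) :
    weight ρ hρ v w = ∑ e, ∫ t, ρ (G.pt e t) * (v.toFun (G.pt e t) * w.toFun (G.pt e t))
      ∂(G.edgeMeasure e) := rfl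

/-- The `L²` inner product. -/
noncomputable def mass : LinearMap.BilinForm ℝ G.Sobolev := weight _ isBoundedPotential_one

theorem mass_apply (v w : G.Sobolev) :
    mass v w = ∑ e, ∫ t, v.toFun (G.pt e t) * w.toFun (G.pt e t) ∂(G.edgeMeasure e) := by
  simp [mass, weight_apply]

theorem dirichlet_symm (v w : G.Sobolev) : dirichlet v w = dirichlet w v := by
  simp only [dirichlet_apply, real_inner_comm]

theorem weight_symm {ρ : G.Point → ℝ} (hρ : IsBoundedPotential ρ) (v w : G.Sobolev) :
    weight ρ hρ v w = weight ρ hρ w v := by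
  simp only [weight_apply, mul_comm (v.toFun _)]

theorem dirichlet_nonneg (v : G.Sobolev) : 0 ≤ dirichlet v v :=
  Finset.sum_nonneg fun _ _ => real_inner_self_nonneg

theorem norm_grad_sq_le (v : G.Sobolev) (e : E) : ‖v.grad e‖ ^ 2 ≤ dirichlet v v := by
  rw [dirichlet_apply, ← real_inner_self_eq_norm_sq]
  exact Finset.single_le_sum (f := fun e => inner ℝ (v.grad e) (v.grad e))
    (fun _ _ => real_inner_self_nonneg) (Finset.mem_univ e)

theorem mass_nonneg (v : G.Sobolev) : 0 ≤ mass v v := by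
  rw [mass_apply]
  exact Finset.sum_nonneg fun _ _ => integral_nonneg fun _ => mul_self_nonneg _

theorem weight_nonneg {ρ : G.Point → ℝ} (hρ : IsBoundedPotential ρ) (h0 : ∀ x, 0 ≤ ρ x)
    (v : G.Sobolev) : 0 ≤ weight ρ hρ v v :=
  Finset.sum_nonneg fun _ _ => integral_nonneg fun _ => mul_nonneg (h0 _) (mul_self_nonneg _)

theorem weight_le {ρ : G.Point → ℝ} (hρ : IsBoundedPotential ρ) {M : ℝ} (h0 : ∀ x, ρ x ≤ M)
    (v : G.Sobolev) : weight ρ hρ v v ≤ M * mass v v := by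
  rw [weight_apply, mass_apply, Finset.mul_sum]
  refine Finset.sum_le_sum fun e _ => ?_
  rw [← integral_const_mul]
  refine integral_mono (integrable_weight hρ v v e) ?_ fun t =>
    mul_le_mul_of_nonneg_right (h0 _) (mul_self_nonneg _)
  exact (v.integrable_mul v e).const_mul _

theorem integral_sq_le_mass (v : G.Sobolev) (e : E) :
    ∫ t, v.toFun (G.pt e t) * v.toFun (G.pt e t) ∂(G.edgeMeasure e) ≤ mass v v := by
  rw [mass_apply]
  exact Finset.single_le_sum
    (f := fun e => ∫ t, v.toFun (G.pt e t) * v.toFun (G.pt e t) ∂(G.edgeMeasure e))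
    (fun _ _ => integral_nonneg fun _ => mul_self_nonneg _) (Finset.mem_univ e)

/-- The Sobolev embedding into bounded functions: compare the value at x with the values at all
points s of the same edge by the Hölder bound, then average over s. The constant is summed over the
edges so that it does not depend on x. -/
theorem exists_sup_bound (G : MetricGraph E) : ∃ C, 0 ≤ C ∧ ∀ (v : G.Sobolev) (x : G.Point),
    v.toFun x ^ 2 ≤ C * (dirichlet v v + mass v v) := by
  refine ⟨∑ e, (2 / G.len e + 2 * G.len e), Finset.sum_nonneg fun e _ => ?_, fun v x => ?_⟩
  · have := G.len_pos e; positivity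
  obtain ⟨e, t, ht, rfl⟩ := G.exists_pt_eq x
  have hl := G.len_pos e
  have hN : 0 ≤ dirichlet v v + mass v v := add_nonneg (dirichlet_nonneg v) (mass_nonneg v)
  have h1 : (2 / G.len e + 2 * G.len e) * (dirichlet v v + mass v v) ≤
      (∑ e, (2 / G.len e + 2 * G.len e)) * (dirichlet v v + mass v v) := by
    refine mul_le_mul_of_nonneg_right ?_ hN
    exact Finset.single_le_sum (f := fun e => 2 / G.len e + 2 * G.len e)
      (fun e _ => by have := G.len_pos e; positivity) (Finset.mem_univ e)
  refine le_trans ?_ h1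
  have h2 : ∀ s ∈ Icc 0 (G.len e), v.toFun (G.pt e t) ^ 2 ≤
      2 * (v.toFun (G.pt e s) * v.toFun (G.pt e s)) + 2 * G.len e * dirichlet v v := by
    intro s hs
    have h3 := v.abs_toFun_sub_le e s t
    have h4 : (v.toFun (G.pt e t) - v.toFun (G.pt e s)) ^ 2 ≤ G.len e * dirichlet v v := by
      rw [← sq_abs]
      calc |v.toFun (G.pt e t) - v.toFun (G.pt e s)| ^ 2 ≤ (√|t - s| * ‖v.grad e‖) ^ 2 := by gcongr
        _ = |t - s| * ‖v.grad e‖ ^ 2 := by rw [mul_pow, Real.sq_sqrt (abs_nonneg _)]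
        _ ≤ G.len e * dirichlet v v := by
          refine mul_le_mul ?_ (v.norm_grad_sq_le e) (by positivity) hl.le
          rw [abs_le]; constructor <;> linarith [hs.1, hs.2, ht.1, ht.2]
    nlinarith [sq_nonneg (v.toFun (G.pt e t) - 2 * v.toFun (G.pt e s))]
  have h5 : ∫ s, v.toFun (G.pt e t) ^ 2 ∂(G.edgeMeasure e) ≤
      ∫ s, (2 * (v.toFun (G.pt e s) * v.toFun (G.pt e s)) + 2 * G.len e * dirichlet v v)
        ∂(G.edgeMeasure e) := by
    have hc := v.continuous_comp_pt e
    refine integral_mono_ae (integrable_const _) (integrable_of_continuous (by fun_prop) e) ?_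
    filter_upwards [ae_restrict_mem measurableSet_Icc] with s hs using h2 s hs
  rw [integral_const, edgeMeasure_real_univ, integral_add
    ((v.integrable_mul v e).const_mul 2)
    (integrable_const _), integral_const_mul, integral_const, edgeMeasure_real_univ,
    smul_eq_mul, smul_eq_mul] at h5
  have h6 := v.integral_sq_le_mass e
  have h7 : G.len e * v.toFun (G.pt e t) ^ 2 ≤
      G.len e * ((2 / G.len e + 2 * G.len e) * (dirichlet v v + mass v v)) := by
    have h8 : G.len e * ((2 / G.len e + 2 * G.len e) * (dirichlet v v + mass v v)) =
      (2 + 2 * G.len e * G.len e) * (dirichlet v v + mass v v) := by field_simp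
    rw [h8]
    have := dirichlet_nonneg v
    have := mass_nonneg v
    have : 0 ≤ G.len e * G.len e * mass v v := by positivity
    nlinarith
  exact le_of_mul_le_mul_left h7 hl

/-- Arzelà–Ascoli in pointwise form: a diagonal subsequence converges at the rational coordinates,
and the uniform Hölder bound extends this to all points. Pointwise convergence with a uniform bound
is all that dominated convergence will need. -/
theorem exists_subseq_tendsto (x : ℕ → G.Sobolev) {C : ℝ}
    (hx : ∀ n, dirichlet (x n) (x n) + mass (x n) (x n) ≤ C) :
    ∃ (φ : ℕ → ℕ) (u : G.Point → ℝ) (K : ℝ), StrictMono φ ∧ (∀ n y, |(x n).toFun y| ≤ K) ∧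
      ∀ y, Tendsto (fun n => (x (φ n)).toFun y) atTop (𝓝 (u y)) := by
  obtain ⟨B, hB, hsup⟩ := exists_sup_bound G
  have hK : ∀ n y, |(x n).toFun y| ≤ √(B * C) := fun n y =>
    Real.abs_le_sqrt ((hsup (x n) y).trans (mul_le_mul_of_nonneg_left (hx n) hB))
  have hgrad : ∀ n e, ‖(x n).grad e‖ ≤ √C := fun n e => by
    refine Real.le_sqrt_of_sq_le (((x n).norm_grad_sq_le e).trans ?_)
    linarith [hx n, mass_nonneg (x n)]
  have hD : (⋃ e, range fun r : ℚ => G.pt e r).Countable :=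
    countable_iUnion fun e => countable_range _
  obtain ⟨φ, hφ, hlim⟩ := exists_subseq_tendsto_of_countable hD (fun n => (x n).toFun)
    (fun n y _ => hK n y)
  have hall : ∀ y, ∃ z, Tendsto (fun n => (x (φ n)).toFun y) atTop (𝓝 z) := by
    intro y
    obtain ⟨e, t, ht, rfl⟩ := G.exists_pt_eq y
    apply exists_tendsto_of_approx (f := fun n => (x (φ n)).toFun)
    intro ε hε
    have hcont : Tendsto (fun s : ℝ => √|t - s| * √C) (𝓝 t) (𝓝 0) := by
      have : Continuous fun s : ℝ => √|t - s| * √C := by fun_prop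
      simpa using this.tendsto t
    obtain ⟨r, hr⟩ := Rat.denseRange_cast.exists_mem_open
      (isOpen_interior (s := {s : ℝ | √|t - s| * √C < ε}))
      ⟨t, mem_interior_iff_mem_nhds.2 (hcont.eventually (gt_mem_nhds hε))⟩
    refine ⟨G.pt e r, .of_forall fun n => ?_, hlim _ (mem_iUnion.2 ⟨e, r, rfl⟩)⟩
    refine ((x (φ n)).abs_toFun_sub_le e r t).trans ?_
    have h1 : (r : ℝ) ∈ {s : ℝ | √|t - s| * √C < ε} := interior_subset hr
    exact (mul_le_mul_of_nonneg_left (hgrad _ _) (Real.sqrt_nonneg _)).trans (le_of_lt h1)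
  choose u hu using hall
  exact ⟨φ, u, _, hφ, hK, hu⟩

/-- Dominated convergence. The index filter is general so that double sequences of differences are
covered too. -/
theorem tendsto_mass_of_tendsto {ι : Type*} {l : Filter ι} [l.IsCountablyGenerated]
    (x : ι → G.Sobolev) {K : ℝ} (hK : ∀ i y, |(x i).toFun y| ≤ K)
    (h : ∀ y, Tendsto (fun i => (x i).toFun y) l (𝓝 0)) :
    Tendsto (fun i => mass (x i) (x i)) l (𝓝 0) := by
  simp only [mass_apply]
  rw [← Finset.sum_const_zero (s := (Finset.univ : Finset E))]
  refine tendsto_finsetSum _ fun e _ => ?_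
  rw [← integral_zero ℝ ℝ (μ := G.edgeMeasure e)]
  refine tendsto_integral_filter_of_dominated_convergence (fun _ => K * K)
    (.of_forall fun i => ((x i).integrable_mul (x i) e).aestronglyMeasurable)
    (.of_forall fun i => .of_forall fun t => ?_) (integrable_const _) (.of_forall fun t => ?_)
  · rw [Real.norm_eq_abs, abs_mul]
    exact mul_le_mul (hK _ _) (hK _ _) (abs_nonneg _) ((abs_nonneg _).trans (hK i (G.pt e t)))
  · simpa using (h (G.pt e t)).mul (h (G.pt e t))

theorem exists_subseq_mass_cauchy (x : ℕ → G.Sobolev) {C : ℝ}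
    (hx : ∀ n, dirichlet (x n) (x n) + mass (x n) (x n) ≤ C) :
    ∃ φ : ℕ → ℕ, StrictMono φ ∧ Tendsto (fun p : ℕ × ℕ =>
      mass (x (φ p.1) - x (φ p.2)) (x (φ p.1) - x (φ p.2))) atTop (𝓝 0) := by
  obtain ⟨φ, u, K, hφ, hK, hu⟩ := exists_subseq_tendsto x hx
  refine ⟨φ, hφ, tendsto_mass_of_tendsto (fun p : ℕ × ℕ => x (φ p.1) - x (φ p.2))
    (K := K + K) (fun p y => ?_) fun y => ?_⟩
  · exact (abs_sub _ _).trans (add_le_add (hK _ _) (hK _ _))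
  · rw [← prod_atTop_atTop_eq]
    simpa using ((hu y).comp tendsto_fst).sub ((hu y).comp tendsto_snd)

/-- Completeness of H¹: by the sup bound the functions converge uniformly, the gradients converge in
L², and the relation tying a function to its gradient is closed because integration over an interval
is continuous on L². -/
theorem exists_limit (x : ℕ → G.Sobolev)
    (hx : Tendsto (fun p : ℕ × ℕ => dirichlet (x p.1 - x p.2) (x p.1 - x p.2) +
      mass (x p.1 - x p.2) (x p.1 - x p.2)) atTop (𝓝 0)) :
    ∃ u : G.Sobolev, Tendsto (fun n => dirichlet (x n - u) (x n - u) +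
      mass (x n - u) (x n - u)) atTop (𝓝 0) := by
  obtain ⟨B, hB, hsup⟩ := exists_sup_bound G
  have hgrad : ∀ e, CauchySeq fun n => (x n).grad e := by
    intro e
    rw [cauchySeq_iff_tendsto_dist_atTop_0]
    have h0 : Tendsto (fun p : ℕ × ℕ => √(dirichlet (x p.1 - x p.2) (x p.1 - x p.2) +
      mass (x p.1 - x p.2) (x p.1 - x p.2))) atTop (𝓝 0) := by simpa using hx.sqrt
    refine squeeze_zero (fun _ => dist_nonneg) (fun p => ?_) h0
    rw [dist_eq_norm]
    refine Real.le_sqrt_of_sq_le (((x p.1 - x p.2).norm_grad_sq_le e).trans ?_)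
    linarith [mass_nonneg (x p.1 - x p.2)]
  have hcau : UniformCauchySeqOn (fun n => (x n).toFun) atTop univ := by
    rw [Metric.uniformCauchySeqOn_iff]
    intro ε hε
    have h1 : Tendsto (fun p : ℕ × ℕ => B * (dirichlet (x p.1 - x p.2) (x p.1 - x p.2) +
      mass (x p.1 - x p.2) (x p.1 - x p.2))) atTop (𝓝 0) := by simpa using hx.const_mul B
    have h2 := h1.eventually (gt_mem_nhds (show 0 < ε ^ 2 by positivity))
    rw [← prod_atTop_atTop_eq, eventually_prod_iff] at h2
    obtain ⟨p, hp, q, hq, hpq⟩ := h2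
    obtain ⟨N, hN⟩ := eventually_atTop.1 (hp.and hq)
    refine ⟨N, fun m hm n hn y _ => ?_⟩
    rw [Real.dist_eq]
    exact abs_lt_of_sq_lt_sq ((hsup (x m - x n) y).trans_lt (hpq (hN m hm).1 (hN n hn).2)) hε.le
  have hpt : ∀ y, ∃ z, Tendsto (fun n => (x n).toFun y) atTop (𝓝 z) := fun y =>
    cauchySeq_tendsto_of_complete (hcau.cauchySeq (mem_univ y))
  choose u hu using hpt
  have hunif := hcau.tendstoUniformlyOn_of_tendsto fun y _ => hu y
  have hucont : Continuous u := by
    rw [← continuousOn_univ]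
    exact hunif.continuousOn (.of_forall fun n => (x n).continuous_toFun.continuousOn)
  choose g hg using fun e => cauchySeq_tendsto_of_complete (hgrad e)
  have hmem : (u, g) ∈ G.sobolevSubmodule := by
    refine ⟨hucont, fun e t ht => ?_⟩
    refine tendsto_nhds_unique (hu _) ?_
    have h1 := (hu (G.pt e 0)).add (((G.integralCLM e 0 t).continuous.tendsto _).comp (hg e))
    exact h1.congr fun n => ((x n).toFun_pt ht).symm
  let w : G.Sobolev := ⟨(u, g), hmem⟩
  have hd : Tendsto (fun n => dirichlet (x n - w) (x n - w)) atTop (𝓝 0) := by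
    simp only [dirichlet_apply]
    have h2 : ∀ e, Tendsto (fun n => inner ℝ ((x n - w).grad e) ((x n - w).grad e)) atTop
        (𝓝 0) := by
      intro e
      have h1 : Tendsto (fun n => (x n).grad e - g e) atTop (𝓝 0) := by
        simpa using (hg e).sub_const (g e)
      have h3 := h1.inner (𝕜 := ℝ) h1
      rw [inner_zero_left] at h3
      exact h3
    have h4 := tendsto_finsetSum Finset.univ fun e (_ : e ∈ Finset.univ) => h2 e
    rwa [Finset.sum_const_zero] at h4
  have hm : Tendsto (fun n => mass (x n - w) (x n - w)) atTop (𝓝 0) := by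
    -- Uniform convergence supplies a dominating constant only from some index on, hence the shift
    -- by N.
    obtain ⟨N, hN⟩ := eventually_atTop.1 ((Metric.tendstoUniformlyOn_iff.1 hunif) 1 one_pos)
    rw [← tendsto_add_atTop_iff_nat N]
    refine tendsto_mass_of_tendsto (fun n => x (n + N) - w) (K := 1) (fun n y => ?_) fun y => ?_
    · have := hN (n + N) (by simp) y (mem_univ y)
      rw [dist_comm, Real.dist_eq] at this
      exact this.le
    · have := ((hu y).sub_const (u y)).comp (tendsto_add_atTop_nat N)
      rw [sub_self] at this
      exact this
  have := hd.add hm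
  rw [add_zero] at this
  exact ⟨w, this⟩

end Sobolev

end MetricGraph

/-! ### Integration by parts -/

/-- Both functions are primitives of integrable functions, hence absolutely continuous with the
expected derivatives almost everywhere, and the product rule can be integrated. -/
theorem integral_parts_of_primitive {P P₁ v v₁ : ℝ → ℝ} {l : ℝ} (hl : 0 ≤ l)
    (hP₁ : IntervalIntegrable P₁ volume 0 l) (hv₁ : IntervalIntegrable v₁ volume 0 l)
    (hP : ∀ t ∈ Icc 0 l, P t = P 0 + ∫ s in (0 : ℝ)..t, P₁ s)
    (hv : ∀ t ∈ Icc 0 l, v t = v 0 + ∫ s in (0 : ℝ)..t, v₁ s) :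
    ∫ t in (0 : ℝ)..l, (P t * v₁ t + P₁ t * v t) = P l * v l - P 0 * v 0 := by
  have ac : ∀ (c : ℝ) {f : ℝ → ℝ}, IntervalIntegrable f volume 0 l →
      AbsolutelyContinuousOnInterval (fun t => c + ∫ s in (0 : ℝ)..t, f s) 0 l := by
    intro c f hf
    have h1 := hf.absolutelyContinuousOnInterval_intervalIntegral (c := 0) (by simp)
    have h2 : AbsolutelyContinuousOnInterval (fun _ : ℝ => c) 0 l :=
      (LipschitzWith.const c).lipschitzOnWith.absolutelyContinuousOnInterval
    exact h2.add h1
  have key := (ac (P 0) hP₁).integral_deriv_mul_eq_sub (ac (v 0) hv₁)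
  rw [← hP l ⟨hl, le_rfl⟩, ← hv l ⟨hl, le_rfl⟩] at key
  simp only [intervalIntegral.integral_same, add_zero] at key
  rw [← key]
  apply intervalIntegral.integral_congr_ae
  filter_upwards [hP₁.ae_hasDerivAt_integral, hv₁.ae_hasDerivAt_integral] with t h1 h2 ht
  have ht' : t ∈ uIcc 0 l := uIoc_subset_uIcc ht
  have ht'' : t ∈ Icc 0 l := by rwa [uIcc_of_le hl] at ht'
  rw [((h1 ht' 0 (by simp)).const_add (P 0)).deriv, ((h2 ht' 0 (by simp)).const_add (v 0)).deriv,
    ← hP t ht'', ← hv t ht'']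
  ring

namespace MetricGraph

variable {E : Type*} {G : MetricGraph E}

theorem intervalIntegrable_of_edge {e : E} {f : ℝ → ℝ} (hf : Integrable f (G.edgeMeasure e)) :
    IntervalIntegrable f volume 0 (G.len e) := by
  rw [intervalIntegrable_iff_integrableOn_Icc_of_le (G.len_pos e).le]
  exact hf

theorem intervalIntegrable_of_edge' {e : E} {f : ℝ → ℝ} (hf : Integrable f (G.edgeMeasure e))
    {t : ℝ} (ht : t ∈ Icc 0 (G.len e)) : IntervalIntegrable f volume 0 t :=
  (intervalIntegrable_of_edge hf).mono_set (by
    rw [uIcc_of_le ht.1, uIcc_of_le (G.len_pos e).le]; exact Icc_subset_Icc_right ht.2)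

theorem integrable_edge_Lp {e : E} (f : Lp ℝ 2 (G.edgeMeasure e)) :
    Integrable f (G.edgeMeasure e) :=
  (Lp.memLp f).integrable (by norm_num)

theorem inner_edge_Lp {e : E} (f g : Lp ℝ 2 (G.edgeMeasure e)) :
    inner ℝ f g = ∫ t, f t * g t ∂(G.edgeMeasure e) := by
  rw [L2.inner_def]
  simp [mul_comm]

variable (G) in
/-- The point of the graph at an end of an edge. -/
noncomputable def endPt (a : E × Bool) : G.Point := G.pt a.1 (if a.2 then G.len a.1 else 0)

theorem endPt_eq_mk (a : E × Bool) : G.endPt a = Quotient.mk G.glue (G.endPoint a) := by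
  obtain ⟨e, b⟩ := a
  cases b
  · simp [endPt, endPoint, pt, projIcc_left]
    rfl
  · simp [endPt, endPoint, pt, projIcc_right]
    rfl

theorem endPt_eq_of_rel {a b : E × Bool} (h : G.vertexSetoid a b) : G.endPt a = G.endPt b := by
  rw [endPt_eq_mk, endPt_eq_mk]
  exact Quotient.sound (Or.inr ⟨a, b, h, rfl, rfl⟩)

namespace Sobolev

/-- The function with prescribed values at the vertices and prescribed weak derivative. -/
theorem exists_of_vertex_values (c : G.Vertex → ℝ) (g : ∀ e, Lp ℝ 2 (G.edgeMeasure e))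
    (hg : ∀ e, G.integralCLM e 0 (G.len e) (g e) =
      c (Quotient.mk _ (e, true)) - c (Quotient.mk _ (e, false))) :
    ∃ v : G.Sobolev, (∀ e, v.grad e = g e) ∧ ∀ a, v.toFun (G.endPt a) = c (Quotient.mk _ a) := by
  let f : G.PrePoint → ℝ := fun x =>
    c (Quotient.mk _ (x.1, false)) + G.integralCLM x.1 0 x.2 (g x.1)
  have hend : ∀ a, f (G.endPoint a) = c (Quotient.mk _ a) := by
    rintro ⟨e, b⟩
    cases b
    · simp only [f, endPoint]
      rw [if_neg (by simp), G.integralCLM_apply le_rfl le_rfl (G.len_pos e).le]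
      simp
    · simp only [f, endPoint, if_true]
      rw [hg]; ring
  have hcompat : ∀ x y : G.PrePoint, G.glue x y → f x = f y := by
    rintro x y (rfl | ⟨a, b, h, rfl, rfl⟩)
    · rfl
    · rw [hend, hend, Quotient.sound h]
  let u : G.Point → ℝ := Quotient.lift f hcompat
  have hu : ∀ e, ∀ t ∈ Icc 0 (G.len e), u (G.pt e t) =
      c (Quotient.mk _ (e, false)) + G.integralCLM e 0 t (g e) := by
    intro e t ht
    rw [pt, projIcc_of_mem _ ht]
    rfl
  have hcont : Continuous u := by
    refine Continuous.quotient_lift (continuous_sigma fun e => ?_) hcompat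
    have h1 : ContinuousOn (fun t => ∫ s in (0 : ℝ)..t, g e s) (Icc 0 (G.len e)) := by
      have := intervalIntegral.continuousOn_primitive_interval (f := g e) (μ := volume) (a := 0)
        (b := G.len e) (by rw [uIcc_of_le (G.len_pos e).le]; exact integrable_edge_Lp (g e))
      rwa [uIcc_of_le (G.len_pos e).le] at this
    have h2 := continuousOn_iff_continuous_domRestrict.1 h1
    have h3 : Continuous fun t : Icc 0 (G.len e) =>
        c (Quotient.mk _ (e, false)) + ∫ s in (0 : ℝ)..t, g e s := continuous_const.add h2
    refine h3.congr fun t => ?_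
    rw [← G.integralCLM_apply le_rfl t.2.1 t.2.2]
  refine ⟨⟨(u, g), hcont, fun e t ht => ?_⟩, fun e => rfl, fun a => ?_⟩
  · simp only [hu e t ht, hu e 0 ⟨le_rfl, (G.len_pos e).le⟩]
    rw [G.integralCLM_apply le_rfl le_rfl (G.len_pos e).le]
    simp
  · rw [endPt_eq_mk]
    exact hend a

/-- The edgewise derivative is a primitive, hence continuous and bounded on the edge, hence in L²;
the fundamental theorem of calculus then identifies it with the weak derivative. -/
theorem exists_of_isH2 {u : G.Point → ℝ} {u' u'' : E → ℝ → ℝ} (h : G.IsH2 u u' u'') :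
    ∃ w : G.Sobolev, w.toFun = u ∧ ∀ e, w.grad e =ᵐ[G.edgeMeasure e] u' e := by
  have hint : ∀ e, Integrable (u'' e) (G.edgeMeasure e) := fun e =>
    (h.memLp e).integrable (by norm_num)
  have hcont : ∀ e, ContinuousOn (u' e) (Icc 0 (G.len e)) := by
    intro e
    have h1 : ContinuousOn (fun t => u' e 0 + ∫ s in (0 : ℝ)..t, u'' e s) (Icc 0 (G.len e)) := by
      rw [← uIcc_of_le (G.len_pos e).le]
      refine continuousOn_const.add (intervalIntegral.continuousOn_primitive_interval ?_)
      rw [uIcc_of_le (G.len_pos e).le]; exact hint e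
    exact h1.congr fun t ht => h.deriv_eq e t ht
  have hmem : ∀ e, MemLp (u' e) 2 (G.edgeMeasure e) := by
    intro e
    obtain ⟨C, hC⟩ := isCompact_Icc.exists_bound_of_continuousOn (hcont e)
    refine MemLp.of_bound ((hcont e).aestronglyMeasurable measurableSet_Icc) C ?_
    filter_upwards [ae_restrict_mem measurableSet_Icc] with t ht using hC t ht
  refine ⟨⟨(u, fun e => (hmem e).toLp _), h.continuous, fun e t ht => ?_⟩, rfl,
    fun e => (hmem e).coeFn_toLp⟩
  simp only
  rw [G.integralCLM_apply le_rfl ht.1 ht.2]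
  have hae : ∫ s in (0 : ℝ)..t, ((hmem e).toLp (u' e)) s = ∫ s in (0 : ℝ)..t, u' e s := by
    rw [intervalIntegral.integral_of_le ht.1, intervalIntegral.integral_of_le ht.1,
      ← G.restrict_edgeMeasure le_rfl ht.2]
    exact integral_congr_ae (ae_restrict_of_ae (hmem e).coeFn_toLp)
  rw [hae, intervalIntegral.integral_eq_sub_of_hasDeriv_right_of_le
    (f := fun s => u (G.pt e s)) ht.1 (h.continuous.comp (G.continuous_pt e)).continuousOn]
  · ring
  · intro s hs
    have hs' : s ∈ Ioo 0 (G.len e) := ⟨hs.1, hs.2.trans_le ht.2⟩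
    exact ((h.hasDeriv e s (Ioo_subset_Icc_self hs')).hasDerivAt
      (Icc_mem_nhds hs'.1 hs'.2)).hasDerivWithinAt
  · exact intervalIntegrable_of_edge' ((hmem e).integrable (by norm_num)) ht

/-- The constant function `1` on an edge. -/
noncomputable def edgeOne (G : MetricGraph E) (e : E) : Lp ℝ 2 (G.edgeMeasure e) :=
  indicatorConstLp 2 (measurableSet_Ioc : MeasurableSet (Ioc 0 (G.len e)))
    (measure_ne_top (G.edgeMeasure e) _) (1 : ℝ)

theorem inner_edgeOne (e : E) (f : Lp ℝ 2 (G.edgeMeasure e)) :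
    inner ℝ (edgeOne G e) f = G.integralCLM e 0 (G.len e) f := rfl

theorem edgeOne_ae (e : E) : edgeOne G e =ᵐ[G.edgeMeasure e] fun _ => 1 := by
  have h1 : G.edgeMeasure e = volume.restrict (Ioc 0 (G.len e)) :=
    (Measure.restrict_congr_set Ioc_ae_eq_Icc).symm
  have h2 : ∀ᵐ t ∂(G.edgeMeasure e), t ∈ Ioc 0 (G.len e) := by
    rw [h1]; exact ae_restrict_mem measurableSet_Ioc
  filter_upwards [indicatorConstLp_coeFn (μ := G.edgeMeasure e) (p := 2)
    (hs := (measurableSet_Ioc : MeasurableSet (Ioc 0 (G.len e))))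
    (hμs := measure_ne_top (G.edgeMeasure e) _) (c := (1 : ℝ)), h2] with t h3 h4
  rw [edgeOne, h3, indicator_of_mem h4]

theorem integral_edgeOne (e : E) : G.integralCLM e 0 (G.len e) (edgeOne G e) = G.len e := by
  rw [← inner_edgeOne, inner_edge_Lp, ← edgeMeasure_real_univ]
  have h1 : ∫ t, edgeOne G e t * edgeOne G e t ∂(G.edgeMeasure e) =
      ∫ _, (1 : ℝ) ∂(G.edgeMeasure e) := by
    refine integral_congr_ae ?_
    filter_upwards [edgeOne_ae (G := G) e] with t ht
    rw [ht, mul_one]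
  rw [h1]
  simp

variable [Fintype E]

theorem dirichlet_apply_integral (v w : G.Sobolev) :
    dirichlet v w = ∑ e, ∫ t, v.grad e t * w.grad e t ∂(G.edgeMeasure e) := by
  simp only [dirichlet_apply, inner_edge_Lp]

theorem sum_normalDeriv (p : E → ℝ → ℝ) (v : G.Sobolev) :
    ∑ e, (p e (G.len e) * v.toFun (G.pt e (G.len e)) - p e 0 * v.toFun (G.pt e 0)) =
      ∑ a : E × Bool, G.normalDeriv p a * v.toFun (G.endPt a) := by
  rw [Fintype.sum_prod_type]
  refine Finset.sum_congr rfl fun e _ => ?_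
  simp [normalDeriv, endPt]
  ring

/-- Green's formula on the graph. -/
theorem green {p p₁ : E → ℝ → ℝ} (hp₁ : ∀ e, Integrable (p₁ e) (G.edgeMeasure e))
    (hp : ∀ e, ∀ t ∈ Icc 0 (G.len e), p e t = p e 0 + ∫ s in (0 : ℝ)..t, p₁ e s)
    (v : G.Sobolev) :
    ∑ e, ∫ t, p e t * v.grad e t ∂(G.edgeMeasure e) +
      ∑ e, ∫ t, p₁ e t * v.toFun (G.pt e t) ∂(G.edgeMeasure e) =
      ∑ a : E × Bool, G.normalDeriv p a * v.toFun (G.endPt a) := by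
  rw [← sum_normalDeriv, ← Finset.sum_add_distrib]
  refine Finset.sum_congr rfl fun e _ => ?_
  have hl := (G.len_pos e).le
  have hg := intervalIntegrable_of_edge (integrable_edge_Lp (v.grad e))
  have hi := intervalIntegrable_of_edge (hp₁ e)
  rw [integral_edgeMeasure, integral_edgeMeasure, ← intervalIntegral.integral_add]
  · exact integral_parts_of_primitive hl hi hg (hp e) fun t ht => v.toFun_pt' ht
  · refine hg.continuousOn_mul ?_
    have h1 : ContinuousOn (fun t => p e 0 + ∫ s in (0 : ℝ)..t, p₁ e s) (uIcc 0 (G.len e)) := by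
      refine continuousOn_const.add (intervalIntegral.continuousOn_primitive_interval ?_)
      rw [uIcc_of_le hl]; exact hp₁ e
    refine h1.congr fun t ht => ?_
    rw [uIcc_of_le hl] at ht
    exact hp e t ht
  · exact hi.mul_continuousOn (v.continuous_comp_pt e).continuousOn

theorem sum_kirchhoff {p : E → ℝ → ℝ} (hp : G.Kirchhoff p) (v : G.Sobolev) :
    ∑ a : E × Bool, G.normalDeriv p a * v.toFun (G.endPt a) = 0 := by
  classical
  have : Fintype G.Vertex := Fintype.ofFinite _
  rw [← Finset.sum_fiberwise (s := Finset.univ) (g := fun a => (Quotient.mk G.vertexSetoid a))]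
  refine Finset.sum_eq_zero fun x _ => ?_
  have h1 : ∑ a : E × Bool with Quotient.mk G.vertexSetoid a = x,
      G.normalDeriv p a * v.toFun (G.endPt a) =
      ∑ a : E × Bool with Quotient.mk G.vertexSetoid a = x,
      G.normalDeriv p a * v.toFun (G.endPt x.out) := by
    refine Finset.sum_congr rfl fun a ha => ?_
    rw [endPt_eq_of_rel (a := a) (b := x.out)]
    apply Quotient.exact
    rw [(Finset.mem_filter.1 ha).2, Quotient.out_eq]
  rw [h1, ← Finset.sum_mul]
  have h2 := hp x
  have h3 : ∑ a : E × Bool with Quotient.mk G.vertexSetoid a = x, G.normalDeriv p a = 0 := by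
    convert h2
  rw [h3, zero_mul]

/-- `w` is a weak solution of `-w'' + q w = μ w` with Kirchhoff conditions. -/
def IsWeakSolution (q : G.Point → ℝ) (hq : IsBoundedPotential q) (μ : ℝ) (w : G.Sobolev) : Prop :=
  ∀ v, dirichlet w v + weight q hq w v = μ * mass w v

/-- Green's formula turns the equation into the weak one; the Kirchhoff condition cancels the vertex
terms, test functions having a single value at each vertex. -/
theorem exists_isWeakSolution {q : G.Point → ℝ} (hq : IsBoundedPotential q) {μ : ℝ}
    {u : G.Point → ℝ} (h : G.IsEigenfunction q μ u) :
    ∃ w : G.Sobolev, w.toFun = u ∧ IsWeakSolution q hq μ w := by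
  obtain ⟨-, u', u'', hH2, hK, heq⟩ := h
  obtain ⟨w, rfl, hw⟩ := exists_of_isH2 hH2
  refine ⟨w, rfl, fun v => ?_⟩
  have h1 := green (fun e => (hH2.memLp e).integrable (by norm_num)) hH2.deriv_eq v
  rw [sum_kirchhoff hK] at h1
  have h2 : dirichlet w v = ∑ e, ∫ t, u' e t * v.grad e t ∂(G.edgeMeasure e) := by
    rw [dirichlet_apply_integral]
    refine Finset.sum_congr rfl fun e _ => integral_congr_ae ?_
    filter_upwards [hw e] with t ht
    rw [ht]
  have h3 : weight q hq w v - μ * mass w v =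
      ∑ e, ∫ t, u'' e t * v.toFun (G.pt e t) ∂(G.edgeMeasure e) := by
    rw [weight_apply, mass_apply, Finset.mul_sum, ← Finset.sum_sub_distrib]
    refine Finset.sum_congr rfl fun e _ => ?_
    rw [← integral_const_mul, ← integral_sub (integrable_weight hq w v e)
      ((w.integrable_mul v e).const_mul μ)]
    refine integral_congr_ae ?_
    filter_upwards [heq e] with t ht
    have : u'' e t = q (G.pt e t) * w.toFun (G.pt e t) - μ * w.toFun (G.pt e t) := by linarith
    rw [this]; ring
  linarith

/-- If `∑ ∫ K v' = 0` for all `v` vanishing at the vertices, then `K` is constant on each edge. -/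
theorem eq_const_of_forall_inner_eq_zero (K : ∀ e, Lp ℝ 2 (G.edgeMeasure e))
    (hK : ∀ v : G.Sobolev, (∀ a, v.toFun (G.endPt a) = 0) → ∑ e, inner ℝ (K e) (v.grad e) = 0) :
    ∃ m : E → ℝ, ∀ e, K e =ᵐ[G.edgeMeasure e] fun _ => m e := by
  let m : E → ℝ := fun e => G.integralCLM e 0 (G.len e) (K e) / G.len e
  -- Removing the mean makes the integral over each edge vanish, so h is itself the gradient of an
  -- admissible test function, and testing with it gives the sum of the squared norms of h.
  let h : ∀ e, Lp ℝ 2 (G.edgeMeasure e) := fun e => K e - m e • edgeOne G e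
  have hint : ∀ e, G.integralCLM e 0 (G.len e) (h e) = 0 := by
    intro e
    have := (G.len_pos e).ne'
    simp only [h, m, map_sub, map_smul, integral_edgeOne, smul_eq_mul]
    field_simp
    ring
  obtain ⟨v, hv1, hv2⟩ := exists_of_vertex_values (fun _ : G.Vertex => 0) h (by simp [hint])
  have h1 := hK v hv2
  have h2 : ∀ e, inner ℝ (K e) (v.grad e) = inner ℝ (h e) (h e) := by
    intro e
    have h3 : K e = h e + m e • edgeOne G e := by simp [h]
    rw [hv1, h3, inner_add_left, inner_smul_left, inner_edgeOne, hint]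
    simp
  simp only [h2] at h1
  rw [Finset.sum_eq_zero_iff_of_nonneg fun _ _ => real_inner_self_nonneg] at h1
  refine ⟨m, fun e => ?_⟩
  have h4 : h e = 0 := inner_self_eq_zero.1 (h1 e (Finset.mem_univ e))
  have h5 : K e = m e • edgeOne G e := sub_eq_zero.1 h4
  rw [h5]
  filter_upwards [Lp.coeFn_smul (m e) (edgeOne G e), edgeOne_ae (G := G) e] with t h6 h7
  rw [h6, Pi.smul_apply, h7, smul_eq_mul, mul_one]

/-- Test with the function that is 1 at the given vertex, 0 at the others and affine on the edges.
-/
theorem kirchhoff_of_forall {p : E → ℝ → ℝ}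
    (hp : ∀ v : G.Sobolev, ∑ a : E × Bool, G.normalDeriv p a * v.toFun (G.endPt a) = 0) :
    G.Kirchhoff p := by
  classical
  intro x
  let c : G.Vertex → ℝ := fun y => if y = x then 1 else 0
  obtain ⟨v, -, hv⟩ := exists_of_vertex_values c (fun e =>
    ((c (Quotient.mk _ (e, true)) - c (Quotient.mk _ (e, false))) / G.len e) • edgeOne G e)
    (fun e => by
      have := (G.len_pos e).ne'
      simp only [map_smul, integral_edgeOne, smul_eq_mul]
      field_simp)
  have h1 := hp v
  simp only [hv, c, mul_ite, mul_one, mul_zero] at h1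
  rw [← Finset.sum_filter] at h1
  convert h1

/-- Regularity by du Bois-Reymond. With r = (q − μ)w, testing with functions that vanish at the
vertices shows that the gradient differs from the primitive of r by a constant on each edge. Hence w
is C¹ with second derivative r, and general test functions then give the Kirchhoff condition. -/
theorem IsWeakSolution.isEigenfunction {q : G.Point → ℝ} {hq : IsBoundedPotential q} {μ : ℝ}
    {w : G.Sobolev} (hw : IsWeakSolution q hq μ w) (hne : w.toFun ≠ 0) :
    G.IsEigenfunction q μ w.toFun := by
  let r : E → ℝ → ℝ := fun e t => (q (G.pt e t) - μ) * w.toFun (G.pt e t)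
  have hr2 : ∀ e, MemLp (r e) 2 (G.edgeMeasure e) := by
    intro e
    obtain ⟨C, hC⟩ := hq.bounded
    obtain ⟨B, hB⟩ := isCompact_Icc.exists_bound_of_continuousOn
      (w.continuous_comp_pt e).continuousOn (s := Icc 0 (G.len e))
    refine MemLp.of_bound (((hq.aestronglyMeasurable e).sub aestronglyMeasurable_const).mul
      (w.continuous_comp_pt e).aestronglyMeasurable) ((C + |μ|) * B) ?_
    filter_upwards [ae_restrict_mem measurableSet_Icc] with t ht
    rw [norm_mul]
    refine mul_le_mul ((abs_sub _ _).trans (by linarith [hC (G.pt e t)])) (hB t ht)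
      (norm_nonneg _) ?_
    linarith [(abs_nonneg _).trans (hC (G.pt e t)), abs_nonneg μ]
  have hr : ∀ e, Integrable (r e) (G.edgeMeasure e) := fun e => (hr2 e).integrable (by norm_num)
  have hweak : ∀ v : G.Sobolev, ∑ e, ∫ t, w.grad e t * v.grad e t ∂(G.edgeMeasure e) +
      ∑ e, ∫ t, r e t * v.toFun (G.pt e t) ∂(G.edgeMeasure e) = 0 := by
    intro v
    have h1 := hw v
    have h3 : weight q hq w v - μ * mass w v =
        ∑ e, ∫ t, r e t * v.toFun (G.pt e t) ∂(G.edgeMeasure e) := by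
      rw [weight_apply, mass_apply, Finset.mul_sum, ← Finset.sum_sub_distrib]
      refine Finset.sum_congr rfl fun e _ => ?_
      rw [← integral_const_mul, ← integral_sub (integrable_weight hq w v e)
        ((w.integrable_mul v e).const_mul μ)]
      refine integral_congr_ae (.of_forall fun t => ?_)
      simp only [r]; ring
    rw [← dirichlet_apply_integral, ← h3]
    linarith
  have hprim : ∀ (c : ℝ) e, ContinuousOn (fun t => c + ∫ s in (0 : ℝ)..t, r e s)
      (Icc 0 (G.len e)) := by
    intro c e
    rw [← uIcc_of_le (G.len_pos e).le]
    refine continuousOn_const.add (intervalIntegral.continuousOn_primitive_interval ?_)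
    rw [uIcc_of_le (G.len_pos e).le]; exact hr e
  -- The leading `0 +` keeps the shape of `hprim` at `c = 0`.
  have hp0mem : ∀ e, MemLp (fun t => 0 + ∫ s in (0 : ℝ)..t, r e s) 2 (G.edgeMeasure e) := by
    intro e
    obtain ⟨C, hC⟩ := isCompact_Icc.exists_bound_of_continuousOn (hprim 0 e)
    refine MemLp.of_bound ((hprim 0 e).aestronglyMeasurable measurableSet_Icc) C ?_
    filter_upwards [ae_restrict_mem measurableSet_Icc] with t ht using hC t ht
  obtain ⟨m, hm⟩ := eq_const_of_forall_inner_eq_zero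
    (fun e => w.grad e - (hp0mem e).toLp _) (by
      intro v hv
      have h1 := green (p := fun e t => 0 + ∫ s in (0 : ℝ)..t, r e s) hr (by simp) v
      simp only [hv, mul_zero, Finset.sum_const_zero] at h1
      have h2 := hweak v
      have h3 : ∀ e, inner ℝ (w.grad e - (hp0mem e).toLp _) (v.grad e) =
          ∫ t, w.grad e t * v.grad e t ∂(G.edgeMeasure e) -
          ∫ t, (0 + ∫ s in (0 : ℝ)..t, r e s) * v.grad e t ∂(G.edgeMeasure e) := by
        intro e
        rw [inner_sub_left, inner_edge_Lp, inner_edge_Lp]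
        congr 1
        refine integral_congr_ae ?_
        filter_upwards [(hp0mem e).coeFn_toLp] with t ht
        rw [ht]
      simp only [h3, Finset.sum_sub_distrib]
      linarith)
  let p : E → ℝ → ℝ := fun e t => m e + ∫ s in (0 : ℝ)..t, r e s
  have hgrad : ∀ e, w.grad e =ᵐ[G.edgeMeasure e] p e := by
    intro e
    filter_upwards [hm e, Lp.coeFn_sub (w.grad e) ((hp0mem e).toLp _),
      (hp0mem e).coeFn_toLp] with t h1 h2 h3
    rw [h2, Pi.sub_apply, h3] at h1
    simp only [p]
    linarith
  have hp : ∀ e, ∀ t ∈ Icc 0 (G.len e), p e t = p e 0 + ∫ s in (0 : ℝ)..t, r e s := by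
    intro e t _
    simp [p]
  refine ⟨hne, p, r, ⟨w.continuous_toFun, fun e t ht => ?_, hr2, hp⟩, ?_, fun e => ?_⟩
  -- A continuous extension of p to the line makes the fundamental theorem of calculus available at
  -- the end points of the edge as well.
  · let p' : ℝ → ℝ := fun t => p e (projIcc 0 (G.len e) (G.len_pos e).le t)
    have hp' : Continuous p' := (hprim (m e) e).comp_continuous
      (continuous_subtype_val.comp continuous_projIcc) fun x => Subtype.mem _
    have hpp' : ∀ s ∈ Icc 0 (G.len e), p' s = p e s := fun s hs => by
      simp only [p', projIcc_of_mem _ hs]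
    have h1 : HasDerivAt (fun s => w.toFun (G.pt e 0) + ∫ x in (0 : ℝ)..s, p' x) (p' t) t :=
      (hp'.integral_hasStrictDerivAt 0 t).hasDerivAt.const_add _
    rw [hpp' t ht] at h1
    refine h1.hasDerivWithinAt.congr_of_mem (fun s hs => ?_) ht
    rw [w.toFun_pt' hs]
    congr 1
    rw [intervalIntegral.integral_of_le hs.1, intervalIntegral.integral_of_le hs.1]
    have h2 : ∀ᵐ x ∂(volume.restrict (Ioc 0 s)), w.grad e x = p e x := by
      rw [← G.restrict_edgeMeasure le_rfl hs.2]
      exact ae_restrict_of_ae (hgrad e)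
    refine integral_congr_ae ?_
    filter_upwards [h2, ae_restrict_mem measurableSet_Ioc] with x hx hx'
    rw [hx, hpp' x ⟨hx'.1.le, hx'.2.trans hs.2⟩]
  · refine kirchhoff_of_forall fun v => ?_
    rw [← green hr hp v, ← hweak v]
    congr 1
    refine Finset.sum_congr rfl fun e _ => integral_congr_ae ?_
    filter_upwards [hgrad e] with t ht
    rw [ht]
  · refine .of_forall fun t => ?_
    simp only [r]; ring

end Sobolev

end MetricGraph

/-! ### The first two eigenvalues and their variational characterisation. -/

namespace MetricGraph

variable {E : Type*} {G : MetricGraph E}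

theorem isBoundedPotential_of_mem {M : ℝ} {q : G.Point → ℝ} (hq : q ∈ G.boundedClass M) :
    IsBoundedPotential q :=
  ⟨hq.1, M, fun x => abs_le.2 ⟨by linarith [(hq.2 x).1, (hq.2 x).2], (hq.2 x).2⟩⟩

theorem zero_mem_boundedClass {M : ℝ} (hM : 0 ≤ M) : (fun _ => 0) ∈ G.boundedClass M :=
  ⟨fun _ => aestronglyMeasurable_const, fun _ => ⟨le_rfl, hM⟩⟩

namespace Sobolev

/-- The constant 1 and the function equal to t(len − t) on each edge: the second vanishes at the
vertices but not at the midpoint of an edge. -/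
theorem exists_independent_pair [Nonempty E] (G : MetricGraph E) : ∃ u₁ u₂ : G.Sobolev,
    ∀ s t : ℝ, s • u₁.toFun + t • u₂.toFun = 0 → s = 0 ∧ t = 0 := by
  obtain ⟨u₁, h1, h1'⟩ := exists_of_vertex_values (fun _ : G.Vertex => 1) (fun e => 0) (by simp)
  have hmem : ∀ e, MemLp (fun t => G.len e - 2 * t) 2 (G.edgeMeasure e) := by
    intro e
    have hc : ContinuousOn (fun t => G.len e - 2 * t) (Icc 0 (G.len e)) := by fun_prop
    obtain ⟨C, hC⟩ := isCompact_Icc.exists_bound_of_continuousOn hc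
    refine MemLp.of_bound (hc.aestronglyMeasurable measurableSet_Icc) C ?_
    filter_upwards [ae_restrict_mem measurableSet_Icc] with t ht using hC t ht
  have hint : ∀ e, ∀ t ∈ Icc 0 (G.len e),
      G.integralCLM e 0 t ((hmem e).toLp _) = G.len e * t - t ^ 2 := by
    intro e t ht
    rw [G.integralCLM_apply le_rfl ht.1 ht.2]
    have h2 : ∫ s in (0 : ℝ)..t, ((hmem e).toLp _) s = ∫ s in (0 : ℝ)..t, (G.len e - 2 * s) := by
      rw [intervalIntegral.integral_of_le ht.1, intervalIntegral.integral_of_le ht.1,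
        ← G.restrict_edgeMeasure le_rfl ht.2]
      exact integral_congr_ae (ae_restrict_of_ae (hmem e).coeFn_toLp)
    rw [h2, intervalIntegral.integral_sub (by simp) (Continuous.intervalIntegrable (by fun_prop) _ _),
      intervalIntegral.integral_const_mul, integral_id]
    simp
    ring
  obtain ⟨u₂, h2, h2'⟩ := exists_of_vertex_values (fun _ : G.Vertex => 0)
    (fun e => (hmem e).toLp _) (fun e => by
      rw [hint e _ ⟨(G.len_pos e).le, le_rfl⟩]; ring)
  refine ⟨u₁, u₂, fun s t hst => ?_⟩
  obtain ⟨e⟩ := ‹Nonempty E›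
  have hl := G.len_pos e
  have h3 := congrFun hst (G.endPt (e, false))
  simp only [Pi.add_apply, Pi.smul_apply, h1', h2', smul_eq_mul, Pi.zero_apply] at h3
  have hs : s = 0 := by linarith
  have h4 := congrFun hst (G.pt e (G.len e / 2))
  have hm : G.len e / 2 ∈ Icc 0 (G.len e) := ⟨by linarith, by linarith⟩
  have h5 : u₂.toFun (G.pt e 0) = 0 := by simpa [endPt] using h2' (e, false)
  simp only [Pi.add_apply, Pi.smul_apply, smul_eq_mul, Pi.zero_apply, u₂.toFun_pt hm, h2,
    hint e _ hm, hs, h5] at h4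
  refine ⟨hs, ?_⟩
  have h6 : t * (G.len e * (G.len e / 2) - (G.len e / 2) ^ 2) = 0 := by linarith
  rcases mul_eq_zero.1 h6 with h7 | h7
  · exact h7
  · nlinarith

variable [Fintype E]

theorem mass_pos {v : G.Sobolev} (hv : v.toFun ≠ 0) : 0 < mass v v := by
  refine (mass_nonneg v).lt_of_ne fun h0 => hv ?_
  funext x
  obtain ⟨e, t, ht, rfl⟩ := G.exists_pt_eq x
  rw [mass_apply, eq_comm, Finset.sum_eq_zero_iff_of_nonneg
    fun _ _ => integral_nonneg fun _ => mul_self_nonneg _] at h0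
  have h1 := h0 e (Finset.mem_univ e)
  rw [integral_eq_zero_iff_of_nonneg (fun _ => mul_self_nonneg _) (v.integrable_mul v e)] at h1
  have h2 := Measure.eqOn_Icc_of_ae_eq volume (G.len_pos e).ne h1
    ((v.continuous_comp_pt e).mul (v.continuous_comp_pt e)).continuousOn continuousOn_const ht
  exact mul_self_eq_zero.1 h2

theorem toFun_eq_zero_of_mass {v : G.Sobolev} (hv : mass v v = 0) : v.toFun = 0 := by
  by_contra h
  exact (mass_pos h).ne' hv

/-- A plane meets a hyperplane in a nonzero vector; this is the dimension count behind the second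
eigenvalue. -/
theorem exists_orthogonal_combination (w u₁ u₂ : G.Sobolev)
    (h : ∀ s t : ℝ, s • u₁.toFun + t • u₂.toFun = 0 → s = 0 ∧ t = 0) :
    ∃ s t : ℝ, mass w (s • u₁ + t • u₂) = 0 ∧ (s • u₁ + t • u₂).toFun ≠ 0 := by
  by_cases h0 : mass w u₁ = 0
  · refine ⟨1, 0, by simp [h0], fun h1 => ?_⟩
    exact one_ne_zero (h 1 0 h1).1
  · refine ⟨mass w u₂, -mass w u₁, by simp; ring, fun h1 => h0 ?_⟩
    simpa using (h _ _ h1).2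

/-- The quadratic form of the Schrödinger operator. -/
noncomputable def schrodinger (q : G.Point → ℝ) (hq : IsBoundedPotential q) :
    LinearMap.BilinForm ℝ G.Sobolev := dirichlet + weight q hq

theorem schrodinger_apply (q : G.Point → ℝ) (hq : IsBoundedPotential q) (v w : G.Sobolev) :
    schrodinger q hq v w = dirichlet v w + weight q hq v w := rfl

/-- Adding the L² product makes the form comparable to the full H¹ norm, as 0 ≤ q ≤ M; compactness
and completeness are thereby reduced to those of H¹. -/
theorem isCompactPair [Nonempty E] {M : ℝ} {q : G.Point → ℝ} (hq : q ∈ G.boundedClass M) :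
    (schrodinger q (isBoundedPotential_of_mem hq) + mass).IsCompactPair mass where
  symm_left u v := by
    simp only [LinearMap.add_apply, schrodinger_apply, dirichlet_symm u, weight_symm _ u, mass]
  symm_right u v := weight_symm _ u v
  nonneg := mass_nonneg
  le v := by
    have h1 := dirichlet_nonneg v
    have h2 := weight_nonneg (isBoundedPotential_of_mem hq) (fun x => (hq.2 x).1) v
    simp only [LinearMap.add_apply, schrodinger_apply]
    linarith
  compact x C hx := by
    refine exists_subseq_mass_cauchy x (C := C) fun n => ?_
    have h2 := weight_nonneg (isBoundedPotential_of_mem hq) (fun x => (hq.2 x).1) (x n)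
    have := hx n
    simp only [LinearMap.add_apply, schrodinger_apply] at this
    linarith
  complete x hx := by
    have hM : 0 ≤ 1 + |M| := by positivity
    obtain ⟨u, hu⟩ := exists_limit x (squeeze_zero
      (fun p => add_nonneg (dirichlet_nonneg _) (mass_nonneg _)) (fun p => by
        have h2 := weight_nonneg (isBoundedPotential_of_mem hq) (fun x => (hq.2 x).1)
          (x p.1 - x p.2)
        simp only [LinearMap.add_apply, schrodinger_apply]
        linarith) hx)
    refine ⟨u, squeeze_zero (fun n => ?_) (fun n => ?_)
      (g := fun n => (1 + |M|) * (dirichlet (x n - u) (x n - u) + mass (x n - u) (x n - u))) ?_⟩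
    · simp only [LinearMap.add_apply, schrodinger_apply]
      have h2 := weight_nonneg (isBoundedPotential_of_mem hq) (fun x => (hq.2 x).1) (x n - u)
      have := dirichlet_nonneg (x n - u)
      have := mass_nonneg (x n - u)
      linarith
    · simp only [LinearMap.add_apply, schrodinger_apply]
      have h2 := weight_le (isBoundedPotential_of_mem hq) (fun x => (hq.2 x).2) (x n - u)
      have h3 := dirichlet_nonneg (x n - u)
      have h4 := mass_nonneg (x n - u)
      have h5 := mul_le_mul_of_nonneg_right (le_abs_self M) h4
      have h6 := mul_nonneg (abs_nonneg M) h3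
      linarith
    · have := hu.const_mul (1 + |M|)
      rwa [mul_zero] at this
  exists_orthogonal w := by
    obtain ⟨u₁, u₂, hu⟩ := exists_independent_pair G
    obtain ⟨s, t, h1, h2⟩ := exists_orthogonal_combination w u₁ u₂ hu
    exact ⟨_, h1, mass_pos h2⟩

theorem exists_two_weakSolutions [Nonempty E] {M : ℝ} {q : G.Point → ℝ}
    (hq : q ∈ G.boundedClass M) :
    ∃ (w₁ w₂ : G.Sobolev) (l₁ l₂ : ℝ), l₁ ≤ l₂ ∧ mass w₁ w₁ = 1 ∧ mass w₂ w₂ = 1 ∧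
      mass w₁ w₂ = 0 ∧ IsWeakSolution q (isBoundedPotential_of_mem hq) l₁ w₁ ∧
      IsWeakSolution q (isBoundedPotential_of_mem hq) l₂ w₂ ∧
      (∀ v, l₁ * mass v v ≤ schrodinger q (isBoundedPotential_of_mem hq) v v) ∧
      (∀ v, mass w₁ v = 0 →
        l₂ * mass v v ≤ schrodinger q (isBoundedPotential_of_mem hq) v v) := by
  obtain ⟨w₁, w₂, l₁, l₂, h1, h2, h3, h4, h5, h6, h7, h8⟩ :=
    (isCompactPair hq).exists_two_eigenvectors
  simp only [LinearMap.add_apply, schrodinger_apply] at h5 h6 h7 h8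
  -- The shift by the L² product raised both eigenvalues by 1.
  refine ⟨w₁, w₂, l₁ - 1, l₂ - 1, by linarith, h2, h3, h4, fun v => ?_, fun v => ?_, fun v => ?_,
    fun v hv => ?_⟩
  · linarith [h5 v]
  · linarith [h6 v]
  · rw [schrodinger_apply]; linarith [h7 v]
  · rw [schrodinger_apply]; linarith [h8 v hv]

theorem mass_symm (v w : G.Sobolev) : mass v w = mass w v := weight_symm _ v w

/-- On the span of two weak solutions the Rayleigh quotient is at most the larger eigenvalue. -/
theorem schrodinger_combination_le {q : G.Point → ℝ} {hq : IsBoundedPotential q} {μ₁ μ₂ x : ℝ}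
    {u₁ u₂ : G.Sobolev} (h₁ : IsWeakSolution q hq μ₁ u₁) (h₂ : IsWeakSolution q hq μ₂ u₂)
    (hμ₁ : μ₁ ≤ x) (hμ₂ : μ₂ ≤ x) (s t : ℝ) :
    schrodinger q hq (s • u₁ + t • u₂) (s • u₁ + t • u₂) ≤
      x * mass (s • u₁ + t • u₂) (s • u₁ + t • u₂) := by
  have e1 : ∀ v, schrodinger q hq u₁ v = μ₁ * mass u₁ v := h₁
  have e2 : ∀ v, schrodinger q hq u₂ v = μ₂ * mass u₂ v := h₂
  have hsymm : schrodinger q hq u₁ u₂ = schrodinger q hq u₂ u₁ := by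
    rw [schrodinger_apply, schrodinger_apply, dirichlet_symm, weight_symm]
  have h12 : μ₁ * mass u₁ u₂ = μ₂ * mass u₁ u₂ := by
    rw [← e1, hsymm, e2, mass_symm]
  simp only [map_add, map_smul, LinearMap.add_apply, LinearMap.smul_apply, smul_eq_mul, e1, e2,
    mass_symm u₂ u₁]
  -- Either the cross term disappears, or the two eigenvalues coincide by `h12` and the form is a
  -- multiple of the mass on the whole span.
  by_cases hm : mass u₁ u₂ = 0
  · rw [hm]
    have := mul_le_mul_of_nonneg_right hμ₁ (mul_nonneg (mul_self_nonneg s) (mass_nonneg u₁))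
    have := mul_le_mul_of_nonneg_right hμ₂ (mul_nonneg (mul_self_nonneg t) (mass_nonneg u₂))
    nlinarith
  · obtain rfl : μ₁ = μ₂ := mul_right_cancel₀ hm h12
    have h0 := mass_nonneg (s • u₁ + t • u₂)
    simp only [map_add, map_smul, LinearMap.add_apply, LinearMap.smul_apply, smul_eq_mul,
      mass_symm u₂ u₁] at h0
    have := mul_le_mul_of_nonneg_right hμ₁ h0
    nlinarith

theorem isLeast_atLeastEigenvalues_one {q : G.Point → ℝ} {hq : IsBoundedPotential q} {l : ℝ}
    {w : G.Sobolev} (hw1 : mass w w = 1) (hw : IsWeakSolution q hq l w)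
    (hmin : ∀ v, l * mass v v ≤ schrodinger q hq v v) :
    IsLeast (G.atLeastEigenvalues q 1) l := by
  have hne : w.toFun ≠ 0 := fun h => by
    simp [mass_apply, h] at hw1
  refine ⟨⟨fun _ => w.toFun, ?_, fun _ => ⟨l, le_rfl, hw.isEigenfunction hne⟩⟩, ?_⟩
  · exact linearIndependent_unique_iff.2 hne
  · rintro x ⟨u, -, hu⟩
    obtain ⟨μ, hμ, hu0⟩ := hu 0
    obtain ⟨v, hv, hweak⟩ := exists_isWeakSolution hq hu0
    have hpos : 0 < mass v v := mass_pos (by rw [hv]; exact hu0.1)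
    have h1 := hmin v
    rw [schrodinger_apply, hweak v] at h1
    exact (le_of_mul_le_mul_right h1 hpos).trans hμ

theorem linearIndependent_pair_of_mass {w₁ w₂ : G.Sobolev} (h1 : mass w₁ w₁ = 1)
    (h2 : mass w₂ w₂ = 1) (h12 : mass w₁ w₂ = 0) (s t : ℝ)
    (h : s • w₁.toFun + t • w₂.toFun = 0) : s = 0 ∧ t = 0 := by
  have h3 : mass (s • w₁ + t • w₂) (s • w₁ + t • w₂) = 0 := by
    have : (s • w₁ + t • w₂).toFun = 0 := h
    simp only [mass_apply, this]
    simp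
  simp only [map_add, map_smul, LinearMap.add_apply, LinearMap.smul_apply, smul_eq_mul, h1, h2,
    h12, mass_symm w₂ w₁] at h3
  constructor <;> nlinarith [sq_nonneg s, sq_nonneg t]

/-- For minimality: two independent eigenfunctions with eigenvalues at most x span a plane, which
contains a nonzero vector orthogonal to w₁. Its Rayleigh quotient is at least l₂ and at most x. -/
theorem isLeast_atLeastEigenvalues_two {q : G.Point → ℝ} {hq : IsBoundedPotential q}
    {l₁ l₂ : ℝ} (hl : l₁ ≤ l₂) {w₁ w₂ : G.Sobolev} (h1 : mass w₁ w₁ = 1) (h2 : mass w₂ w₂ = 1)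
    (h12 : mass w₁ w₂ = 0) (hw₁ : IsWeakSolution q hq l₁ w₁) (hw₂ : IsWeakSolution q hq l₂ w₂)
    (hmin : ∀ v, mass w₁ v = 0 → l₂ * mass v v ≤ schrodinger q hq v v) :
    IsLeast (G.atLeastEigenvalues q 2) l₂ := by
  have hind := linearIndependent_pair_of_mass h1 h2 h12
  have hne₁ : w₁.toFun ≠ 0 := fun h => one_ne_zero (hind 1 0 (by simp [h])).1
  have hne₂ : w₂.toFun ≠ 0 := fun h => one_ne_zero (hind 0 1 (by simp [h])).2
  refine ⟨⟨![w₁.toFun, w₂.toFun], LinearIndependent.pair_iff.2 hind, fun i => ?_⟩, ?_⟩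
  · fin_cases i
    · exact ⟨l₁, hl, hw₁.isEigenfunction hne₁⟩
    · exact ⟨l₂, le_rfl, hw₂.isEigenfunction hne₂⟩
  · rintro x ⟨u, hu, hev⟩
    obtain ⟨μ₁, hμ₁, hu₁⟩ := hev 0
    obtain ⟨μ₂, hμ₂, hu₂⟩ := hev 1
    obtain ⟨v₁, hv₁, hweak₁⟩ := exists_isWeakSolution hq hu₁
    obtain ⟨v₂, hv₂, hweak₂⟩ := exists_isWeakSolution hq hu₂
    have hu' : LinearIndependent ℝ ![v₁.toFun, v₂.toFun] := by
      convert hu using 1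
      funext i
      fin_cases i <;> simp [hv₁, hv₂]
    obtain ⟨s, t, horth, hne⟩ :=
      exists_orthogonal_combination w₁ v₁ v₂ (LinearIndependent.pair_iff.1 hu')
    have h3 := (hmin _ horth).trans (schrodinger_combination_le hweak₁ hweak₂ hμ₁ hμ₂ s t)
    exact le_of_mul_le_mul_right h3 (mass_pos hne)

/-- There is an `n`-dimensional space on which the Rayleigh quotient is at most `x`. -/
def RayleighLE (q : G.Point → ℝ) (hq : IsBoundedPotential q) (n : ℕ) (x : ℝ) : Prop :=
  ∃ W : Submodule ℝ G.Sobolev, (∃ u : Fin n → G.Sobolev,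
    LinearIndependent ℝ (fun i => (u i).toFun) ∧ ∀ i, u i ∈ W) ∧
    ∀ v ∈ W, schrodinger q hq v v ≤ x * mass v v

/-- The point of this form is that a trial space is not tied to the potential: comparing eigenvalues
of two potentials reduces to comparing their forms on one space. -/
theorem rayleigh_characterization [Nonempty E] {M : ℝ} {q : G.Point → ℝ}
    (hq : q ∈ G.boundedClass M) {n : ℕ} (hn : n = 1 ∨ n = 2) :
    IsLeast (G.atLeastEigenvalues q n) (G.eigenvalue q n) ∧
      ∀ x, RayleighLE q (isBoundedPotential_of_mem hq) n x ↔ G.eigenvalue q n ≤ x := by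
  obtain ⟨w₁, w₂, l₁, l₂, hl, h1, h2, h12, hw₁, hw₂, hmin₁, hmin₂⟩ := exists_two_weakSolutions hq
  rcases hn with rfl | rfl
  · have hleast := isLeast_atLeastEigenvalues_one h1 hw₁ hmin₁
    have heq : G.eigenvalue q 1 = l₁ := hleast.csInf_eq
    rw [heq]
    refine ⟨hleast, fun x => ⟨?_, fun hx => ?_⟩⟩
    · rintro ⟨W, ⟨u, hu, huW⟩, hW⟩
      have h3 := (hmin₁ (u 0)).trans (hW _ (huW 0))
      exact le_of_mul_le_mul_right h3 (mass_pos (hu.ne_zero 0))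
    · refine ⟨Submodule.span ℝ {w₁}, ⟨fun _ => w₁, ?_, fun _ => Submodule.mem_span_singleton_self _⟩,
        fun v hv => ?_⟩
      · refine linearIndependent_unique_iff.2 fun h => ?_
        have h : w₁.toFun = 0 := h
        simp [mass_apply, h] at h1
      · obtain ⟨c, rfl⟩ := Submodule.mem_span_singleton.1 hv
        -- The estimate for pairs, used with a repeated solution and second coefficient 0.
        have := schrodinger_combination_le hw₁ hw₁ hx hx c 0
        simpa only [zero_smul, add_zero] using this
  · have hleast := isLeast_atLeastEigenvalues_two hl h1 h2 h12 hw₁ hw₂ hmin₂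
    have heq : G.eigenvalue q 2 = l₂ := hleast.csInf_eq
    rw [heq]
    refine ⟨hleast, fun x => ⟨?_, fun hx => ?_⟩⟩
    · rintro ⟨W, ⟨u, hu, huW⟩, hW⟩
      have hu' : LinearIndependent ℝ ![(u 0).toFun, (u 1).toFun] := by
        convert hu using 1
        funext i
        fin_cases i <;> rfl
      obtain ⟨s, t, horth, hne⟩ :=
        exists_orthogonal_combination w₁ (u 0) (u 1) (LinearIndependent.pair_iff.1 hu')
      have h3 := (hmin₂ _ horth).trans
        (hW _ (W.add_mem (W.smul_mem s (huW 0)) (W.smul_mem t (huW 1))))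
      exact le_of_mul_le_mul_right h3 (mass_pos hne)
    · refine ⟨Submodule.span ℝ {w₁, w₂}, ⟨![w₁, w₂], ?_, fun i => ?_⟩, fun v hv => ?_⟩
      · have := LinearIndependent.pair_iff.2 (linearIndependent_pair_of_mass h1 h2 h12)
        have h3 : (fun i => (![w₁, w₂] i).toFun) = ![w₁.toFun, w₂.toFun] := by
          funext i
          fin_cases i <;> rfl
        rwa [h3]
      · fin_cases i <;> exact Submodule.subset_span (by simp)
      · obtain ⟨s, t, rfl⟩ := Submodule.mem_span_pair.1 hv
        exact schrodinger_combination_le hw₁ hw₂ (hl.trans hx) hx s t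

end Sobolev

end MetricGraph

/-! ### Continuity of the eigenvalues under weak convergence of the potentials -/

namespace MetricGraph

variable {E : Type*} {G : MetricGraph E}

/-- Weak convergence of potentials, tested against square integrable functions on the edges. -/
def WeakTendsto (q : ℕ → G.Point → ℝ) (q₀ : G.Point → ℝ) : Prop :=
  ∀ e (f : ℝ → ℝ), MemLp f 2 (G.edgeMeasure e) →
    Tendsto (fun n => ∫ t, q n (G.pt e t) * f t ∂(G.edgeMeasure e)) atTop
      (𝓝 (∫ t, q₀ (G.pt e t) * f t ∂(G.edgeMeasure e)))

theorem WeakTendsto.comp {q : ℕ → G.Point → ℝ} {q₀ : G.Point → ℝ} (h : WeakTendsto q q₀)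
    {φ : ℕ → ℕ} (hφ : Tendsto φ atTop atTop) : WeakTendsto (fun n => q (φ n)) q₀ :=
  fun e f hf => (h e f hf).comp hφ

namespace Sobolev

variable [Fintype E]

/-- Replace vₙ² by its limit u²: the error is at most M times an L¹ norm tending to 0, for every
potential in the class. What remains is weak convergence tested against the fixed bounded function
u². -/
theorem tendsto_weight_sub {M K : ℝ} {q : ℕ → G.Point → ℝ} {q₀ : G.Point → ℝ}
    (hq : ∀ n, q n ∈ G.boundedClass M) (hq₀ : q₀ ∈ G.boundedClass M) (h : WeakTendsto q q₀)
    (v : ℕ → G.Sobolev) (u : G.Point → ℝ) (hK : ∀ n y, |(v n).toFun y| ≤ K)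
    (hu : ∀ y, Tendsto (fun n => (v n).toFun y) atTop (𝓝 (u y))) :
    Tendsto (fun n => weight (q n) (isBoundedPotential_of_mem (hq n)) (v n) (v n) -
      weight q₀ (isBoundedPotential_of_mem hq₀) (v n) (v n)) atTop (𝓝 0) := by
  have huK : ∀ y, |u y| ≤ K := fun y =>
    le_of_tendsto (hu y).abs (.of_forall fun n => hK n y)
  have hsum : ∀ e, Tendsto (fun n =>
      ∫ t, q n (G.pt e t) * ((v n).toFun (G.pt e t) * (v n).toFun (G.pt e t)) ∂(G.edgeMeasure e) -
      ∫ t, q₀ (G.pt e t) * ((v n).toFun (G.pt e t) * (v n).toFun (G.pt e t)) ∂(G.edgeMeasure e))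
      atTop (𝓝 0) := by
    intro e
    have hum : AEStronglyMeasurable (fun t => u (G.pt e t)) (G.edgeMeasure e) :=
      aestronglyMeasurable_of_tendsto_ae atTop
        (fun n => ((v n).continuous_comp_pt e).aestronglyMeasurable)
        (.of_forall fun t => hu (G.pt e t))
    have hb : ∀ t, |u (G.pt e t) * u (G.pt e t)| ≤ K * K := fun t => by
      rw [abs_mul]
      exact mul_le_mul (huK _) (huK _) (abs_nonneg _) ((abs_nonneg _).trans (huK (G.pt e t)))
    have hu2 : MemLp (fun t => u (G.pt e t) * u (G.pt e t)) 2 (G.edgeMeasure e) :=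
      MemLp.of_bound (hum.mul hum) (K * K) (.of_forall hb)
    have hu2i : Integrable (fun t => u (G.pt e t) * u (G.pt e t)) (G.edgeMeasure e) :=
      hu2.integrable (by norm_num)
    have hd : Tendsto (fun n => ∫ t, |(v n).toFun (G.pt e t) * (v n).toFun (G.pt e t) -
        u (G.pt e t) * u (G.pt e t)| ∂(G.edgeMeasure e)) atTop (𝓝 0) := by
      rw [← integral_zero ℝ ℝ (μ := G.edgeMeasure e)]
      refine tendsto_integral_of_dominated_convergence (fun _ => K * K + K * K)
        (fun n => (((v n).integrable_mul (v n) e).sub hu2i).abs.aestronglyMeasurable)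
        (integrable_const _) (fun n => .of_forall fun t => ?_) (.of_forall fun t => ?_)
      · rw [norm_abs_eq_norm]
        refine (norm_sub_le _ _).trans (add_le_add ?_ (hb t))
        rw [norm_mul]
        exact mul_le_mul (hK _ _) (hK _ _) (abs_nonneg _)
          ((abs_nonneg _).trans (hK n (G.pt e t)))
      · have h1 := ((hu (G.pt e t)).mul (hu (G.pt e t))).sub_const
          (u (G.pt e t) * u (G.pt e t))
        simpa using h1.abs
    have hw : Tendsto (fun n =>
        ∫ t, q n (G.pt e t) * (u (G.pt e t) * u (G.pt e t)) ∂(G.edgeMeasure e) -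
        ∫ t, q₀ (G.pt e t) * (u (G.pt e t) * u (G.pt e t)) ∂(G.edgeMeasure e)) atTop (𝓝 0) := by
      simpa using (h e _ hu2).sub_const
        (∫ t, q₀ (G.pt e t) * (u (G.pt e t) * u (G.pt e t)) ∂(G.edgeMeasure e))
    have hbound : ∀ (p : G.Point → ℝ), p ∈ G.boundedClass M → ∀ n,
        |∫ t, p (G.pt e t) * ((v n).toFun (G.pt e t) * (v n).toFun (G.pt e t)) ∂(G.edgeMeasure e) -
          ∫ t, p (G.pt e t) * (u (G.pt e t) * u (G.pt e t)) ∂(G.edgeMeasure e)| ≤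
        M * ∫ t, |(v n).toFun (G.pt e t) * (v n).toFun (G.pt e t) -
          u (G.pt e t) * u (G.pt e t)| ∂(G.edgeMeasure e) := by
      intro p hp n
      have hp' := isBoundedPotential_of_mem hp
      rw [← integral_sub (integrable_weight hp' (v n) (v n) e) (hp'.integrable_mul hu2i),
        ← integral_const_mul]
      refine (abs_integral_le_integral_abs).trans (integral_mono ?_ ?_ fun t => ?_)
      · exact ((integrable_weight hp' (v n) (v n) e).sub (hp'.integrable_mul hu2i)).abs
      · exact (((v n).integrable_mul (v n) e).sub hu2i).abs.const_mul M
      · rw [← mul_sub, abs_mul, abs_of_nonneg (hp.2 _).1]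
        exact mul_le_mul_of_nonneg_right (hp.2 _).2 (abs_nonneg _)
    have hb' := (hd.const_mul M).add (hd.const_mul M)
    rw [mul_zero, add_zero] at hb'
    have hdiff : Tendsto (fun n =>
        (∫ t, q n (G.pt e t) * ((v n).toFun (G.pt e t) * (v n).toFun (G.pt e t))
            ∂(G.edgeMeasure e) -
          ∫ t, q n (G.pt e t) * (u (G.pt e t) * u (G.pt e t)) ∂(G.edgeMeasure e)) -
        (∫ t, q₀ (G.pt e t) * ((v n).toFun (G.pt e t) * (v n).toFun (G.pt e t))
            ∂(G.edgeMeasure e) -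
          ∫ t, q₀ (G.pt e t) * (u (G.pt e t) * u (G.pt e t)) ∂(G.edgeMeasure e)))
        atTop (𝓝 0) :=
      squeeze_zero_norm (fun n => (norm_sub_le _ _).trans
        (add_le_add (hbound _ (hq n) n) (hbound _ hq₀ n))) hb'
    have := hdiff.add hw
    rw [add_zero] at this
    exact this.congr fun n => by ring
  have := tendsto_finsetSum Finset.univ fun e (_ : e ∈ Finset.univ) => hsum e
  rw [Finset.sum_const_zero] at this
  exact this.congr fun n => by rw [weight_apply, weight_apply, Finset.sum_sub_distrib]

/-- Uniformity in v comes from compactness: a sequence of counterexamples, bounded in H¹, would have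
a pointwise convergent subsequence, contradicting `tendsto_weight_sub`. -/
theorem eventually_abs_weight_sub_le {M : ℝ} {q : ℕ → G.Point → ℝ} {q₀ : G.Point → ℝ}
    (hq : ∀ n, q n ∈ G.boundedClass M) (hq₀ : q₀ ∈ G.boundedClass M) (h : WeakTendsto q q₀)
    (C : ℝ) {ε : ℝ} (hε : 0 < ε) :
    ∀ᶠ n in atTop, ∀ v : G.Sobolev, dirichlet v v + mass v v ≤ C →
      |weight (q n) (isBoundedPotential_of_mem (hq n)) v v -
        weight q₀ (isBoundedPotential_of_mem hq₀) v v| ≤ ε := by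
  by_contra hcon
  rw [not_eventually] at hcon
  obtain ⟨ψ, hψ, hbad⟩ := extraction_of_frequently_atTop hcon
  push Not at hbad
  choose v hv hbad using hbad
  obtain ⟨φ, u, K, hφ, hK, hu⟩ := exists_subseq_tendsto v hv
  have h1 := tendsto_weight_sub (fun n => hq (ψ (φ n))) hq₀
    (h.comp (hψ.tendsto_atTop.comp hφ.tendsto_atTop)) (fun n => v (φ n)) u
    (fun n => hK (φ n)) hu
  obtain ⟨n, hn⟩ := ((Metric.tendsto_nhds.1 h1) ε hε).exists
  rw [Real.dist_eq, sub_zero] at hn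
  exact lt_asymm hn (hbad (φ n))

theorem eventually_abs_weight_sub_le_mass {M : ℝ} {q : ℕ → G.Point → ℝ} {q₀ : G.Point → ℝ}
    (hq : ∀ n, q n ∈ G.boundedClass M) (hq₀ : q₀ ∈ G.boundedClass M) (h : WeakTendsto q q₀)
    (C : ℝ) {ε : ℝ} (hε : 0 < ε) :
    ∀ᶠ n in atTop, ∀ v : G.Sobolev, dirichlet v v ≤ C * mass v v →
      |weight (q n) (isBoundedPotential_of_mem (hq n)) v v -
        weight q₀ (isBoundedPotential_of_mem hq₀) v v| ≤ ε * mass v v := by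
  filter_upwards [eventually_abs_weight_sub_le hq hq₀ h (C + 1) hε] with n hn v hv
  rcases (mass_nonneg v).eq_or_lt with h0 | hpos
  · have := toFun_eq_zero_of_mass h0.symm
    simp [weight_apply, this, ← h0]
  · have hc : (√(mass v v))⁻¹ * (√(mass v v))⁻¹ = (mass v v)⁻¹ := by
      rw [← mul_inv, Real.mul_self_sqrt hpos.le]
    have hs : ∀ B : LinearMap.BilinForm ℝ G.Sobolev,
        B ((√(mass v v))⁻¹ • v) ((√(mass v v))⁻¹ • v) = (mass v v)⁻¹ * B v v := fun B => by
      rw [← hc]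
      simp only [map_smul, LinearMap.smul_apply, smul_eq_mul]
      ring
    have h1 := hn ((√(mass v v))⁻¹ • v) (by
      rw [hs, hs, inv_mul_cancel₀ hpos.ne', inv_mul_eq_div]
      linarith [(div_le_iff₀ hpos).2 hv])
    rw [hs, hs, ← mul_sub, abs_mul, abs_of_pos (inv_pos.2 hpos), inv_mul_eq_div,
      div_le_iff₀ hpos] at h1
    exact h1

theorem dirichlet_le_of_schrodinger_le {M : ℝ} {q : G.Point → ℝ} (hq : q ∈ G.boundedClass M)
    {x : ℝ} {v : G.Sobolev}
    (h : schrodinger q (isBoundedPotential_of_mem hq) v v ≤ x * mass v v) :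
    dirichlet v v ≤ x * mass v v := by
  have := weight_nonneg (isBoundedPotential_of_mem hq) (fun x => (hq.2 x).1) v
  rw [schrodinger_apply] at h
  linarith

/-- An optimal space for the zero potential is a trial space for every q in the class, at an extra
cost of at most M. The bound confines optimal trial functions to a fixed cone where the Dirichlet
form is at most C times the mass. -/
theorem exists_eigenvalue_le [Nonempty E] {M : ℝ} (hM : 0 ≤ M) {n : ℕ} (hn : n = 1 ∨ n = 2) :
    ∃ C, ∀ q ∈ G.boundedClass M, G.eigenvalue q n ≤ C := by
  have h0 := zero_mem_boundedClass (G := G) hM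
  obtain ⟨W, hu, hW⟩ := ((rayleigh_characterization h0 hn).2 _).2 le_rfl
  refine ⟨G.eigenvalue (fun _ => 0) n + M, fun q hq =>
    ((rayleigh_characterization hq hn).2 _).1 ⟨W, hu, fun v hv => ?_⟩⟩
  have h1 := dirichlet_le_of_schrodinger_le h0 (hW v hv)
  have h2 := weight_le (isBoundedPotential_of_mem hq) (fun x => (hq.2 x).2) v
  rw [schrodinger_apply]
  linarith

theorem tendsto_eigenvalue [Nonempty E] {M : ℝ} (hM : 0 ≤ M) {n : ℕ} (hn : n = 1 ∨ n = 2)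
    {q : ℕ → G.Point → ℝ} {q₀ : G.Point → ℝ} (hq : ∀ k, q k ∈ G.boundedClass M)
    (hq₀ : q₀ ∈ G.boundedClass M) (h : WeakTendsto q q₀) :
    Tendsto (fun k => G.eigenvalue (q k) n) atTop (𝓝 (G.eigenvalue q₀ n)) := by
  obtain ⟨C, hC⟩ := exists_eigenvalue_le (G := G) hM hn
  rw [Metric.tendsto_nhds]
  intro ε hε
  -- One index k now serves both directions: an optimal space of either potential is a trial space
  -- for the other, with error ε/2.
  filter_upwards [eventually_abs_weight_sub_le_mass hq hq₀ h C (half_pos hε)] with k hk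
  have hdir : ∀ p (hp : p ∈ G.boundedClass M) (v : G.Sobolev),
      schrodinger p (isBoundedPotential_of_mem hp) v v ≤ G.eigenvalue p n * mass v v →
      dirichlet v v ≤ C * mass v v := fun p hp v hv =>
    (dirichlet_le_of_schrodinger_le hp hv).trans
      (mul_le_mul_of_nonneg_right (hC p hp) (mass_nonneg v))
  have h1 : G.eigenvalue (q k) n ≤ G.eigenvalue q₀ n + ε / 2 := by
    obtain ⟨W, hu, hW⟩ := ((rayleigh_characterization hq₀ hn).2 _).2 le_rfl
    refine ((rayleigh_characterization (hq k) hn).2 _).1 ⟨W, hu, fun v hv => ?_⟩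
    have h2 := hW v hv
    have h3 := (abs_le.1 (hk v (hdir _ hq₀ v h2))).2
    rw [schrodinger_apply] at h2 ⊢
    linarith
  have h2 : G.eigenvalue q₀ n ≤ G.eigenvalue (q k) n + ε / 2 := by
    obtain ⟨W, hu, hW⟩ := ((rayleigh_characterization (hq k) hn).2 _).2 le_rfl
    refine ((rayleigh_characterization hq₀ hn).2 _).1 ⟨W, hu, fun v hv => ?_⟩
    have h2 := hW v hv
    have h3 := (abs_le.1 (hk v (hdir _ (hq k) v h2))).1
    rw [schrodinger_apply] at h2 ⊢
    linarith
  rw [Real.dist_eq, abs_lt]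
  constructor <;> linarith

end Sobolev

theorem WeakTendsto.tendsto_gap [Fintype E] [Nonempty E] {M : ℝ} (hM : 0 ≤ M)
    {q : ℕ → G.Point → ℝ} {q₀ : G.Point → ℝ} (hq : ∀ k, q k ∈ G.boundedClass M)
    (hq₀ : q₀ ∈ G.boundedClass M) (h : WeakTendsto q q₀) :
    Tendsto (fun k => G.gap (q k)) atTop (𝓝 (G.gap q₀)) :=
  (Sobolev.tendsto_eigenvalue hM (Or.inr rfl) hq hq₀ h).sub
    (Sobolev.tendsto_eigenvalue hM (Or.inl rfl) hq hq₀ h)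

end MetricGraph

/-! ### Selection of convergent subsequences -/

/-- Helly's selection principle: monotone functions that converge at the rational points converge
off a countable set. -/
theorem countable_not_tendsto_of_monotoneOn {f : ℕ → ℝ → ℝ} {a b M : ℝ}
    (hM : ∀ n t, |f n t| ≤ M) (hlim : ∀ r : ℚ, ∃ y, Tendsto (fun n => f n r) atTop (𝓝 y))
    (hmono : ∀ᶠ n in atTop, MonotoneOn (f n) (Ioo a b)) :
    {t ∈ Ioo a b | ¬ ∃ y, Tendsto (fun n => f n t) atTop (𝓝 y)}.Countable := by
  choose y hy using hlim
  have hyM : ∀ r, |y r| ≤ M := fun r => le_of_tendsto (hy r).abs (.of_forall fun n => hM n r)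
  have hymono : ∀ r s : ℚ, (r : ℝ) ∈ Ioo a b → (s : ℝ) ∈ Ioo a b → (r : ℝ) ≤ s → y r ≤ y s :=
    fun r s hr hs hrs => le_of_tendsto_of_tendsto (hy r) (hy s)
      (hmono.mono fun n hn => hn hr hs hrs)
  -- F is the left-sided monotone extension of the limits at rational points. At a continuity point
  -- of F the limits at nearby rationals on the two sides almost agree and squeeze f n t; the
  -- discontinuities of a monotone function are countable.
  let S : ℝ → Set ℝ := fun t => y '' {r : ℚ | (r : ℝ) ∈ Ioo a b ∧ (r : ℝ) < t}
  let F : ℝ → ℝ := fun t => sSup (S t)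
  have hbdd : ∀ t, BddAbove (S t) := by
    refine fun t => ⟨M, ?_⟩
    rintro _ ⟨r, -, rfl⟩
    exact (abs_le.1 (hyM r)).2
  have hne : ∀ t ∈ Ioo a b, (S t).Nonempty := by
    intro t ht
    obtain ⟨r, hr1, hr2⟩ := exists_rat_btwn ht.1
    exact ⟨_, r, ⟨⟨hr1, hr2.trans ht.2⟩, hr2⟩, rfl⟩
  have hF : MonotoneOn F (Ioo a b) := by
    intro s hs t ht hst
    exact csSup_le_csSup (hbdd t) (hne s hs)
      (image_mono fun r hr => ⟨hr.1, hr.2.trans_le hst⟩)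
  refine hF.countable_not_continuousWithinAt.mono ?_
  rintro t ⟨ht, hbad⟩
  refine ⟨ht, fun hcont => hbad ?_⟩
  have hcont' : ContinuousAt F t := hcont.continuousAt (Ioo_mem_nhds ht.1 ht.2)
  apply exists_tendsto_of_approx
  intro ε hε
  obtain ⟨δ, hδ, hball⟩ := Metric.continuousAt_iff.1 hcont' (ε / 4) (by positivity)
  obtain ⟨t₂, ht₂, ht₂'⟩ := exists_between (show t < min b (t + δ) from lt_min ht.2 (by linarith))
  obtain ⟨t₁, ht₁, ht₁'⟩ := exists_between (show max a (t - δ) < t from max_lt ht.1 (by linarith))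
  obtain ⟨r₂, hr₂, hr₂'⟩ := exists_rat_btwn ht₂
  obtain ⟨r₁, hr₁, hr₁'⟩ := exists_rat_btwn ht₁'
  have hb2 : t₂ < b := ht₂'.trans_le (min_le_left _ _)
  have ha1 : a < t₁ := (le_max_left _ _).trans_lt ht₁
  have hr₂m : (r₂ : ℝ) ∈ Ioo a b := ⟨ht.1.trans hr₂, hr₂'.trans hb2⟩
  have hr₁m : (r₁ : ℝ) ∈ Ioo a b := ⟨ha1.trans hr₁, hr₁'.trans ht.2⟩
  have h1 : y r₂ ≤ F t₂ := le_csSup (hbdd t₂) ⟨r₂, ⟨hr₂m, hr₂'⟩, rfl⟩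
  have h2 : F t₁ ≤ y r₁ := by
    refine csSup_le (hne t₁ ⟨ha1, ht₁'.trans ht.2⟩) ?_
    rintro _ ⟨r, hr, rfl⟩
    exact hymono r r₁ hr.1 hr₁m (hr.2.trans hr₁).le
  have h3 := hball (x := t₂) (by
    rw [Real.dist_eq, abs_of_pos (by linarith)]
    linarith [ht₂'.trans_le (min_le_right b (t + δ))])
  have h4 := hball (x := t₁) (by
    rw [Real.dist_eq, abs_of_neg (by linarith)]
    linarith [(le_max_right a (t - δ)).trans_lt ht₁])
  rw [Real.dist_eq, abs_lt] at h3 h4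
  refine ⟨r₁, ?_, y r₁, hy r₁⟩
  have h5 : Tendsto (fun n => f n r₂ - f n r₁) atTop (𝓝 (y r₂ - y r₁)) := (hy r₂).sub (hy r₁)
  filter_upwards [hmono, h5.eventually (gt_mem_nhds (show y r₂ - y r₁ < ε by linarith))]
    with n hn hn'
  have h6 := hn hr₁m ht hr₁'.le
  have h7 := hn ht hr₂m hr₂.le
  rw [abs_of_nonneg (by linarith)]
  linarith

theorem countable_not_tendsto_of_antitoneOn {f : ℕ → ℝ → ℝ} {a b M : ℝ}
    (hM : ∀ n t, |f n t| ≤ M) (hlim : ∀ r : ℚ, ∃ y, Tendsto (fun n => f n r) atTop (𝓝 y))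
    (hanti : ∀ᶠ n in atTop, AntitoneOn (f n) (Ioo a b)) :
    {t ∈ Ioo a b | ¬ ∃ y, Tendsto (fun n => f n t) atTop (𝓝 y)}.Countable := by
  have h := countable_not_tendsto_of_monotoneOn (f := fun n t => -f n t) (a := a) (b := b) (M := M)
    (by simpa using hM) (fun r => (hlim r).imp' (fun y => -y) fun y hy => hy.neg)
    (hanti.mono fun n hn => hn.neg)
  refine h.mono ?_
  rintro t ⟨ht, hbad⟩
  exact ⟨ht, fun ⟨y, hy⟩ => hbad ⟨-y, by simpa using hy.neg⟩⟩

/-- Uniformly bounded convex functions are uniformly Lipschitz on a smaller ball, so convergence at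
rational points spreads to every interior point, with no exceptional set. -/
theorem exists_tendsto_of_convexOn {f : ℕ → ℝ → ℝ} {a b M : ℝ}
    (hM : ∀ n t, |f n t| ≤ M) (hlim : ∀ r : ℚ, ∃ y, Tendsto (fun n => f n r) atTop (𝓝 y))
    (hconv : ∀ᶠ n in atTop, ConvexOn ℝ (Ioo a b) (f n)) {t : ℝ} (ht : t ∈ Ioo a b) :
    ∃ y, Tendsto (fun n => f n t) atTop (𝓝 y) := by
  obtain ⟨ρ, hρ, hball⟩ := Metric.isOpen_iff.1 isOpen_Ioo t ht
  apply exists_tendsto_of_approx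
  intro ε hε
  set L := (2 * M / (ρ / 2)).toNNReal
  have hcont : Tendsto (fun s : ℝ => L * |t - s|) (𝓝 t) (𝓝 0) := by
    have : Continuous fun s : ℝ => L * |t - s| := by fun_prop
    simpa using this.tendsto t
  have hmem : {s : ℝ | L * |t - s| < ε} ∩ Metric.ball t (ρ / 2) ∈ 𝓝 t :=
    inter_mem (hcont.eventually (gt_mem_nhds hε)) (Metric.ball_mem_nhds t (half_pos hρ))
  obtain ⟨r, hr⟩ := Rat.denseRange_cast.exists_mem_open isOpen_interior
    ⟨t, mem_interior_iff_mem_nhds.2 hmem⟩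
  obtain ⟨hr1, hr2⟩ := interior_subset hr
  refine ⟨r, ?_, hlim r⟩
  filter_upwards [hconv] with n hn
  have h1 := (hn.subset hball (convex_ball t ρ)).lipschitzOnWith_of_abs_le (half_pos hρ)
    (M := M) fun s _ => hM n s
  have h2 := h1.dist_le_mul t (by simpa using by linarith) r
    (by rw [show ρ - ρ / 2 = ρ / 2 by ring]; exact hr2)
  rw [Real.dist_eq, Real.dist_eq] at h2
  exact h2.trans (le_of_lt hr1)

/-! ### Weak compactness, and limits that are also pointwise limits on a set. -/

namespace MetricGraph

variable {E : Type*} {G : MetricGraph E}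

theorem pt_eq_pt_iff_of_mem_Ioo {e e' : E} {t t' : ℝ} (ht : t ∈ Ioo 0 (G.len e))
    (ht' : t' ∈ Icc 0 (G.len e')) : G.pt e t = G.pt e' t' ↔ e = e' ∧ t = t' := by
  refine ⟨fun h => ?_, by rintro ⟨rfl, rfl⟩; rfl⟩
  rw [pt, pt, projIcc_of_mem _ (Ioo_subset_Icc_self ht), projIcc_of_mem _ ht'] at h
  rcases Quotient.exact h with h | ⟨a, b, -, h, -⟩
  · have he : e = e' := congrArg Sigma.fst h
    subst he
    exact ⟨rfl, congrArg Subtype.val (eq_of_heq (Sigma.mk.inj h).2)⟩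
  · exfalso
    obtain ⟨c, d⟩ := a
    have he : e = c := congrArg Sigma.fst h
    subst he
    have h2 := congrArg Subtype.val (eq_of_heq (Sigma.mk.inj h).2)
    cases d <;> simp at h2
    · exact ht.1.ne' h2
    · exact ht.2.ne h2

theorem injOn_pt (e : E) : InjOn (G.pt e) (Ioo 0 (G.len e)) := fun _ hs _ ht h =>
  ((pt_eq_pt_iff_of_mem_Ioo hs (Ioo_subset_Icc_self ht)).1 h).2

theorem ae_edgeMeasure_mem_Ioo (e : E) : ∀ᵐ t ∂(G.edgeMeasure e), t ∈ Ioo 0 (G.len e) := by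
  have h1 : G.edgeMeasure e = volume.restrict (Ioo 0 (G.len e)) :=
    (Measure.restrict_congr_set Ioo_ae_eq_Icc).symm
  rw [h1]; exact ae_restrict_mem measurableSet_Ioo

theorem memLp_of_mem_boundedClass {M : ℝ} {q : G.Point → ℝ} (hq : q ∈ G.boundedClass M) (e : E) :
    MemLp (fun t => q (G.pt e t)) 2 (G.edgeMeasure e) :=
  MemLp.of_bound (hq.1 e) M (.of_forall fun t => by
    rw [Real.norm_eq_abs, abs_of_nonneg (hq.2 _).1]; exact (hq.2 _).2)

/-- Weak sequential compactness of bounded sets of potentials. -/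
theorem exists_subseq_weak_limit [Fintype E] {M : ℝ} (hM : 0 ≤ M) {q : ℕ → G.Point → ℝ}
    (hq : ∀ n, q n ∈ G.boundedClass M) :
    ∃ (φ : ℕ → ℕ) (w : ∀ e, Lp ℝ 2 (G.edgeMeasure e)), StrictMono φ ∧
      ∀ e (f : ℝ → ℝ), MemLp f 2 (G.edgeMeasure e) →
        Tendsto (fun n => ∫ t, q (φ n) (G.pt e t) * f t ∂(G.edgeMeasure e)) atTop
          (𝓝 (∫ t, w e t * f t ∂(G.edgeMeasure e))) := by
  classical
  let Q : ℕ → ∀ e, Lp ℝ 2 (G.edgeMeasure e) := fun n e => (memLp_of_mem_boundedClass (hq n) e).toLp _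
  -- Treating all edges together as one functional on the product yields a single subsequence for
  -- the whole graph from the sequential Banach–Alaoglu theorem.
  let F : ℕ → StrongDual ℝ (∀ e, Lp ℝ 2 (G.edgeMeasure e)) := fun n =>
    ∑ e, (innerSL ℝ (Q n e)).comp (ContinuousLinearMap.proj e)
  have hFsingle : ∀ n e f, F n (Pi.single e f) = inner ℝ (Q n e) f := by
    intro n e f
    simp only [F, sum_apply, ContinuousLinearMap.comp_apply,
      ContinuousLinearMap.proj_apply, innerSL_apply_apply]
    rw [Finset.sum_eq_single e]
    · simp
    · intro e' _ he'
      rw [Pi.single_eq_of_ne he', inner_zero_right]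
    · simp
  obtain ⟨B, hB⟩ : ∃ B, ∀ n, ‖F n‖ ≤ B := by
    refine ⟨∑ e, (measureUnivNNReal (G.edgeMeasure e) : ℝ) ^ (2 : ENNReal).toReal⁻¹ * M,
      fun n => (norm_sum_le _ _).trans (Finset.sum_le_sum fun e _ => ?_)⟩
    have h1 : ‖Q n e‖ ≤ (measureUnivNNReal (G.edgeMeasure e) : ℝ) ^ (2 : ENNReal).toReal⁻¹ * M := by
      refine Lp.norm_le_of_ae_bound hM ?_
      filter_upwards [(memLp_of_mem_boundedClass (hq n) e).coeFn_toLp] with t ht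
      rw [ht, Real.norm_eq_abs, abs_of_nonneg ((hq n).2 _).1]
      exact ((hq n).2 _).2
    refine ContinuousLinearMap.opNorm_le_bound _ ((norm_nonneg _).trans h1) fun f => ?_
    rw [ContinuousLinearMap.comp_apply, ContinuousLinearMap.proj_apply, innerSL_apply_apply]
    exact (norm_inner_le_norm _ _).trans
      (mul_le_mul h1 (norm_le_pi_norm f e) (norm_nonneg _) ((norm_nonneg _).trans h1))
  -- Needed by the separability instance of L², which sequential compactness of the dual ball
  -- requires.
  have : Fact ((2 : ENNReal) ≠ ⊤) := ⟨by simp⟩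
  obtain ⟨L, -, φ, hφ, hL⟩ := WeakDual.isSeqCompact_closedBall ℝ
    (∀ e, Lp ℝ 2 (G.edgeMeasure e)) 0 B (x := fun n => StrongDual.toWeakDual (F n))
    (fun n => by simpa using hB n)
  have hL' : ∀ f, Tendsto (fun n => F (φ n) f) atTop (𝓝 (L f)) := fun f =>
    ((WeakDual.eval_continuous f).tendsto L).comp hL
  let w : ∀ e, Lp ℝ 2 (G.edgeMeasure e) := fun e =>
    (InnerProductSpace.toDual ℝ _).symm ((WeakDual.toStrongDual L).comp
      (ContinuousLinearMap.single ℝ (fun e => Lp ℝ 2 (G.edgeMeasure e)) e))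
  refine ⟨φ, w, hφ, fun e f hf => ?_⟩
  have h1 := hL' (Pi.single e (hf.toLp f))
  simp only [hFsingle] at h1
  have h2 : L (Pi.single e (hf.toLp f)) = inner ℝ (w e) (hf.toLp f) := by
    rw [InnerProductSpace.toDual_symm_apply]
    rfl
  rw [h2, inner_edge_Lp] at h1
  have h3 : ∫ t, w e t * f t ∂(G.edgeMeasure e) =
      ∫ t, w e t * (hf.toLp f) t ∂(G.edgeMeasure e) := by
    refine integral_congr_ae ?_
    filter_upwards [hf.coeFn_toLp] with t ht
    rw [ht]
  rw [h3]
  refine h1.congr fun n => ?_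
  rw [inner_edge_Lp]
  refine integral_congr_ae ?_
  filter_upwards [hf.coeFn_toLp, (memLp_of_mem_boundedClass (hq (φ n)) e).coeFn_toLp] with t ht ht'
  rw [ht, ht']

end MetricGraph

namespace MetricGraph

variable {E : Type*} {G : MetricGraph E}

/-- The functions `f n` are eventually all monotone, all antitone or all convex on an open interval. -/
def EventuallyRegular (f : ℕ → ℝ → ℝ) (a b : ℝ) : Prop :=
  (∀ᶠ n in atTop, MonotoneOn (f n) (Ioo a b)) ∨ (∀ᶠ n in atTop, AntitoneOn (f n) (Ioo a b)) ∨
    ∀ᶠ n in atTop, ConvexOn ℝ (Ioo a b) (f n)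

theorem EventuallyRegular.countable_not_tendsto {f : ℕ → ℝ → ℝ} {a b M : ℝ}
    (h : EventuallyRegular f a b) (hM : ∀ n t, |f n t| ≤ M) {φ : ℕ → ℕ} (hφ : StrictMono φ)
    (hlim : ∀ r : ℚ, ∃ y, Tendsto (fun n => f (φ n) r) atTop (𝓝 y)) :
    {t ∈ Ioo a b | ¬ ∃ y, Tendsto (fun n => f (φ n) t) atTop (𝓝 y)}.Countable := by
  have hM' : ∀ n t, |f (φ n) t| ≤ M := fun n => hM (φ n)
  rcases h with h | h | h
  · exact countable_not_tendsto_of_monotoneOn hM' hlim (hφ.tendsto_atTop.eventually h)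
  · exact countable_not_tendsto_of_antitoneOn hM' hlim (hφ.tendsto_atTop.eventually h)
  · convert countable_empty
    rw [eq_empty_iff_forall_notMem]
    rintro t ⟨ht, hbad⟩
    exact hbad (exists_tendsto_of_convexOn hM' hlim (hφ.tendsto_atTop.eventually h) ht)

/-- A function on the graph with prescribed values in the interior of the edges. -/
theorem exists_extension_of_edges (f : E → ℝ → ℝ) {M : ℝ} (hM : 0 ≤ M)
    (hf : ∀ e t, f e t ∈ Icc 0 M) :
    ∃ F : G.Point → ℝ, (∀ x, F x ∈ Icc 0 M) ∧ ∀ e, ∀ t ∈ Ioo 0 (G.len e), F (G.pt e t) = f e t := by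
  classical
  let g : G.PrePoint → ℝ := fun x => if (x.2 : ℝ) ∈ Ioo 0 (G.len x.1) then f x.1 x.2 else 0
  have hend : ∀ a, g (G.endPoint a) = 0 := by
    rintro ⟨e, b⟩
    cases b <;> simp [g, endPoint]
  have hcompat : ∀ x y : G.PrePoint, G.glue x y → g x = g y := by
    rintro x y (rfl | ⟨a, b, h, rfl, rfl⟩)
    · rfl
    · rw [hend, hend]
  refine ⟨Quotient.lift g hcompat, fun x => ?_, fun e t ht => ?_⟩
  · induction x using Quotient.inductionOn with
    | h x =>
      simp only [Quotient.lift_mk, g]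
      split_ifs
      · exact hf _ _
      · exact ⟨le_rfl, hM⟩
  · rw [pt, projIcc_of_mem _ (Ioo_subset_Icc_self ht)]
    simp only [Quotient.lift_mk, g]
    rw [if_pos ht]

/-- Testing with indicators bounds the integral of the limit over every measurable set, which bounds
the limit almost everywhere. -/
theorem weak_limit_mem_Icc {M : ℝ} {q : ℕ → G.Point → ℝ} (hq : ∀ n, q n ∈ G.boundedClass M)
    {e : E} {w : Lp ℝ 2 (G.edgeMeasure e)}
    (h : ∀ f : ℝ → ℝ, MemLp f 2 (G.edgeMeasure e) →
      Tendsto (fun n => ∫ t, q n (G.pt e t) * f t ∂(G.edgeMeasure e)) atTop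
        (𝓝 (∫ t, w t * f t ∂(G.edgeMeasure e)))) :
    ∀ᵐ t ∂(G.edgeMeasure e), w t ∈ Icc 0 M := by
  have hset : ∀ s, MeasurableSet s →
      Tendsto (fun n => ∫ t in s, q n (G.pt e t) ∂(G.edgeMeasure e)) atTop
        (𝓝 (∫ t in s, w t ∂(G.edgeMeasure e))) := by
    intro s hs
    have h1 := h (s.indicator fun _ => 1) ((memLp_const 1).indicator hs)
    have h2 : ∀ g : ℝ → ℝ, ∫ t, g t * s.indicator (fun _ => (1 : ℝ)) t ∂(G.edgeMeasure e) =
        ∫ t in s, g t ∂(G.edgeMeasure e) := by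
      intro g
      rw [← integral_indicator hs]
      congr 1
      funext t
      by_cases ht : t ∈ s <;> simp [ht]
    simpa only [h2] using h1
  have hw := integrable_edge_Lp w
  have hqi : ∀ n, Integrable (fun t => q n (G.pt e t)) (G.edgeMeasure e) := fun n =>
    (memLp_of_mem_boundedClass (hq n) e).integrable (by norm_num)
  have h0 : 0 ≤ᵐ[G.edgeMeasure e] w := by
    refine ae_nonneg_of_forall_setIntegral_nonneg hw fun s hs _ => ?_
    exact ge_of_tendsto (hset s hs) (.of_forall fun n =>
      integral_nonneg fun t => ((hq n).2 _).1)
  have hM : 0 ≤ᵐ[G.edgeMeasure e] fun t => M - w t := by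
    refine ae_nonneg_of_forall_setIntegral_nonneg ((integrable_const M).sub hw) fun s hs _ => ?_
    rw [integral_sub (integrable_const M) hw.integrableOn, sub_nonneg]
    refine le_of_tendsto (hset s hs) (.of_forall fun n => ?_)
    exact integral_mono (hqi n).integrableOn (integrable_const M) fun t => ((hq n).2 _).2
  filter_upwards [h0, hM] with t h1 h2
  exact ⟨h1, sub_nonneg.1 h2⟩

/-- A sequence of potentials that is locally regular on `R`, up to a countable set, has a
subsequence converging weakly to a potential that is a pointwise cluster value of the sequence
on `R`. -/
theorem exists_limit_potential [Fintype E] {M : ℝ} (hM : 0 ≤ M) {q : ℕ → G.Point → ℝ}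
    (hq : ∀ n, q n ∈ G.boundedClass M) {R N : Set G.Point} (hN : N.Countable)
    (hreg : ∀ e, ∀ t ∈ Ioo 0 (G.len e), G.pt e t ∈ R → G.pt e t ∉ N → ∃ a b, t ∈ Ioo a b ∧
      Ioo a b ⊆ Ioo 0 (G.len e) ∧ (∀ s ∈ Ioo a b, G.pt e s ∈ R) ∧
      EventuallyRegular (fun n s => q n (G.pt e s)) a b) :
    ∃ (φ : ℕ → ℕ) (U : Filter ℕ) (q₀ : G.Point → ℝ), StrictMono φ ∧ U.NeBot ∧ U ≤ atTop ∧
      q₀ ∈ G.boundedClass M ∧ WeakTendsto (fun n => q (φ n)) q₀ ∧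
      ∀ x ∈ R, Tendsto (fun n => q (φ n) x) U (𝓝 (q₀ x)) := by
  classical
  have hqM : ∀ n x, |q n x| ≤ M := fun n x => by
    rw [abs_of_nonneg ((hq n).2 x).1]; exact ((hq n).2 x).2
  have hD : (⋃ e, range fun r : ℚ => G.pt e r).Countable :=
    countable_iUnion fun e => countable_range _
  obtain ⟨φ₁, hφ₁, hlim⟩ := exists_subseq_tendsto_of_countable hD q (fun n x _ => hqM n x)
  obtain ⟨φ₂, w, hφ₂, hw⟩ := exists_subseq_weak_limit hM fun n => hq (φ₁ n)
  let φ : ℕ → ℕ := fun n => φ₁ (φ₂ n)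
  have hφ : StrictMono φ := hφ₁.comp hφ₂
  have hlim' : ∀ e (r : ℚ), ∃ y, Tendsto (fun n => q (φ n) (G.pt e r)) atTop (𝓝 y) := by
    intro e r
    obtain ⟨y, hy⟩ := hlim (G.pt e r) (mem_iUnion.2 ⟨e, r, rfl⟩)
    exact ⟨y, hy.comp hφ₂.tendsto_atTop⟩
  -- The ultrafilter supplies a limit at every point, including vertices and exceptional points, and
  -- preserves non-strict inequalities. Wherever the sequence genuinely converges, it gives the true
  -- limit.
  let U : Ultrafilter ℕ := Ultrafilter.of atTop
  have hU : (U : Filter ℕ) ≤ atTop := Ultrafilter.of_le atTop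
  have hg : ∀ x, ∃ y ∈ Icc 0 M, Tendsto (fun n => q (φ n) x) U (𝓝 y) := fun x =>
    isCompact_Icc.ultrafilter_le_nhds (U.map fun n => q (φ n) x)
      (le_principal_iff.2 (Filter.mem_map.2 (univ_mem' fun n => (hq (φ n)).2 x)))
  choose g hgM hg using hg
  have hwM := fun e => weak_limit_mem_Icc (fun n => hq (φ n)) (hw e)
  obtain ⟨F, hFM, hF⟩ := exists_extension_of_edges (G := G) (fun e t => max 0 (min M (w e t))) hM
    fun e t => ⟨le_max_left _ _, max_le hM (min_le_left _ _)⟩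
  -- Off R nothing is known pointwise, so the weak limit is used there, clamped to [0, M] to hold
  -- the bounds everywhere.
  let q₀ : G.Point → ℝ := fun x => if x ∈ R then g x else F x
  have hq₀M : ∀ x, q₀ x ∈ Icc 0 M := by
    intro x
    by_cases hx : x ∈ R
    · simpa only [q₀, if_pos hx] using hgM x
    · simpa only [q₀, if_neg hx] using hFM x
  let Re : E → Set ℝ := fun e => {t ∈ Ioo 0 (G.len e) | G.pt e t ∈ R}
  have hNe : ∀ e, {t ∈ Ioo 0 (G.len e) | G.pt e t ∈ N}.Countable := fun e =>
    MapsTo.countable_of_injOn (f := G.pt e) (t := N) (fun t ht => ht.2)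
      ((injOn_pt e).mono fun t ht => ht.1) hN
  have hRe : ∀ e, MeasurableSet (Re e) := by
    intro e
    -- R itself is arbitrary; measurability of its trace on an edge follows because local regularity
    -- makes it open up to a countable set.
    have h1 : (Re e \ interior (Re e)).Countable := by
      refine (hNe e).mono ?_
      rintro t ⟨⟨ht, htR⟩, hint⟩
      refine ⟨ht, by_contra fun htN => hint ?_⟩
      obtain ⟨a, b, htab, hsub, hR, -⟩ := hreg e t ht htR htN
      exact mem_interior.2 ⟨Ioo a b, fun s hs => ⟨hsub hs, hR s hs⟩, isOpen_Ioo, htab⟩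
    rw [← union_sdiff_cancel (interior_subset (s := Re e))]
    exact isOpen_interior.measurableSet.union h1.measurableSet
  have hbad : ∀ e, {t ∈ Re e | ¬ ∃ y, Tendsto (fun n => q (φ n) (G.pt e t)) atTop
      (𝓝 y)}.Countable := by
    intro e
    have hcov : ∀ t ∈ {t ∈ Re e | G.pt e t ∉ N}, ∃ V ∈ 𝓝 t,
        {s ∈ V | ¬ ∃ y, Tendsto (fun n => q (φ n) (G.pt e s)) atTop (𝓝 y)}.Countable := by
      rintro t ⟨⟨ht, htR⟩, htN⟩
      obtain ⟨a, b, htab, -, -, hr⟩ := hreg e t ht htR htN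
      exact ⟨Ioo a b, Ioo_mem_nhds htab.1 htab.2,
        hr.countable_not_tendsto (fun n s => hqM n _) hφ (hlim' e)⟩
    choose! V hV hVc using hcov
    -- By Lindelöf countably many of the local intervals suffice, so the exceptional set stays
    -- countable even when R comes from infinitely many paths.
    obtain ⟨S, hSs, hSc, hSU⟩ := TopologicalSpace.countable_cover_nhdsWithin (f := V)
      (s := {t ∈ Re e | G.pt e t ∉ N}) fun t ht => mem_nhdsWithin_of_mem_nhds (hV t ht)
    refine ((hNe e).union (hSc.biUnion fun t ht => hVc t (hSs ht))).mono ?_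
    rintro t ⟨ht, hbad⟩
    by_cases htN : G.pt e t ∈ N
    · exact Or.inl ⟨ht.1, htN⟩
    · obtain ⟨s, hs, hts⟩ := mem_iUnion₂.1 (hSU ⟨ht, htN⟩)
      exact Or.inr (mem_iUnion₂.2 ⟨s, hs, hts, hbad⟩)
  have hpt : ∀ e, ∀ᵐ t ∂(G.edgeMeasure e).restrict (Re e),
      Tendsto (fun n => q (φ n) (G.pt e t)) atTop (𝓝 (q₀ (G.pt e t))) := by
    intro e
    have h1 : ∀ᵐ t ∂(G.edgeMeasure e), t ∉
        {t ∈ Re e | ¬ ∃ y, Tendsto (fun n => q (φ n) (G.pt e t)) atTop (𝓝 y)} :=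
      ae_restrict_of_ae ((hbad e).ae_notMem volume)
    filter_upwards [ae_restrict_of_ae h1, ae_restrict_mem (hRe e)] with t ht htR
    obtain ⟨y, hy⟩ : ∃ y, Tendsto (fun n => q (φ n) (G.pt e t)) atTop (𝓝 y) := by
      by_contra hcon
      exact ht ⟨htR, hcon⟩
    have h2 : y = g (G.pt e t) := tendsto_nhds_unique (hy.mono_left hU) (hg _)
    have h3 : q₀ (G.pt e t) = g (G.pt e t) := if_pos htR.2
    rw [h3, ← h2]
    exact hy
  have hcompl : ∀ e, ∀ᵐ t ∂(G.edgeMeasure e).restrict (Re e)ᶜ, w e t = q₀ (G.pt e t) := by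
    intro e
    filter_upwards [ae_restrict_of_ae (hwM e), ae_restrict_mem (hRe e).compl,
      ae_restrict_of_ae (ae_edgeMeasure_mem_Ioo e)] with t h1 h2 h3
    have h4 : G.pt e t ∉ R := fun h => h2 ⟨h3, h⟩
    simp only [q₀, if_neg h4, hF e t h3]
    rw [min_eq_right h1.2, max_eq_right h1.1]
  have hmeas : ∀ e, AEStronglyMeasurable (fun t => q₀ (G.pt e t)) (G.edgeMeasure e) := by
    intro e
    have h1 : AEStronglyMeasurable (fun t => q₀ (G.pt e t)) ((G.edgeMeasure e).restrict (Re e)) :=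
      aestronglyMeasurable_of_tendsto_ae atTop
        (fun n => ((hq (φ n)).1 e).mono_measure Measure.restrict_le_self) (hpt e)
    have h2 : AEStronglyMeasurable (fun t => q₀ (G.pt e t))
        ((G.edgeMeasure e).restrict (Re e)ᶜ) :=
      ((Lp.aestronglyMeasurable (w e)).mono_measure Measure.restrict_le_self).congr (hcompl e)
    have h3 := aestronglyMeasurable_union_iff.2 ⟨h1, h2⟩
    rwa [union_compl_self, Measure.restrict_univ] at h3
  have hq₀ : q₀ ∈ G.boundedClass M := ⟨hmeas, hq₀M⟩
  refine ⟨φ, U, q₀, hφ, inferInstance, hU, hq₀, fun e f hf => ?_, fun x hx => ?_⟩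
  · have hfi : Integrable f (G.edgeMeasure e) := hf.integrable (by norm_num)
    have hi : ∀ p ∈ G.boundedClass M, Integrable (fun t => p (G.pt e t) * f t) (G.edgeMeasure e) :=
      fun p hp => (isBoundedPotential_of_mem hp).integrable_mul hfi
    have hA : Tendsto (fun n => ∫ t in Re e, q (φ n) (G.pt e t) * f t ∂(G.edgeMeasure e)) atTop
        (𝓝 (∫ t in Re e, q₀ (G.pt e t) * f t ∂(G.edgeMeasure e))) := by
      refine tendsto_integral_of_dominated_convergence (fun t => M * ‖f t‖)
        (fun n => (hi _ (hq (φ n))).aestronglyMeasurable.mono_measure Measure.restrict_le_self)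
        (hfi.norm.const_mul M).integrableOn (fun n => .of_forall fun t => ?_) ?_
      · rw [norm_mul]
        exact mul_le_mul_of_nonneg_right (hqM _ _) (norm_nonneg _)
      · filter_upwards [hpt e] with t ht using ht.mul_const _
    have hind : ∀ h : ℝ → ℝ, ∫ t, h t * (Re e)ᶜ.indicator f t ∂(G.edgeMeasure e) =
        ∫ t in (Re e)ᶜ, h t * f t ∂(G.edgeMeasure e) := by
      intro h
      rw [← integral_indicator (hRe e).compl]
      congr 1
      funext t
      by_cases ht : t ∈ (Re e)ᶜ
      · rw [indicator_of_mem ht, indicator_of_mem ht]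
      · rw [indicator_of_notMem ht, indicator_of_notMem ht, mul_zero]
    have hB : Tendsto (fun n => ∫ t in (Re e)ᶜ, q (φ n) (G.pt e t) * f t ∂(G.edgeMeasure e)) atTop
        (𝓝 (∫ t in (Re e)ᶜ, q₀ (G.pt e t) * f t ∂(G.edgeMeasure e))) := by
      have h1 := hw e _ (hf.indicator (hRe e).compl)
      simp only [hind] at h1
      have h2 : ∫ t in (Re e)ᶜ, w e t * f t ∂(G.edgeMeasure e) =
          ∫ t in (Re e)ᶜ, q₀ (G.pt e t) * f t ∂(G.edgeMeasure e) := by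
        refine integral_congr_ae ?_
        filter_upwards [hcompl e] with t ht
        rw [ht]
      rwa [h2] at h1
    have hsum := hA.add hB
    rw [integral_add_compl (hRe e) (hi _ hq₀)] at hsum
    exact hsum.congr fun n => integral_add_compl (hRe e) (hi _ (hq (φ n)))
  · have h3 : q₀ x = g x := if_pos hx
    rw [h3]
    exact hg x

end MetricGraph

/-! ### Paths in edge coordinates -/

namespace MetricGraph

variable {E : Type*} {G : MetricGraph E}

theorem isOpen_image_pt {e : E} {V : Set ℝ} (hV : IsOpen V) (hsub : V ⊆ Ioo 0 (G.len e)) :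
    IsOpen (G.pt e '' V) := by
  have hcoin : IsOpen ((Quotient.mk G.glue) ⁻¹' (G.pt e '' V)) := by
    rw [isOpen_sigma_iff]
    intro e'
    by_cases he : e' = e
    · subst he
      have : Sigma.mk e' ⁻¹' ((Quotient.mk G.glue) ⁻¹' (G.pt e' '' V)) =
          (Subtype.val : Icc 0 (G.len e') → ℝ) ⁻¹' V := by
        ext x
        simp only [mem_preimage]
        constructor
        · rintro ⟨t, ht, hx⟩
          have h1 : G.pt e' t = G.pt e' x := by rw [hx, pt, projIcc_val]
          rwa [← ((pt_eq_pt_iff_of_mem_Ioo (hsub ht) x.2).1 h1).2]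
        · intro hx
          exact ⟨x, hx, by rw [pt, projIcc_val]⟩
      rw [this]
      exact hV.preimage continuous_subtype_val
    · have : Sigma.mk e' ⁻¹' ((Quotient.mk G.glue) ⁻¹' (G.pt e '' V)) = ∅ := by
        rw [eq_empty_iff_forall_notMem]
        rintro x ⟨t, ht, hx⟩
        have h1 : G.pt e t = G.pt e' x := by rw [hx, pt, projIcc_val]
        exact he ((pt_eq_pt_iff_of_mem_Ioo (hsub ht) x.2).1 h1).1.symm
      rw [this]
      exact isOpen_empty
  exact hcoin

namespace GPath

/-- A path, extended to the real line. -/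
noncomputable def ext (γ : G.GPath) (s : ℝ) : G.Point := γ.map (projIcc 0 1 zero_le_one s)

theorem continuous_ext (γ : G.GPath) : Continuous γ.ext :=
  γ.map.continuous.comp continuous_projIcc

theorem ext_coe (γ : G.GPath) (s : unitInterval) : γ.ext s = γ.map s := by
  rw [ext, projIcc_val]

theorem ext_of_mem (γ : G.GPath) {s : ℝ} (hs : s ∈ Icc (0 : ℝ) 1) : γ.ext s = γ.map ⟨s, hs⟩ := by
  rw [ext, projIcc_of_mem _ hs]

theorem injOn_ext (γ : G.GPath) : InjOn γ.ext (Ioo 0 1) := by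
  have key : ∀ s ∈ Ioo (0 : ℝ) 1, ∀ t ∈ Ioo (0 : ℝ) 1, s < t → γ.ext s ≠ γ.ext t := by
    intro s hs t ht hst h
    rw [γ.ext_of_mem (Ioo_subset_Icc_self hs), γ.ext_of_mem (Ioo_subset_Icc_self ht)] at h
    have h1 := (γ.inj _ _ (Subtype.mk_lt_mk.2 hst) h).1
    exact hs.1.ne' (congrArg Subtype.val h1)
  intro s hs t ht h
  rcases lt_trichotomy s t with hst | rfl | hst
  · exact absurd h (key s hs t ht hst)
  · rfl
  · exact absurd h.symm (key t ht s hs hst)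

/-- Near an interior point that lies in the interior of an edge, a path is a strictly monotone
reparametrisation of the edge. -/
theorem exists_chart (γ : G.GPath) {s₀ t₀ : ℝ} (hs₀ : s₀ ∈ Ioo (0 : ℝ) 1) {e : E}
    (ht₀ : t₀ ∈ Ioo 0 (G.len e)) (h : γ.ext s₀ = G.pt e t₀) :
    ∃ (s₁ s₂ : ℝ) (c : ℝ → ℝ), s₀ ∈ Ioo s₁ s₂ ∧ 0 < s₁ ∧ s₂ < 1 ∧ c s₀ = t₀ ∧
      ContinuousOn c (Icc s₁ s₂) ∧
      (∀ s ∈ Icc s₁ s₂, c s ∈ Ioo 0 (G.len e) ∧ γ.ext s = G.pt e (c s)) ∧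
      (StrictMonoOn c (Icc s₁ s₂) ∨ StrictAntiOn c (Icc s₁ s₂)) := by
  -- The edge coordinate of the path. It is continuous because `pt` is open on the interior of the
  -- edge, and injective because the path is; a continuous injection of an interval is strictly
  -- monotone.
  let c : ℝ → ℝ := fun s => Function.invFunOn (G.pt e) (Ioo 0 (G.len e)) (γ.ext s)
  have hc : ∀ s, γ.ext s ∈ G.pt e '' Ioo 0 (G.len e) →
      c s ∈ Ioo 0 (G.len e) ∧ G.pt e (c s) = γ.ext s := fun s hs =>
    ⟨Function.invFunOn_mem hs, Function.invFunOn_eq hs⟩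
  have hc' : ∀ s, ∀ t ∈ Ioo 0 (G.len e), γ.ext s = G.pt e t → c s = t := fun s t ht hst =>
    injOn_pt e (hc s ⟨t, ht, hst.symm⟩).1 ht ((hc s ⟨t, ht, hst.symm⟩).2.trans hst)
  have hnear : ∀ᶠ s in 𝓝 s₀, γ.ext s ∈ G.pt e '' Ioo 0 (G.len e) ∧ s ∈ Ioo (0 : ℝ) 1 := by
    refine (γ.continuous_ext.continuousAt.eventually_mem ?_).and (Ioo_mem_nhds hs₀.1 hs₀.2)
    exact (isOpen_image_pt isOpen_Ioo Subset.rfl).mem_nhds ⟨t₀, ht₀, h.symm⟩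
  obtain ⟨s₁, s₂, hs, hsub⟩ := mem_nhds_iff_exists_Ioo_subset.1 hnear
  obtain ⟨s₁', h1, h1'⟩ := exists_between hs.1
  obtain ⟨s₂', h2, h2'⟩ := exists_between hs.2
  have hIcc : ∀ s ∈ Icc s₁' s₂', γ.ext s ∈ G.pt e '' Ioo 0 (G.len e) ∧ s ∈ Ioo (0 : ℝ) 1 :=
    fun s hs => hsub ⟨h1.trans_le hs.1, hs.2.trans_lt h2'⟩
  have hcont : ContinuousOn c (Icc s₁' s₂') := by
    intro s hs
    apply ContinuousAt.continuousWithinAt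
    obtain ⟨hcs, hcs'⟩ := hc s (hIcc s hs).1
    intro V hV
    obtain ⟨V', hV'V, hV'o, hV'⟩ := mem_nhds_iff.1 hV
    have h3 : G.pt e '' (V' ∩ Ioo 0 (G.len e)) ∈ 𝓝 (γ.ext s) :=
      (isOpen_image_pt (hV'o.inter isOpen_Ioo) inter_subset_right).mem_nhds
        ⟨c s, ⟨hV', hcs⟩, hcs'⟩
    rw [Filter.mem_map]
    filter_upwards [γ.continuous_ext.continuousAt h3] with x hx
    obtain ⟨t, ht, hxt⟩ := hx
    change c x ∈ V
    rw [hc' x t ht.2 hxt.symm]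
    exact hV'V ht.1
  have hinj : InjOn c (Icc s₁' s₂') := by
    intro x hx y hy hxy
    apply γ.injOn_ext (hIcc x hx).2 (hIcc y hy).2
    rw [← (hc x (hIcc x hx).1).2, ← (hc y (hIcc y hy).1).2, hxy]
  have hle : s₁' ≤ s₂' := (h1'.trans h2).le
  exact ⟨s₁', s₂', c, ⟨h1', h2⟩, (hIcc s₁' ⟨le_rfl, hle⟩).2.1, (hIcc s₂' ⟨hle, le_rfl⟩).2.2,
    hc' s₀ t₀ ht₀ h, hcont, fun s hs => ⟨(hc s (hIcc s hs).1).1, (hc s (hIcc s hs).1).2.symm⟩,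
    hcont.strictMonoOn_of_injOn_Icc' hle hinj⟩

end GPath

theorem setLength_image_pt [Fintype E] {e : E} {x y : ℝ} (hxy : x ≤ y)
    (hsub : Icc x y ⊆ Ioo 0 (G.len e)) : G.setLength (G.pt e '' Icc x y) = y - x := by
  classical
  rw [setLength, Finset.sum_eq_single e]
  · have : {t | t ∈ Icc 0 (G.len e) ∧ G.pt e t ∈ G.pt e '' Icc x y} = Icc x y := by
      ext t
      constructor
      · rintro ⟨ht, s, hs, hst⟩
        rwa [← ((pt_eq_pt_iff_of_mem_Ioo (hsub hs) ht).1 hst).2]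
      · exact fun ht => ⟨Ioo_subset_Icc_self (hsub ht), t, ht, rfl⟩
    rw [this, Real.volume_Icc, ENNReal.toReal_ofReal (sub_nonneg.2 hxy)]
  · intro e' _ he'
    have : {t | t ∈ Icc 0 (G.len e') ∧ G.pt e' t ∈ G.pt e '' Icc x y} = ∅ := by
      rw [eq_empty_iff_forall_notMem]
      rintro t ⟨ht, s, hs, hst⟩
      exact he' ((pt_eq_pt_iff_of_mem_Ioo (hsub hs) ht).1 hst).1.symm
    rw [this, measure_empty, ENNReal.toReal_zero]
  · simp

theorem convexOn_of_three_points {f : ℝ → ℝ} {a b : ℝ}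
    (h : ∀ x y z, a < x → x ≤ y → y ≤ z → z < b →
      (z - x) * f y ≤ (z - y) * f x + (y - x) * f z) : ConvexOn ℝ (Ioo a b) f := by
  refine LinearOrder.convexOn_of_lt (convex_Ioo a b) fun x hx z hz hxz s t hs ht hst => ?_
  simp only [smul_eq_mul]
  obtain rfl : s = 1 - t := by linarith
  have h1 := h x ((1 - t) * x + t * z) z hx.1 (by nlinarith) (by nlinarith) hz.2
  have h2 : z - ((1 - t) * x + t * z) = (z - x) * (1 - t) := by ring
  have h3 : (1 - t) * x + t * z - x = (z - x) * t := by ring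
  rw [h2, h3] at h1
  refine le_of_mul_le_mul_left ?_ (sub_pos.2 hxz)
  linarith

/-- Along a path, the image of a short parameter interval is an interval of an edge. -/
theorem GPath.image_Icc_of_chart (γ : G.GPath) {e : E} {s₁ s₂ : ℝ}
    {c : ℝ → ℝ} (hc : ContinuousOn c (Icc s₁ s₂)) (hγ : ∀ s ∈ Icc s₁ s₂, γ.ext s = G.pt e (c s))
    (hmono : MonotoneOn c (Icc s₁ s₂) ∨ AntitoneOn c (Icc s₁ s₂)) {r s : unitInterval}
    (hr : (r : ℝ) ∈ Icc s₁ s₂) (hs : (s : ℝ) ∈ Icc s₁ s₂) (hrs : r ≤ s) :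
    γ.map '' Icc r s = G.pt e '' uIcc (c r) (c s) := by
  have hsub : Icc (r : ℝ) s ⊆ Icc s₁ s₂ := Icc_subset_Icc hr.1 hs.2
  have h2 : γ.map '' Icc r s = γ.ext '' Icc (r : ℝ) s := by
    ext x
    constructor
    · rintro ⟨y, hy, rfl⟩
      exact ⟨y, ⟨hy.1, hy.2⟩, γ.ext_coe y⟩
    · rintro ⟨y, hy, rfl⟩
      have hy' : y ∈ Icc (0 : ℝ) 1 := ⟨r.2.1.trans hy.1, hy.2.trans s.2.2⟩
      exact ⟨⟨y, hy'⟩, ⟨hy.1, hy.2⟩, (γ.ext_of_mem hy').symm⟩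
  have h3 : γ.ext '' Icc (r : ℝ) s = G.pt e '' (c '' Icc (r : ℝ) s) := by
    rw [image_image]
    exact image_congr fun x hx => hγ x (hsub hx)
  have h4 : c '' Icc (r : ℝ) s = uIcc (c r) (c s) := by
    have hrs' : (r : ℝ) ≤ s := hrs
    refine Subset.antisymm ?_ ?_
    · rintro _ ⟨x, hx, rfl⟩
      rcases hmono with hm | hm
      · exact Icc_subset_uIcc ⟨hm hr (hsub hx) hx.1, hm (hsub hx) hs hx.2⟩
      · exact Icc_subset_uIcc' ⟨hm (hsub hx) hs hx.2, hm hr (hsub hx) hx.1⟩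
    · have := intermediate_value_uIcc (hc.mono (by rw [uIcc_of_le hrs']; exact hsub))
      rwa [uIcc_of_le hrs'] at this
  rw [h2, h3, h4]

/-- In a chart the arc length between two parameters is the distance of their edge coordinates, so
convexity in arc length becomes convexity in the coordinate. If the path runs against the edge, the
outer points swap roles. -/
theorem ConvexAlong.convexOn_chart [Fintype E] {q : G.Point → ℝ} {γ : G.GPath}
    (hq : G.ConvexAlong q γ) {e : E} {s₁ s₂ : ℝ} (h0 : 0 < s₁) (h1 : s₂ < 1)
    {c : ℝ → ℝ} (hc : ContinuousOn c (Icc s₁ s₂))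
    (hγ : ∀ s ∈ Icc s₁ s₂, c s ∈ Ioo 0 (G.len e) ∧ γ.ext s = G.pt e (c s))
    (hmono : StrictMonoOn c (Icc s₁ s₂) ∨ StrictAntiOn c (Icc s₁ s₂)) {x y z : ℝ}
    (hx : x ∈ c '' Icc s₁ s₂) (hy : y ∈ c '' Icc s₁ s₂) (hz : z ∈ c '' Icc s₁ s₂)
    (hxy : x ≤ y) (hyz : y ≤ z) :
    (z - x) * q (G.pt e y) ≤ (z - y) * q (G.pt e x) + (y - x) * q (G.pt e z) := by
  have hmono' : MonotoneOn c (Icc s₁ s₂) ∨ AntitoneOn c (Icc s₁ s₂) :=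
    hmono.imp StrictMonoOn.monotoneOn StrictAntiOn.antitoneOn
  have hI : ∀ s ∈ Icc s₁ s₂, s ∈ Icc (0 : ℝ) 1 := fun s hs =>
    ⟨h0.le.trans hs.1, hs.2.trans h1.le⟩
  have himage : ∀ {x y : ℝ}, x ∈ c '' Icc s₁ s₂ → y ∈ c '' Icc s₁ s₂ → x ≤ y →
      Icc x y ⊆ Ioo 0 (G.len e) := by
    rintro _ _ ⟨r, hr, rfl⟩ ⟨s, hs, rfl⟩ - t ht
    exact ⟨(hγ r hr).1.1.trans_le ht.1, ht.2.trans_lt (hγ s hs).1.2⟩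
  have hlen : ∀ {r s : ℝ} (hr : r ∈ Icc s₁ s₂) (hs : s ∈ Icc s₁ s₂), r ≤ s →
      G.setLength (γ.map '' Icc ⟨r, hI r hr⟩ ⟨s, hI s hs⟩) = |c s - c r| := by
    intro r s hr hs hrs
    rw [γ.image_Icc_of_chart hc (fun s hs => (hγ s hs).2) hmono' (r := ⟨r, hI r hr⟩)
      (s := ⟨s, hI s hs⟩) hr hs hrs]
    rcases le_total (c r) (c s) with h | h
    · rw [uIcc_of_le h, setLength_image_pt h (himage ⟨r, hr, rfl⟩ ⟨s, hs, rfl⟩ h),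
        abs_of_nonneg (sub_nonneg.2 h)]
    · rw [uIcc_of_ge h, setLength_image_pt h (himage ⟨s, hs, rfl⟩ ⟨r, hr, rfl⟩ h),
        abs_of_nonpos (sub_nonpos.2 h)]
      ring
  have hval : ∀ s (hs : s ∈ Icc s₁ s₂), γ.map ⟨s, hI s hs⟩ = G.pt e (c s) := fun s hs => by
    rw [← γ.ext_of_mem, (hγ s hs).2]
  obtain ⟨r, hr, rfl⟩ := hx
  obtain ⟨s, hs, rfl⟩ := hy
  obtain ⟨t, ht, rfl⟩ := hz
  rcases hmono with hm | hm
  · have hrs : r ≤ s := (hm.le_iff_le hr hs).1 hxy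
    have hst : s ≤ t := (hm.le_iff_le hs ht).1 hyz
    have := hq ⟨r, hI r hr⟩ ⟨s, hI s hs⟩ ⟨t, hI t ht⟩ hrs hst
    rwa [hlen hr ht (hrs.trans hst), hlen hs ht hst, hlen hr hs hrs, hval r hr, hval s hs,
      hval t ht, abs_of_nonneg (by linarith), abs_of_nonneg (by linarith),
      abs_of_nonneg (by linarith)] at this
  · have hrs : s ≤ r := (hm.le_iff_ge hr hs).1 hxy
    have hst : t ≤ s := (hm.le_iff_ge hs ht).1 hyz
    have := hq ⟨t, hI t ht⟩ ⟨s, hI s hs⟩ ⟨r, hI r hr⟩ hst hrs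
    rw [hlen ht hr (hst.trans hrs), hlen hs hr hrs, hlen ht hs hst, hval r hr, hval s hs,
      hval t ht, abs_of_nonpos (by linarith), abs_of_nonpos (by linarith),
      abs_of_nonpos (by linarith)] at this
    linarith

/-- In a chart around an interior point of a path, a neighbourhood of the point is covered. -/
theorem exists_Ioo_subset_image_chart {s₀ s₁ s₂ : ℝ} {c : ℝ → ℝ} (hs₀ : s₀ ∈ Ioo s₁ s₂)
    (hc : ContinuousOn c (Icc s₁ s₂))
    (hmono : StrictMonoOn c (Icc s₁ s₂) ∨ StrictAntiOn c (Icc s₁ s₂)) :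
    ∃ a b, c s₀ ∈ Ioo a b ∧ Ioo a b ⊆ c '' Icc s₁ s₂ := by
  have hle : s₁ ≤ s₂ := (hs₀.1.trans hs₀.2).le
  have m0 := Ioo_subset_Icc_self hs₀
  have m1 : s₁ ∈ Icc s₁ s₂ := ⟨le_rfl, hle⟩
  have m2 : s₂ ∈ Icc s₁ s₂ := ⟨hle, le_rfl⟩
  rcases hmono with hm | hm
  · exact ⟨c s₁, c s₂, ⟨hm m1 m0 hs₀.1, hm m0 m2 hs₀.2⟩,
      Ioo_subset_Icc_self.trans (intermediate_value_Icc hle hc)⟩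
  · exact ⟨c s₂, c s₁, ⟨hm m0 m2 hs₀.2, hm m1 m0 hs₀.1⟩,
      Ioo_subset_Icc_self.trans (intermediate_value_Icc' hle hc)⟩

/-- Around each interior point of a path the potentials are convex in the edge coordinate; the end
points of the paths form the countable exceptional set. The convexity inequalities, involving three
values each, pass to the pointwise limit along the ultrafilter, also across vertices. -/
theorem exists_limit_convexClass [Fintype E] {P : Set G.GPath} (hP : P.Finite) {M : ℝ}
    (hM : 0 ≤ M) {q : ℕ → G.Point → ℝ} (hq : ∀ n, q n ∈ G.convexClass P M) :
    ∃ (φ : ℕ → ℕ) (q₀ : G.Point → ℝ), StrictMono φ ∧ q₀ ∈ G.convexClass P M ∧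
      WeakTendsto (fun n => q (φ n)) q₀ := by
  have hN : (⋃ γ ∈ P, {γ.map 0, γ.map 1} : Set G.Point).Countable :=
    hP.countable.biUnion fun γ _ => (Set.toFinite _).countable
  obtain ⟨φ, U, q₀, hφ, hU, -, hq₀, hweak, hpt⟩ := exists_limit_potential hM
    (fun n => (hq n).1) (R := ⋃ γ ∈ P, range γ.map) hN (by
      intro e t ht hR hN
      obtain ⟨γ, hγP, s, hs⟩ := mem_iUnion₂.1 hR
      have hsI : (s : ℝ) ∈ Ioo (0 : ℝ) 1 := by
        refine ⟨s.2.1.lt_of_ne fun h => hN (mem_iUnion₂.2 ⟨γ, hγP, ?_⟩),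
          s.2.2.lt_of_ne fun h => hN (mem_iUnion₂.2 ⟨γ, hγP, ?_⟩)⟩
        · left; rw [← hs]; congr 1; exact Subtype.ext h.symm
        · right; rw [mem_singleton_iff, ← hs]; congr 1; exact Subtype.ext h
      obtain ⟨s₁, s₂, c, hs₀, h0, h1, hcs, hc, hγ, hmono⟩ :=
        γ.exists_chart hsI ht ((γ.ext_coe s).trans hs)
      obtain ⟨a, b, hab, hsub⟩ := exists_Ioo_subset_image_chart hs₀ hc hmono
      refine ⟨a, b, hcs ▸ hab, fun x hx => ?_, fun x hx => ?_, Or.inr (Or.inr ?_)⟩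
      · obtain ⟨r, hr, rfl⟩ := hsub hx
        exact (hγ r hr).1
      · obtain ⟨r, hr, rfl⟩ := hsub hx
        exact mem_iUnion₂.2 ⟨γ, hγP, _, (hγ r hr).2⟩
      · refine .of_forall fun n => convexOn_of_three_points fun x y z hx hxy hyz hz => ?_
        exact ((hq n).2 γ hγP).convexOn_chart h0 h1 hc hγ hmono
          (hsub ⟨hx, (hxy.trans hyz).trans_lt hz⟩) (hsub ⟨hx.trans_le hxy, hyz.trans_lt hz⟩)
          (hsub ⟨hx.trans_le (hxy.trans hyz), hz⟩) hxy hyz)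
  refine ⟨φ, q₀, hφ, ⟨hq₀, fun γ hγ r s t hrs hst => ?_⟩, hweak⟩
  have hlim : ∀ s, Tendsto (fun n => q (φ n) (γ.map s)) U (𝓝 (q₀ (γ.map s))) := fun s =>
    hpt _ (mem_iUnion₂.2 ⟨γ, hγ, s, rfl⟩)
  exact le_of_tendsto_of_tendsto ((hlim s).const_mul _)
    (((hlim r).const_mul _).add ((hlim t).const_mul _))
    (.of_forall fun n => (hq (φ n)).2 γ hγ r s t hrs hst)

end MetricGraph

/-! ### Single-well potentials on a tree -/

namespace MetricGraph

variable {E : Type*} {G : MetricGraph E}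

/-- The only possible identification within one edge is that of its two ends, when it is a loop;
these are a full edge length apart. -/
theorem eq_of_pt_eq_pt {e : E} {s t : ℝ} (hs : s ∈ Icc 0 (G.len e)) (ht : t ∈ Icc 0 (G.len e))
    (hst : |s - t| < G.len e) (h : G.pt e s = G.pt e t) : s = t := by
  by_cases hs' : s ∈ Ioo 0 (G.len e)
  · exact ((pt_eq_pt_iff_of_mem_Ioo hs' ht).1 h).2
  by_cases ht' : t ∈ Ioo 0 (G.len e)
  · exact ((pt_eq_pt_iff_of_mem_Ioo ht' hs).1 h.symm).2.symm
  have key : ∀ r ∈ Icc 0 (G.len e), r ∉ Ioo 0 (G.len e) → r = 0 ∨ r = G.len e := by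
    intro r hr hr'
    rcases hr.1.eq_or_lt with h0 | h0
    · exact Or.inl h0.symm
    · exact Or.inr (hr.2.eq_or_lt.resolve_right fun h1 => hr' ⟨h0, h1⟩)
  rcases key s hs hs' with rfl | rfl <;> rcases key t ht ht' with rfl | rfl
  · rfl
  · rw [zero_sub, abs_neg, abs_of_pos (G.len_pos e)] at hst
    exact absurd hst (lt_irrefl _)
  · rw [sub_zero, abs_of_pos (G.len_pos e)] at hst
    exact absurd hst (lt_irrefl _)
  · rfl

/-- Gluing affects only ends, so the preimage of the image on each edge is closed up to finitely
many points. -/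
theorem isClosed_image_pt {e : E} {J : Set ℝ} (hJ : IsClosed J) (hsub : J ⊆ Icc 0 (G.len e)) :
    IsClosed (G.pt e '' J) := by
  have hcoin : IsClosed ((Quotient.mk G.glue) ⁻¹' (G.pt e '' J)) := by
    rw [isClosed_sigma_iff]
    intro e'
    let Z : Set (Icc 0 (G.len e')) := {x | (Quotient.mk G.glue ⟨e', x⟩ : G.Point) ∈ G.pt e '' J}
    let B : Set (Icc 0 (G.len e')) := {⟨0, left_mem_Icc.2 (G.len_pos e').le⟩,
      ⟨G.len e', right_mem_Icc.2 (G.len_pos e').le⟩}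
    have hZ : ∀ x, x ∈ Z ↔ G.pt e' x ∈ G.pt e '' J := by
      intro x
      rw [pt, projIcc_val]
      rfl
    have hint : ∀ x : Icc 0 (G.len e'), x ∉ B → (x : ℝ) ∈ Ioo 0 (G.len e') := by
      intro x hx
      refine ⟨x.2.1.lt_of_ne fun h => hx (Or.inl (Subtype.ext h.symm)),
        x.2.2.lt_of_ne fun h => hx (Or.inr (Subtype.ext h))⟩
    have hB : (Z ∩ B).Finite := (Set.toFinite B).inter_of_right Z
    by_cases he : e' = e
    · subst he
      have : Z = (Z ∩ B) ∪ (Subtype.val : Icc 0 (G.len e') → ℝ) ⁻¹' J := by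
        ext x
        constructor
        · intro hx
          by_cases hxB : x ∈ B
          · exact Or.inl ⟨hx, hxB⟩
          · obtain ⟨t, ht, htx⟩ := (hZ x).1 hx
            right
            rw [mem_preimage, ((pt_eq_pt_iff_of_mem_Ioo (hint x hxB) (hsub ht)).1 htx.symm).2]
            exact ht
        · rintro (hx | hx)
          · exact hx.1
          · exact (hZ x).2 ⟨x, hx, rfl⟩
      change IsClosed Z
      rw [this]
      exact hB.isClosed.union (hJ.preimage continuous_subtype_val)
    · have : Z = Z ∩ B := by
        refine Subset.antisymm (fun x hx => ⟨hx, ?_⟩) inter_subset_left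
        by_contra hxB
        obtain ⟨t, ht, htx⟩ := (hZ x).1 hx
        exact he ((pt_eq_pt_iff_of_mem_Ioo (hint x hxB) (hsub ht)).1 htx.symm).1
      change IsClosed Z
      rw [this]
      exact hB.isClosed
  exact (isQuotientMap_quotient_mk' (s := G.glue)).isClosed_preimage.1 hcoin

theorem isClosed_singleton_point (x : G.Point) : IsClosed ({x} : Set G.Point) := by
  obtain ⟨e, t, ht, rfl⟩ := G.exists_pt_eq x
  simpa using isClosed_image_pt (isClosed_singleton (x := t)) (singleton_subset_iff.2 ht)

/-- An interior point of a segment has two outgoing directions inside the subgraph, so a leaf is an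
end of one of the finitely many segments. -/
theorem countable_leaves {T : Set G.Point} (hT : G.IsSubgraph T) : (G.leaves T).Countable := by
  obtain ⟨S, hS, rfl⟩ := hT
  have hc : (⋃ p ∈ S, {G.pt p.1 p.2.1, G.pt p.1 p.2.2} : Set G.Point).Countable :=
    S.countable_toSet.biUnion fun p _ => (Set.toFinite _).countable
  refine hc.mono ?_
  rintro x ⟨hx, hdeg⟩
  obtain ⟨p, hp, t, ht, rfl⟩ := mem_iUnion₂.1 hx
  refine mem_iUnion₂.2 ⟨p, hp, ?_⟩
  by_contra hne
  rw [mem_insert_iff, mem_singleton_iff, not_or] at hne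
  have ht' : t ∈ Ioo p.2.1 p.2.2 :=
    ⟨ht.1.lt_of_ne fun h => hne.1 (by rw [h]), ht.2.lt_of_ne fun h => hne.2 (by rw [h])⟩
  obtain ⟨h0, -, h1⟩ := hS p hp
  have hmem : ∀ σ : ℝ, σ = 1 ∨ σ = -1 → (p.1, t, σ) ∈ {g : E × ℝ × ℝ |
      g.2.1 ∈ Icc 0 (G.len g.1) ∧ (g.2.2 = 1 ∨ g.2.2 = -1) ∧ G.pt g.1 g.2.1 = G.pt p.1 t ∧
      ∀ᶠ s in 𝓝[>] (0 : ℝ), g.2.1 + g.2.2 * s ∈ Icc 0 (G.len g.1) ∧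
        G.pt g.1 (g.2.1 + g.2.2 * s) ∈ ⋃ p ∈ S, G.pt p.1 '' Icc p.2.1 p.2.2} := by
    intro σ hσ
    refine ⟨⟨h0.trans ht.1, ht.2.trans h1⟩, hσ, rfl, ?_⟩
    have hcont : Tendsto (fun s : ℝ => t + σ * s) (𝓝[>] 0) (𝓝 t) := by
      have : Continuous fun s : ℝ => t + σ * s := by fun_prop
      simpa using (this.tendsto 0).mono_left nhdsWithin_le_nhds
    filter_upwards [hcont.eventually_mem (Ioo_mem_nhds ht'.1 ht'.2)] with s hs
    exact ⟨⟨h0.trans hs.1.le, hs.2.le.trans h1⟩,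
      mem_iUnion₂.2 ⟨p, hp, _, Ioo_subset_Icc_self hs, rfl⟩⟩
  obtain ⟨g, hg⟩ := Set.ncard_eq_one.1 hdeg
  have e1 := hmem 1 (Or.inl rfl)
  have e2 := hmem (-1) (Or.inr rfl)
  rw [hg, mem_singleton_iff] at e1 e2
  have := congrArg (fun g : E × ℝ × ℝ => g.2.2) (e1.trans e2.symm)
  norm_num at this

namespace GPath

/-- An injective path. -/
def ofInjective (f : ℝ → G.Point) (hf : Continuous f) (hinj : InjOn f (Icc 0 1)) : G.GPath where
  map := ⟨fun s => f s, hf.comp continuous_subtype_val⟩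
  inj s t hst h := absurd (Subtype.ext (hinj s.2 t.2 h)) hst.ne

theorem ofInjective_ext (f : ℝ → G.Point) (hf : Continuous f) (hinj : InjOn f (Icc 0 1)) {s : ℝ}
    (hs : s ∈ Icc (0 : ℝ) 1) : (ofInjective f hf hinj).ext s = f s := by
  rw [ext_of_mem _ hs]
  rfl

theorem injOn_ext_Icc (γ : G.GPath) (hne : γ.map 0 ≠ γ.map 1) : InjOn γ.ext (Icc 0 1) := by
  have key : ∀ s ∈ Icc (0 : ℝ) 1, ∀ t ∈ Icc (0 : ℝ) 1, s < t → γ.ext s ≠ γ.ext t := by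
    intro s hs t ht hst h
    rw [γ.ext_of_mem hs, γ.ext_of_mem ht] at h
    obtain ⟨h0, h1⟩ := γ.inj _ _ (Subtype.mk_lt_mk.2 hst) h
    rw [h0, h1] at h
    exact hne h
  intro s hs t ht h
  rcases lt_trichotomy s t with hst | rfl | hst
  · exact absurd h (key s hs t ht hst)
  · rfl
  · exact absurd h.symm (key t ht s hs hst)

theorem ext_zero (γ : G.GPath) : γ.ext 0 = γ.map 0 := γ.ext_coe 0

theorem ext_one (γ : G.GPath) : γ.ext 1 = γ.map 1 := γ.ext_coe 1

theorem ext_mem_range (γ : G.GPath) (s : ℝ) : γ.ext s ∈ range γ.map := ⟨_, rfl⟩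

/-- A path that meets an edge segment only at its final time can be continued along the segment. -/
theorem exists_continuation (γ : G.GPath) (hne : γ.map 0 ≠ γ.map 1) {T : Set G.Point}
    (hγT : range γ.map ⊆ T) {e : E} {J : Set ℝ} (hJ : Convex ℝ J) (hJT : G.pt e '' J ⊆ T)
    (hJinj : InjOn (G.pt e) J) {s₀ r₀ r₁ : ℝ} (hs₀ : s₀ ∈ Ioc (0 : ℝ) 1) (hr₀ : r₀ ∈ J)
    (hr₁ : r₁ ∈ J) (hγ : γ.ext s₀ = G.pt e r₀) (hfirst : ∀ s ∈ Ico 0 s₀, γ.ext s ∉ G.pt e '' J) :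
    ∃ (γ' : G.GPath) (k : ℝ), range γ'.map ⊆ T ∧ γ'.map 0 = γ.map 0 ∧ γ'.map 1 = G.pt e r₁ ∧
      0 < k ∧ ∀ s ∈ Icc 0 s₀, k * s ∈ Icc (0 : ℝ) 1 ∧ γ'.ext (k * s) = γ.ext s := by
  have hinj := γ.injOn_ext_Icc hne
  have hpos := hs₀.1
  -- When the target is reached already, truncating and rescaling is enough; otherwise the truncated
  -- path takes the first half of the time and the segment the second. The factor k converts the old
  -- time into the new.
  by_cases hr : r₀ = r₁
  · subst hr
    have hmem : ∀ s ∈ Icc (0 : ℝ) 1, s₀ * s ∈ Icc (0 : ℝ) 1 := fun s hs =>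
      ⟨mul_nonneg hpos.le hs.1, mul_le_one₀ hs₀.2 hs.1 hs.2⟩
    let f : ℝ → G.Point := fun s => γ.ext (s₀ * s)
    have hf : Continuous f := γ.continuous_ext.comp (by fun_prop)
    have hfinj : InjOn f (Icc 0 1) := fun s hs t ht h =>
      mul_left_cancel₀ hpos.ne' (hinj (hmem s hs) (hmem t ht) h)
    refine ⟨ofInjective f hf hfinj, s₀⁻¹, ?_, ?_, ?_, inv_pos.2 hpos, fun s hs => ?_⟩
    · rintro _ ⟨s, rfl⟩
      exact hγT (γ.ext_mem_range _)
    · change γ.ext (s₀ * 0) = _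
      rw [mul_zero, ext_zero]
    · change γ.ext (s₀ * 1) = _
      rw [mul_one, hγ]
    · have h1 : s₀⁻¹ * s ∈ Icc (0 : ℝ) 1 :=
        ⟨mul_nonneg (inv_pos.2 hpos).le hs.1, by rw [inv_mul_le_one₀ hpos]; exact hs.2⟩
      refine ⟨h1, ?_⟩
      rw [ofInjective_ext _ _ _ h1]
      simp only [f]
      rw [mul_inv_cancel_left₀ hpos.ne']
  · let f₁ : ℝ → G.Point := fun s => γ.ext (2 * s * s₀)
    let f₂ : ℝ → G.Point := fun s => G.pt e (r₀ + (2 * s - 1) * (r₁ - r₀))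
    let f : ℝ → G.Point := fun s => if s ≤ 1 / 2 then f₁ s else f₂ s
    have hf : Continuous f := by
      refine Continuous.if_le (γ.continuous_ext.comp (by fun_prop))
        ((G.continuous_pt e).comp (by fun_prop)) continuous_id continuous_const ?_
      rintro s rfl
      simp only [f₁, f₂]
      rw [show (2 : ℝ) * (1 / 2) * s₀ = s₀ by ring, hγ]
      congr 1
      ring
    have hf1 : ∀ s, s ≤ 1 / 2 → f s = f₁ s := fun s hs => if_pos hs
    have hf2 : ∀ s, 1 / 2 < s → f s = f₂ s := fun s hs => if_neg (not_le.2 hs)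
    have hJmem : ∀ s ∈ Icc (1 / 2 : ℝ) 1, r₀ + (2 * s - 1) * (r₁ - r₀) ∈ J := by
      intro s hs
      have := hJ hr₀ hr₁ (a := 1 - (2 * s - 1)) (b := 2 * s - 1) (by linarith [hs.2])
        (by linarith [hs.1]) (by ring)
      simp only [smul_eq_mul] at this
      convert this using 1
      ring
    have hne' : r₁ - r₀ ≠ 0 := sub_ne_zero.2 (Ne.symm hr)
    have hI : ∀ s, 0 ≤ s → s ≤ 1 / 2 → 2 * s * s₀ ∈ Icc (0 : ℝ) 1 := fun s h0 h1 =>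
      ⟨by positivity, by nlinarith [hs₀.2]⟩
    have key : ∀ s ∈ Icc (0 : ℝ) 1, ∀ t ∈ Icc (0 : ℝ) 1, s < t → f s ≠ f t := by
      intro s hs t ht hst h
      rcases le_or_gt t (1 / 2) with ht2 | ht2
      · rw [hf1 t ht2, hf1 s (hst.le.trans ht2)] at h
        have := hinj (hI s hs.1 (hst.le.trans ht2)) (hI t ht.1 ht2) h
        have := mul_right_cancel₀ hpos.ne' this
        linarith
      · rw [hf2 t ht2] at h
        rcases le_or_gt s (1 / 2) with hs2 | hs2
        · rw [hf1 s hs2] at h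
          rcases hs2.eq_or_lt with rfl | hs3
          · simp only [f₁, f₂] at h
            rw [show (2 : ℝ) * (1 / 2) * s₀ = s₀ by ring, hγ] at h
            have h3 := hJinj hr₀ (hJmem t ⟨ht2.le, ht.2⟩) h
            have h4 : (2 * t - 1) * (r₁ - r₀) = 0 := by linarith
            rcases mul_eq_zero.1 h4 with h5 | h5
            · linarith
            · exact hne' h5
          · refine hfirst (2 * s * s₀) ⟨(hI s hs.1 hs2).1, by nlinarith⟩ ?_
            exact ⟨_, hJmem t ⟨ht2.le, ht.2⟩, h.symm⟩
        · rw [hf2 s hs2] at h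
          have h3 := hJinj (hJmem s ⟨hs2.le, hs.2⟩) (hJmem t ⟨ht2.le, ht.2⟩) h
          have h4 := mul_right_cancel₀ hne' (add_left_cancel h3)
          linarith
    have hfinj : InjOn f (Icc 0 1) := by
      intro s hs t ht h
      rcases lt_trichotomy s t with hst | rfl | hst
      · exact absurd h (key s hs t ht hst)
      · rfl
      · exact absurd h.symm (key t ht s hs hst)
    refine ⟨ofInjective f hf hfinj, (2 * s₀)⁻¹, ?_, ?_, ?_, by positivity, fun s hs => ?_⟩
    · rintro _ ⟨s, rfl⟩
      change f s ∈ T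
      rcases le_or_gt (s : ℝ) (1 / 2) with hs | hs
      · rw [hf1 _ hs]
        exact hγT (γ.ext_mem_range _)
      · rw [hf2 _ hs]
        exact hJT ⟨_, hJmem s ⟨hs.le, s.2.2⟩, rfl⟩
    · change f 0 = _
      rw [hf1 0 (by norm_num)]
      simp only [f₁, mul_zero, zero_mul]
      exact γ.ext_zero
    · change f 1 = _
      rw [hf2 1 (by norm_num)]
      simp only [f₂]
      congr 1
      ring
    · have h0 : (2 * s₀)⁻¹ * s ≤ 1 / 2 := by
        rw [inv_mul_le_iff₀ (by positivity)]
        linarith [hs.2]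
      have h1 : (2 * s₀)⁻¹ * s ∈ Icc (0 : ℝ) 1 :=
        ⟨mul_nonneg (by positivity) hs.1, by linarith⟩
      refine ⟨h1, ?_⟩
      rw [ofInjective_ext _ _ _ h1, hf1 _ h0]
      simp only [f₁]
      congr 1
      field_simp

end GPath

end MetricGraph

/-! ### Convergence of the bottoms of single wells. -/

namespace MetricGraph

variable {E : Type*} {G : MetricGraph E}

/-- A path ending at `a` stays away, up to a time before the end, from short segments at `a`. -/
theorem GPath.eventually_notMem_segment (γ : G.GPath) (hne : γ.map 0 ≠ γ.map 1) {e : E}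
    {τ : ℕ → ℝ} {τ₀ : ℝ} (hτ : ∀ n, τ n ∈ Icc 0 (G.len e)) (hτ₀ : τ₀ ∈ Icc 0 (G.len e))
    (hlim : Tendsto τ atTop (𝓝 τ₀)) (hγ : γ.map 1 = G.pt e τ₀) {S : ℝ} (hS : S < 1) :
    ∀ᶠ n in atTop, ∀ s ∈ Icc 0 S, γ.ext s ∉ G.pt e '' uIcc (τ n) τ₀ := by
  by_contra hcon
  rw [not_eventually] at hcon
  obtain ⟨ψ, hψ, hbad⟩ := extraction_of_frequently_atTop hcon
  push Not at hbad
  choose s hs hbad using hbad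
  choose r hr hrs using hbad
  obtain ⟨s₀, hs₀, ψ', hψ', hs'⟩ := isCompact_Icc.tendsto_subseq hs
  have hτ' : Tendsto (fun n => τ (ψ (ψ' n))) atTop (𝓝 τ₀) :=
    hlim.comp (hψ.tendsto_atTop.comp hψ'.tendsto_atTop)
  have hr' : Tendsto (fun n => r (ψ' n)) atTop (𝓝 τ₀) := by
    rw [tendsto_iff_dist_tendsto_zero] at hτ' ⊢
    refine squeeze_zero (fun _ => dist_nonneg) (fun n => ?_) hτ'
    rw [Real.dist_eq, Real.dist_eq]
    refine abs_sub_le_of_uIcc_subset_uIcc (uIcc_subset_uIcc left_mem_uIcc ?_)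
    rw [uIcc_comm]
    exact hr (ψ' n)
  have hlimγ : Tendsto (fun n => γ.ext (s (ψ' n))) atTop (𝓝 (γ.ext s₀)) :=
    (γ.continuous_ext.tendsto s₀).comp hs'
  -- The limit lies in arbitrarily short closed arcs around τ₀, hence equals the end of the path;
  -- since s₀ ≤ S < 1, this contradicts injectivity.
  have hmem : ∀ δ > 0, γ.ext s₀ ∈ G.pt e '' (Icc (τ₀ - δ) (τ₀ + δ) ∩ Icc 0 (G.len e)) := by
    intro δ hδ
    refine (isClosed_image_pt (isClosed_Icc.inter isClosed_Icc) inter_subset_right).mem_of_tendsto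
      hlimγ ?_
    filter_upwards [hr'.eventually_mem (Icc_mem_nhds (by linarith : τ₀ - δ < τ₀)
      (by linarith : τ₀ < τ₀ + δ))] with n hn
    refine ⟨r (ψ' n), ⟨hn, ?_⟩, hrs (ψ' n)⟩
    exact (uIcc_subset_Icc (hτ _) hτ₀) (hr (ψ' n))
  have heq : G.pt e τ₀ = γ.ext s₀ := by
    choose ρ hρ hρs using fun n : ℕ => hmem (1 / (n + 1)) (by positivity)
    have hρ' : Tendsto ρ atTop (𝓝 τ₀) := by
      have h1 := tendsto_one_div_add_atTop_nhds_zero_nat (𝕜 := ℝ)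
      refine tendsto_of_tendsto_of_tendsto_of_le_of_le
        (by simpa using h1.const_sub τ₀) (by simpa using h1.const_add τ₀)
        (fun n => (hρ n).1.1) (fun n => (hρ n).1.2)
    have hclosed := (isClosed_singleton_point (γ.ext s₀)).preimage (G.continuous_pt e)
    exact hclosed.mem_of_tendsto hρ' (.of_forall hρs)
  have h1 := γ.injOn_ext_Icc hne ⟨hs₀.1, hs₀.2.trans hS.le⟩ (right_mem_Icc.2 zero_le_one)
    (by rw [← heq, γ.ext_one, hγ])
  linarith [hs₀.2]

/-- If the bottoms of the wells converge to `a` within a segment, then the potentials are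
eventually antitone along every path from a leaf to `a`, up to any time before the end. -/
theorem eventually_antitoneOn_ext {T : Set G.Point} (hT : G.IsTree T) {q : ℕ → G.Point → ℝ}
    {e : E} {α β : ℝ} (hα : 0 ≤ α) (hβ : β ≤ G.len e) (hseg : G.pt e '' Icc α β ⊆ T)
    {τ : ℕ → ℝ} {τ₀ : ℝ} (hτ : ∀ n, τ n ∈ Icc α β) (hτ₀ : τ₀ ∈ Icc α β)
    (hlim : Tendsto τ atTop (𝓝 τ₀))
    (hq : ∀ n, ∀ γ : G.GPath, range γ.map ⊆ T → γ.map 0 ∈ G.leaves T →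
      γ.map 1 = G.pt e (τ n) → Antitone fun s => q n (γ.map s))
    {γ : G.GPath} (hγT : range γ.map ⊆ T) (hγ0 : γ.map 0 ∈ G.leaves T)
    (hγ1 : γ.map 1 = G.pt e τ₀) {S : ℝ} (hS0 : 0 ≤ S) (hS : S < 1) :
    ∀ᶠ n in atTop, AntitoneOn (fun s => q n (γ.ext s)) (Icc 0 S) := by
  have hne := hT.acyclic γ hγT
  have hI : Icc α β ⊆ Icc 0 (G.len e) := Icc_subset_Icc hα hβ
  have hshort : ∀ᶠ n in atTop, dist (τ n) τ₀ < G.len e :=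
    (Metric.tendsto_nhds.1 hlim) _ (G.len_pos e)
  filter_upwards [γ.eventually_notMem_segment hne (fun n => hI (hτ n)) (hI hτ₀) hlim hγ1 hS,
    hshort] with n hn hshort
  have hJsub : uIcc (τ n) τ₀ ⊆ Icc α β := uIcc_subset_Icc (hτ n) hτ₀
  -- The path is left at the first time it meets the segment between the n-th bottom and the limit
  -- bottom, which keeps the rerouted path injective. That time exceeds S, so the rerouted path
  -- agrees with γ up to S.
  let H : Set ℝ := Icc 0 1 ∩ γ.ext ⁻¹' (G.pt e '' uIcc (τ n) τ₀)
  have hHc : IsCompact H := isCompact_Icc.inter_right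
    ((isClosed_image_pt isClosed_Icc (hJsub.trans hI)).preimage γ.continuous_ext)
  have hHne : H.Nonempty :=
    ⟨1, right_mem_Icc.2 zero_le_one, τ₀, right_mem_uIcc, by rw [γ.ext_one, hγ1]⟩
  have hs₀ := hHc.sInf_mem hHne
  set s₀ := sInf H
  obtain ⟨hs₀I, r₀, hr₀, hr₀s⟩ := hs₀
  have hSs : S < s₀ := by
    by_contra hle
    exact hn s₀ ⟨hs₀I.1, not_lt.1 hle⟩ ⟨r₀, hr₀, hr₀s⟩
  have hfirst : ∀ s ∈ Ico 0 s₀, γ.ext s ∉ G.pt e '' uIcc (τ n) τ₀ := by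
    intro s hs hmem
    exact (csInf_le hHc.bddBelow (show s ∈ H from ⟨⟨hs.1, hs.2.le.trans hs₀I.2⟩, hmem⟩)).not_gt hs.2
  -- The edge may be a loop; injectivity holds because the segment is shorter than the edge.
  have hJinj : InjOn (G.pt e) (uIcc (τ n) τ₀) := by
    intro x hx y hy hxy
    refine eq_of_pt_eq_pt (hI (hJsub hx)) (hI (hJsub hy)) (lt_of_le_of_lt ?_ hshort) hxy
    rw [Real.dist_eq, abs_sub_comm (τ n)]
    rw [abs_sub_comm x y]
    exact abs_sub_le_of_uIcc_subset_uIcc (uIcc_subset_uIcc hx hy)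
  obtain ⟨γ', k, h1, h2, h3, hk, h4⟩ := γ.exists_continuation hne hγT (convex_uIcc (τ n) τ₀)
    ((image_mono hJsub).trans hseg) hJinj ⟨hS0.trans_lt hSs, hs₀I.2⟩ hr₀ left_mem_uIcc
    hr₀s.symm hfirst
  have hanti := hq n γ' h1 (h2 ▸ hγ0) h3
  intro x hx y hy hxy
  obtain ⟨hx1, hx2⟩ := h4 x ⟨hx.1, hx.2.trans hSs.le⟩
  obtain ⟨hy1, hy2⟩ := h4 y ⟨hy.1, hy.2.trans hSs.le⟩
  have := hanti (a := ⟨k * x, hx1⟩) (b := ⟨k * y, hy1⟩)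
    (Subtype.mk_le_mk.2 (mul_le_mul_of_nonneg_left hxy hk.le))
  simp only [← γ'.ext_of_mem, hx2, hy2] at this
  exact this

/-- Monotonicity along a path passes to edge coordinates. -/
theorem eventuallyRegular_of_chart {q : ℕ → G.Point → ℝ} {γ : G.GPath} {e : E} {s₁ s₂ a b : ℝ}
    {c : ℝ → ℝ} (hγ : ∀ s ∈ Icc s₁ s₂, γ.ext s = G.pt e (c s))
    (hmono : StrictMonoOn c (Icc s₁ s₂) ∨ StrictAntiOn c (Icc s₁ s₂))
    (hsub : Ioo a b ⊆ c '' Icc s₁ s₂)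
    (hq : ∀ᶠ n in atTop, AntitoneOn (fun s => q n (γ.ext s)) (Icc s₁ s₂)) :
    EventuallyRegular (fun n s => q n (G.pt e s)) a b := by
  rcases hmono with hm | hm
  · right; left
    filter_upwards [hq] with n hn x hx y hy hxy
    obtain ⟨r, hr, rfl⟩ := hsub hx
    obtain ⟨s, hs, rfl⟩ := hsub hy
    have := hn hr hs ((hm.le_iff_le hr hs).1 hxy)
    simpa only [hγ r hr, hγ s hs] using this
  · left
    filter_upwards [hq] with n hn x hx y hy hxy
    obtain ⟨r, hr, rfl⟩ := hsub hx
    obtain ⟨s, hs, rfl⟩ := hsub hy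
    have := hn hs hr ((hm.le_iff_ge hr hs).1 hxy)
    simpa only [hγ r hr, hγ s hs] using this

/-- Changing a potential at one point does not matter. -/
theorem ae_update_eq [DecidableEq G.Point] (q : G.Point → ℝ) (x : G.Point) (y : ℝ) (e : E) :
    ∀ᵐ t ∂(G.edgeMeasure e), Function.update q x y (G.pt e t) = q (G.pt e t) := by
  have hc : {t ∈ Ioo 0 (G.len e) | G.pt e t ∈ ({x} : Set G.Point)}.Countable :=
    MapsTo.countable_of_injOn (f := G.pt e) (fun t ht => ht.2)
      ((injOn_pt e).mono fun t ht => ht.1) (countable_singleton x)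
  have h1 : ∀ᵐ t ∂(G.edgeMeasure e), t ∉
      {t ∈ Ioo 0 (G.len e) | G.pt e t ∈ ({x} : Set G.Point)} :=
    ae_restrict_of_ae (hc.ae_notMem volume)
  filter_upwards [h1, ae_edgeMeasure_mem_Ioo e] with t ht ht'
  exact Function.update_of_ne (fun h => ht ⟨ht', h⟩) _ _

/-- Points of a subgraph have a subsequence converging within a segment of the subgraph. -/
theorem IsSubgraph.exists_subseq {T : Set G.Point} (hT : G.IsSubgraph T) {a : ℕ → G.Point}
    (ha : ∀ n, a n ∈ T) :
    ∃ (e : E) (α β : ℝ) (ψ : ℕ → ℕ) (τ : ℕ → ℝ) (τ₀ : ℝ), 0 ≤ α ∧ β ≤ G.len e ∧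
      G.pt e '' Icc α β ⊆ T ∧ StrictMono ψ ∧ (∀ n, τ n ∈ Icc α β ∧ G.pt e (τ n) = a (ψ n)) ∧
      τ₀ ∈ Icc α β ∧ Tendsto τ atTop (𝓝 τ₀) := by
  obtain ⟨S, hS, rfl⟩ := hT
  have hfreq : ∃ p ∈ S, ∃ᶠ n in atTop, a n ∈ G.pt p.1 '' Icc p.2.1 p.2.2 := by
    by_contra hcon
    push Not at hcon
    obtain ⟨n, hn⟩ := ((Filter.eventually_all_finset S).2 hcon).exists
    obtain ⟨p, hp, hap⟩ := mem_iUnion₂.1 (ha n)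
    exact hn p hp hap
  obtain ⟨p, hp, hfreq⟩ := hfreq
  obtain ⟨ψ, hψ, hmem⟩ := extraction_of_frequently_atTop hfreq
  choose τ hτ hτa using hmem
  obtain ⟨τ₀, hτ₀, ψ', hψ', hlim⟩ := isCompact_Icc.tendsto_subseq hτ
  exact ⟨p.1, p.2.1, p.2.2, ψ ∘ ψ', τ ∘ ψ', τ₀, (hS p hp).1, (hS p hp).2.2,
    fun x hx => mem_iUnion₂.2 ⟨p, hp, hx⟩, hψ.comp hψ', fun n => ⟨hτ _, hτa _⟩, hτ₀, hlim⟩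

/-- The limit bottom is fixed first, and R is the union of the tree paths from leaves to it. Away
from the leaves and this bottom, the potentials are eventually monotone near each point of R in the
edge coordinate. -/
theorem exists_limit_singleWellClass [Fintype E] {T : Set G.Point} (hT : G.IsTree T) {M : ℝ}
    (hM : 0 ≤ M) {q : ℕ → G.Point → ℝ} (hq : ∀ n, q n ∈ G.singleWellClass T M) :
    ∃ (φ : ℕ → ℕ) (q₀ : G.Point → ℝ), StrictMono φ ∧ q₀ ∈ G.singleWellClass T M ∧
      WeakTendsto (fun n => q (φ n)) q₀ := by
  classical
  choose a haT ha using fun n => (hq n).2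
  obtain ⟨e, α, β, ψ, τ, τ₀, hα, hβ, hseg, hψ, hτ, hτ₀, hlim⟩ := hT.subgraph.exists_subseq haT
  have hanti : ∀ γ : G.GPath, range γ.map ⊆ T → γ.map 0 ∈ G.leaves T → γ.map 1 = G.pt e τ₀ →
      ∀ S, 0 ≤ S → S < 1 →
      ∀ᶠ n in atTop, AntitoneOn (fun s => q (ψ n) (γ.ext s)) (Icc 0 S) :=
    fun γ h1 h2 h3 S hS0 hS => eventually_antitoneOn_ext hT hα hβ hseg (fun n => (hτ n).1) hτ₀ hlim
      (fun n γ h1 h2 h3 => ha (ψ n) γ h1 h2 (h3.trans (hτ n).2)) h1 h2 h3 hS0 hS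
  let F : Set G.GPath := {γ | range γ.map ⊆ T ∧ γ.map 0 ∈ G.leaves T ∧ γ.map 1 = G.pt e τ₀}
  obtain ⟨φ, U, q₀, hφ, hU, hUtop, hq₀, hweak, hpt⟩ := exists_limit_potential hM
    (fun n => (hq (ψ n)).1) (R := ⋃ γ ∈ F, range γ.map)
    ((countable_leaves hT.subgraph).insert (G.pt e τ₀)) (by
      intro e' t ht hR hN
      obtain ⟨γ, hγF, s, hs⟩ := mem_iUnion₂.1 hR
      obtain ⟨h1, h2, h3⟩ := hγF
      have hsI : (s : ℝ) ∈ Ioo (0 : ℝ) 1 := by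
        refine ⟨s.2.1.lt_of_ne fun h => hN ?_, s.2.2.lt_of_ne fun h => hN ?_⟩
        · right
          rw [← hs, show s = 0 from Subtype.ext h.symm]
          exact h2
        · left
          rw [← hs, show s = 1 from Subtype.ext h]
          exact h3
      obtain ⟨s₁, s₂, c, hs₀, h0, h1', hcs, hc, hγ, hmono⟩ :=
        γ.exists_chart hsI ht ((γ.ext_coe s).trans hs)
      obtain ⟨a, b, hab, hsub⟩ := exists_Ioo_subset_image_chart hs₀ hc hmono
      refine ⟨a, b, hcs ▸ hab, fun x hx => ?_, fun x hx => ?_, ?_⟩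
      · obtain ⟨r, hr, rfl⟩ := hsub hx
        exact (hγ r hr).1
      · obtain ⟨r, hr, rfl⟩ := hsub hx
        exact mem_iUnion₂.2 ⟨γ, ⟨h1, h2, h3⟩, _, (hγ r hr).2⟩
      · refine eventuallyRegular_of_chart (γ := γ) (fun r hr => (hγ r hr).2) hmono hsub ?_
        filter_upwards [hanti γ h1 h2 h3 s₂ (by linarith [hs₀.1, hs₀.2]) h1'] with n hn
        exact hn.mono (Icc_subset_Icc_left h0.le))
  -- Monotonicity was obtained only before the final time of each path. The least admissible value
  -- at the bottom secures it at the final time, and changing one point affects neither the class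
  -- bounds nor the weak limit.
  let q₁ := Function.update q₀ (G.pt e τ₀) 0
  have hq₁ : q₁ ∈ G.boundedClass M := by
    refine ⟨fun e' => (hq₀.1 e').congr ?_, fun x => ?_⟩
    · filter_upwards [ae_update_eq q₀ (G.pt e τ₀) 0 e'] with t ht using ht.symm
    · by_cases hx : x = G.pt e τ₀
      · simp only [q₁, hx, Function.update_self]
        exact ⟨le_rfl, hM⟩
      · simp only [q₁, Function.update_of_ne hx]
        exact hq₀.2 x
  refine ⟨fun n => ψ (φ n), q₁, hψ.comp hφ,
    ⟨hq₁, G.pt e τ₀, hseg ⟨τ₀, hτ₀, rfl⟩, fun γ h1 h2 h3 s t hst => ?_⟩, fun e' f hf => ?_⟩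
  · change q₁ (γ.map t) ≤ q₁ (γ.map s)
    have hne := hT.acyclic γ h1
    -- Acyclicity makes the path injective, so the modified point is met only at the end.
    have hnot : ∀ r : unitInterval, r < 1 → γ.map r ≠ G.pt e τ₀ := by
      intro r hr h
      have h4 := γ.injOn_ext_Icc hne r.2 (right_mem_Icc.2 zero_le_one)
        (by rw [γ.ext_coe, γ.ext_one, h, h3])
      exact hr.ne (Subtype.ext h4)
    rcases (unitInterval.le_one' (t := t)).eq_or_lt with rfl | ht
    · rw [h3]
      simp only [q₁, Function.update_self]
      exact (hq₁.2 _).1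
    · simp only [q₁, Function.update_of_ne (hnot t ht), Function.update_of_ne (hnot s (hst.trans_lt ht))]
      have hlim' : ∀ r, Tendsto (fun n => q (ψ (φ n)) (γ.map r)) U (𝓝 (q₀ (γ.map r))) := fun r =>
        hpt _ (mem_iUnion₂.2 ⟨γ, ⟨h1, h2, h3⟩, r, rfl⟩)
      refine le_of_tendsto_of_tendsto (hlim' t) (hlim' s) (hUtop ?_)
      have := hφ.tendsto_atTop.eventually (hanti γ h1 h2 h3 t t.2.1 ht)
      filter_upwards [this] with n hn
      have h5 := hn ⟨s.2.1, hst⟩ ⟨t.2.1, le_rfl⟩ hst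
      simpa only [γ.ext_coe] using h5
  · have h4 : ∫ t, q₁ (G.pt e' t) * f t ∂(G.edgeMeasure e') =
        ∫ t, q₀ (G.pt e' t) * f t ∂(G.edgeMeasure e') := by
      refine integral_congr_ae ?_
      filter_upwards [ae_update_eq q₀ (G.pt e τ₀) 0 e'] with t ht
      simp only [q₁, ht]
    rw [h4]
    exact hweak e' f hf

/-! ### Existence of extremal potentials. -/

/-- A class of potentials that is sequentially compact for weak convergence contains a minimiser and
a maximiser of the gap. -/
theorem exists_isMinOn_isMaxOn_gap [Fintype E] [Nonempty E] {M : ℝ} (hM : 0 ≤ M)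
    {Λ : Set (G.Point → ℝ)} (hΛ : Λ ⊆ G.boundedClass M) (hne : Λ.Nonempty)
    (hlim : ∀ q : ℕ → G.Point → ℝ, (∀ n, q n ∈ Λ) → ∃ (φ : ℕ → ℕ) (q₀ : G.Point → ℝ),
      StrictMono φ ∧ q₀ ∈ Λ ∧ WeakTendsto (fun n => q (φ n)) q₀) :
    (∃ q ∈ Λ, IsMinOn G.gap Λ q) ∧ (∃ q ∈ Λ, IsMaxOn G.gap Λ q) := by
  have hcomp : IsCompact (G.gap '' Λ) := by
    refine IsSeqCompact.isCompact fun x hx => ?_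
    choose q hq hqx using hx
    obtain ⟨φ, q₀, hφ, hq₀, hweak⟩ := hlim q hq
    refine ⟨_, ⟨q₀, hq₀, rfl⟩, φ, hφ, ?_⟩
    have h1 := hweak.tendsto_gap hM (fun n => hΛ (hq (φ n))) (hΛ hq₀)
    exact h1.congr fun n => hqx (φ n)
  constructor
  · obtain ⟨_, ⟨q, hq, rfl⟩, hmin⟩ := hcomp.exists_isLeast (hne.image _)
    exact ⟨q, hq, fun p hp => hmin ⟨p, hp, rfl⟩⟩
  · obtain ⟨_, ⟨q, hq, rfl⟩, hmax⟩ := hcomp.exists_isGreatest (hne.image _)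
    exact ⟨q, hq, fun p hp => hmax ⟨p, hp, rfl⟩⟩

end MetricGraph

theorem mainTheorem1 {E : Type*} [Fintype E] (G : MetricGraph E) [ConnectedSpace G.Point]
    (P : Set G.GPath) (hP : P.Finite) (T : Set G.Point) (hT : G.IsTree T)
    (M : ℝ) (hM : 0 < M) (Λ : Set (G.Point → ℝ))
    (hΛ : Λ = G.convexClass P M ∨ Λ = G.singleWellClass T M) :
    -- the eigenvalues `λ₁(q)` and `λ₂(q)` exist, so that `Γ[q]` is meaningful on `Λ`
    (∀ q ∈ Λ, IsLeast (G.atLeastEigenvalues q 1) (G.eigenvalue q 1) ∧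
      IsLeast (G.atLeastEigenvalues q 2) (G.eigenvalue q 2)) ∧
    (∃ q ∈ Λ, IsMinOn G.gap Λ q) ∧ (∃ q ∈ Λ, IsMaxOn G.gap Λ q) := by
  -- A connected space has a point, and every point lies on an edge.
  have hE : Nonempty E := by
    obtain ⟨x⟩ := (inferInstance : Nonempty G.Point)
    obtain ⟨e, -⟩ := G.exists_pt_eq x
    exact ⟨e⟩
  have hsub : Λ ⊆ G.boundedClass M := by
    rcases hΛ with rfl | rfl <;> exact fun q hq => hq.1
  have h0 := MetricGraph.zero_mem_boundedClass (G := G) hM.le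
  refine ⟨fun q hq => ⟨(MetricGraph.Sobolev.rayleigh_characterization (hsub hq) (Or.inl rfl)).1,
    (MetricGraph.Sobolev.rayleigh_characterization (hsub hq) (Or.inr rfl)).1⟩,
    MetricGraph.exists_isMinOn_isMaxOn_gap hM.le hsub ?_ ?_⟩
  -- The zero potential shows that either class is nonempty; for single wells any point of the tree
  -- serves as its bottom.
  · rcases hΛ with rfl | rfl
    · exact ⟨fun _ => 0, h0, fun γ _ r s t _ _ => by simp⟩
    · obtain ⟨a, ha⟩ := hT.connected.nonempty
      exact ⟨fun _ => 0, h0, a, ha, fun _ _ _ _ => antitone_const⟩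
  · rcases hΛ with rfl | rfl
    · exact fun q hq => MetricGraph.exists_limit_convexClass hP hM.le hq
    · exact fun q hq => MetricGraph.exists_limit_singleWellClass hT hM.le hq
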